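/- Theorem. Let $K$ be an algebraically closed field of characteristic zero (for instance $K=\mathbb C$). Conventions. For integers $0<k<n$, a partition for $\mathrm{Gr}(k,n)$ is a weakly decreasing sequence $n-k\ge\lambda_1\ge\dots\ge\lambda_k\ge 0$ (with $\lambda_j=0$ for $j>k$), and a Schubert problem in $\mathrm{Gr}(k,n)$ is a list $\boldsymbol\lambda=(\lambda^1,\dots,\lambda^s)$ of such partitions (zero partitions are allowed) with $\sum_i|\lambda^i|=k(n-k)$. An instance of $\boldsymbol\lambda$ in an $n$-dimensional vector space $X$ is a list $\mathcal F=(F^1_\bullet,\dots,F^s_\bullet)$ of complete flags in $X$; its set of solutions $\Omega_{\boldsymbol\lambda}\mathcal F\subset\mathrm{Gr}(k,X)$ consists of the $k$-planes $H\subset X$ with $\dim(H\cap F^i_{n-k+j-\lambda^i_j})\ge j$ for all $i=1,\dots,s$ and $j=1,\dots,k$. "General" means: in some nonempty Zariski open (hence dense) subset of the product of flag varieties. Write $\lambda+\mu$ for the componentwise sum of partitions, $c^m$ for the partition with $m$ parts equal to $c$, $(c,d^m)$ for the partition with first part $c$ followed by $m$ parts equal to $d$, and $\square=(1)$, so that $\square^4=(\square,\square,\square,\square)$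 is a Schubert problem in $\mathrm{Gr}(2,4)$. Let $\boldsymbol\lambda$, $\boldsymbol\mu$, $\boldsymbol\nu$ be Schubert problems in $\mathrm{Gr}(k+a,n+b)$, $\mathrm{Gr}(k,n)$, $\mathrm{Gr}(a,b)$, consisting of $s$, $r$, $t$ partitions. We say that $\boldsymbol\lambda$ is fibered over $\boldsymbol\mu$ with fiber $\boldsymbol\nu$ if there are a nonempty Zariski open set $U$ of $s$-tuples of complete flags in $K^{n+b}$ and an assignment to each $\mathcal F\in U$ of a subspace $V\subset K^{n+b}$ of dimension $n$, of an $r$-tuple $\mathcal E$ of complete flags in $V$, and, for every $h\in\Omega_{\boldsymbol\mu}\mathcal E\subset\mathrm{Gr}(k,V)$, of a $t$-tuple $\mathcal G(h)$ of complete flags in $W:=K^{n+b}/V$, such that: 1. for $\mathcal F\in U$ and every $H\in\Omega_{\boldsymbol\lambda}\mathcal F$ we have $H\cap V\in\Omega_{\boldsymbol\mu}\mathcal E$; 2. for $\mathcal F\in U$, $h\in\Omega_{\boldsymbol\mu}\mathcal E$ and $H\in\Omega_{\boldsymbol\lambda}\mathcal F$ with $H\cap V=h$, we have $H/h\in\Omega_{\boldsymbol\nu}\mathcal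 G(h)\subset\mathrm{Gr}(a,W)$, where $H/h=H/(H\cap V)$ is identified with the image of $H$ in $W$; 3. for $\mathcal F\in U$, the map $H\mapsto(h,H/h)$ with $h=H\cap V$ is a bijection from $\Omega_{\boldsymbol\lambda}\mathcal F$ onto the set of pairs $(h,M)$ with $h\in\Omega_{\boldsymbol\mu}\mathcal E$ and $M\in\Omega_{\boldsymbol\nu}\mathcal G(h)$; 4. for every subspace $V\subset K^{n+b}$ of dimension $n$: every general $r$-tuple $\mathcal E$ of flags in $V$ is assigned, together with $V$, to some $\mathcal F\in U$; and for general $\mathcal E$ and every $h\in\Omega_{\boldsymbol\mu}\mathcal E$, every general $t$-tuple of flags in $K^{n+b}/V$ is $\mathcal G(h)$ for some $\mathcal F\in U$ to which $V$ and $\mathcal E$ are assigned. Statement. Let $0<a<b$ be integers with $b\ge 3$ (that is, $(a,b)\ne(1,2)$), and let $$\boldsymbol\nu=\bigl(2^{a-1},\,(b-a-1),\,\nu^3,\,\nu^4,\,\nu^5,\dots,\nu^s\bigr),\qquad s\ge 4,$$ be a Schubert problem in $\mathrm{Gr}(a,b)$. Then $$\boldsymbol\lambda=\bigl((b-a+1,2^a),\,(b-a-1)^2,\,1^{a+1}+\nu^3,\,1^{a+1}+\nu^4,\,\nu^5,\dots,\nu^s\bigr)$$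 is a Schubert problem in $\mathrm{Gr}(2+a,4+b)$, and it is fibered over $\square^4$ in $\mathrm{Gr}(2,4)$ with fiber $\boldsymbol\nu$. -/

import Mathlib

open Module

namespace Schubert

/-! Partitions are sequences `l : ℕ → ℕ`, where `l j` is the length of row `j + 1`.
The componentwise sum of partitions is the pointwise sum of functions. -/

/-- The sequence with the given rows, followed by zeros. -/
def ofRows (rows : List ℕ) : ℕ → ℕ := fun j => rows.getD j 0

/-- `l` is a partition for `Gr(k, n)`: weakly decreasing, at most `k` nonzero rows, and
rows of length at most `n - k`. -/
def IsPartitionFor (k n : ℕ) (l : ℕ → ℕ) : Prop :=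
  Antitone l ∧ l 0 ≤ n - k ∧ l k = 0

/-- A Schubert problem in `Gr(k, n)`: a list of partitions for `Gr(k, n)` whose sizes add up to
`k (n - k)` (used for `0 < k < n`). -/
def IsSchubertProblem (k n : ℕ) {s : ℕ} (lam : Fin s → ℕ → ℕ) : Prop :=
  (∀ i, IsPartitionFor k n (lam i)) ∧
    ∑ i, ∑ j ∈ Finset.range k, lam i j = k * (n - k)

/-- A complete flag in a finite-dimensional vector space `V`: subspaces
`F 0 ⊆ F 1 ⊆ ⋯ ⊆ F (dim V) = V` with `dim (F j) = j`. (Beyond `dim V` the sequence is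
constantly `V`, so that the sequence is determined by the flag.) -/
@[ext]
structure CompleteFlag (K V : Type*) [Field K] [AddCommGroup V] [Module K V] where
  /-- The subspaces of the flag. -/
  sub : ℕ → Submodule K V
  mono : Monotone sub
  finrank_sub : ∀ j, finrank K (sub j) = min j (finrank K V)

section

variable {K V : Type*} [Field K] [AddCommGroup V] [Module K V]

/-- The flag whose `j`-th subspace is spanned by the first `j` vectors of an ordered basis. -/
def CompleteFlag.ofBasis (f : Basis (Fin (finrank K V)) K V) : CompleteFlag K V where
  sub j := Submodule.span K (f '' {i | (i : ℕ) < j})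
  mono := fun _ _ h => Submodule.span_mono (Set.image_mono fun _ hi => lt_of_lt_of_le hi h)
  finrank_sub j := by
    classical
    have h : f '' {i | (i : ℕ) < j} =
        Set.range (f ∘ (Subtype.val : {i : Fin (finrank K V) // (i : ℕ) < j} → _)) := by
      ext x
      simp
    rw [h, finrank_span_eq_card (f.linearIndependent.comp _ Subtype.val_injective),
      Fintype.card_subtype, Fin.card_filter_val_lt, min_comm]

/-- The value of a polynomial in the coordinates (with respect to a reference basis of `V`) of
the vectors of `s` ordered bases of `V`. -/
noncomputable def evalFrames {s : ℕ}
    (p : MvPolynomial (Fin s × Fin (finrank K V) × Fin (finrank K V)) K)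
    [FiniteDimensional K V] (f : Fin s → Basis (Fin (finrank K V)) K V) : K :=
  MvPolynomial.eval (fun x => (finBasis K V).repr (f x.1 x.2.1) x.2.2) p

/-- Zariski open subsets of the product of `s` copies of the variety of complete flags in `V`.
This variety is the quotient of the variety of ordered bases of `V` (which is isomorphic to the
general linear group) by the upper triangular matrices; so a set of tuples of flags is open if and
only if its preimage among the tuples of ordered bases is open, that is, a union of
nonvanishing loci of polynomials in the coordinates. The choice of the reference basis does not
matter. -/
def IsZariskiOpen [FiniteDimensional K V] {s : ℕ}
    (U : Set (Fin s → CompleteFlag K V)) : Prop :=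
  ∀ f : Fin s → Basis (Fin (finrank K V)) K V, (fun i => CompleteFlag.ofBasis (f i)) ∈ U →
    ∃ p : MvPolynomial (Fin s × Fin (finrank K V) × Fin (finrank K V)) K,
      evalFrames p f ≠ 0 ∧
      ∀ g : Fin s → Basis (Fin (finrank K V)) K V, evalFrames p g ≠ 0 →
        (fun i => CompleteFlag.ofBasis (g i)) ∈ U

/-- `P` holds for general `s`-tuples of flags: it holds on a nonempty Zariski open set. (Over an
infinite field, such a set is dense, as the product of flag varieties is irreducible.) -/
def Generally [FiniteDimensional K V] {s : ℕ} (P : (Fin s → CompleteFlag K V) → Prop) : Prop :=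
  ∃ U : Set (Fin s → CompleteFlag K V), IsZariskiOpen U ∧ U.Nonempty ∧ ∀ F ∈ U, P F

/-- The Schubert variety in `Gr(k, V)` of a partition and a flag: with `n = dim V`, the
`k`-planes `H` with `dim (H ∩ F_{n - k + j - l_j}) ≥ j` for `j = 1, …, k`. -/
def schubertVariety (k : ℕ) (l : ℕ → ℕ) (F : CompleteFlag K V) : Set (Submodule K V) :=
  {H | finrank K H = k ∧
    ∀ j < k, j + 1 ≤ finrank K ↥(H ⊓ F.sub (finrank K V - k + (j + 1) - l j))}

/-- The set of solutions in `Gr(k, V)` of the instance of a Schubert problem given by flags. -/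
def solutions (k : ℕ) {s : ℕ} (lam : Fin s → ℕ → ℕ) (F : Fin s → CompleteFlag K V) :
    Set (Submodule K V) :=
  {H | finrank K H = k ∧ ∀ i, H ∈ schubertVariety k (lam i) (F i)}

end

/-- What a fibration attaches to an instance of a Schubert problem in `K^N`: a subspace `V`,
an `r`-tuple `E` of flags in `V`, and for every subspace `h` of `V` a `t`-tuple `G h` of flags in
the quotient `K^N / V` (only its values at the solutions `h` of the instance `E` matter). -/
structure FibrationDatum (K : Type*) [Field K] (N r t : ℕ) where
  V : Submodule K (Fin N → K)
  E : Fin r → CompleteFlag K V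
  G : Submodule K V → Fin t → CompleteFlag K ((Fin N → K) ⧸ V)

/-- The Schubert problem `lam` in `Gr(k + a, n + b)` is fibered over `mu` in `Gr(k, n)` with
fiber `nu` in `Gr(a, b)`. Here `U` is the set of general instances of `lam`. For a subspace `H`
of `K^(n + b)`, `H.comap V.subtype` is `h = H ∩ V` as a subspace of `V`, and `H.map V.mkQ`, the
image of `H` in `W = K^(n + b) / V`, is `H / h`. -/
def IsFibered (K : Type*) [Field K] (k n a b : ℕ) {s r t : ℕ}
    (lam : Fin s → ℕ → ℕ) (mu : Fin r → ℕ → ℕ) (nu : Fin t → ℕ → ℕ) : Prop :=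
  ∃ (U : Set (Fin s → CompleteFlag K (Fin (n + b) → K)))
    (D : (Fin s → CompleteFlag K (Fin (n + b) → K)) → FibrationDatum K (n + b) r t),
    IsZariskiOpen U ∧ U.Nonempty ∧
    -- solutions `H` give solutions `H ∩ V` of the base problem
    (∀ F ∈ U, finrank K (D F).V = n ∧
      ∀ H ∈ solutions (k + a) lam F, H.comap (D F).V.subtype ∈ solutions k mu (D F).E) ∧
    -- and solutions `H / h` of the problem in the fiber over `h = H ∩ V`
    (∀ F ∈ U, ∀ h ∈ solutions k mu (D F).E, ∀ H ∈ solutions (k + a) lam F,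
      H.comap (D F).V.subtype = h → H.map (D F).V.mkQ ∈ solutions a nu ((D F).G h)) ∧
    -- `H ↦ (h, H / h)` is a bijection
    (∀ F ∈ U, Set.BijOn (fun H => (H.comap (D F).V.subtype, H.map (D F).V.mkQ))
      (solutions (k + a) lam F)
      {p | p.1 ∈ solutions k mu (D F).E ∧ p.2 ∈ solutions a nu ((D F).G p.1)}) ∧
    -- for given `V`, all general `E` arise; for general `E` and each `h`, all general `G h` arise
    (∀ V : Submodule K (Fin (n + b) → K), finrank K V = n →
      Generally (fun E : Fin r → CompleteFlag K V => ∃ F ∈ U, ∃ G, D F = ⟨V, E, G⟩) ∧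
      Generally (fun E : Fin r → CompleteFlag K V => ∀ h ∈ solutions k mu E,
        Generally (fun G₀ : Fin t → CompleteFlag K ((Fin (n + b) → K) ⧸ V) =>
          ∃ F ∈ U, ∃ G, D F = ⟨V, E, G⟩ ∧ G h = G₀)))

end Schubert

open Schubert

/-! Write `F⁰, F¹, F², F³` for the first four flags of a general instance in a space `X` of
dimension `b + 4`. A solution `H`, of dimension `a + 2`, meets `F⁰_2` in dimension at least 1,
`F⁰_{b+1}` in at least `a + 1`, `F¹_5` in at least 2, and each of `F²_{b+2}`, `F³_{b+2}` in at least
`a + 1`. Put `P = F¹_5 ∩ F⁰_{b+1}`, which has dimension 2, and `V = F⁰_2 ⊕ P` (`baseSpace`).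
Dimension counts inside `H` show that `H` meets `P`, and that `h = H ∩ V` meets `F²_{b+2}` and
`F³_{b+2}`; generality forces `dim h = 2`. So `h` meets four two-dimensional subspaces of `V`, which
is the problem of four lines (`IsGeneral.isBasePlane_inf`).

Conversely `h` confines `H`: since `H ∩ F²_{b+2}` has dimension at least `a + 1` and meets `h` only
in a line, `H = (H ∩ F²_{b+2}) + h`, and likewise for `F³`. Hence `H` lies in `L = (F²_{b+2} + h) ∩
(F³_{b+2} + h)` (`liftSpace`, `IsGeneral.le_liftSpace`). For general flags `L ∩ V = h` and `L + V =
X`, so `L / h` is `X / V`, and subspaces between `h` and `L` correspond to subspaces of `X / V`. The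
images of the traces `L ∩ F^i_m` form the flags of the fiber problem, and its conditions are exactly
what is left of those on `H` (`IsBasePlane.mem_solutions_iff`).

The required generality (`IsGeneral`) is obtained from a dimension count in coordinates. Pairs of a
tuple of frames and a subspace in fixed relative position are parametrized polynomially. If there
are fewer parameters than coordinates of frames, or equally many subject to one further equation,
transcendence degree puts the image in a hypersurface (`exists_ne_zero_vanishing_on_image`). There
are finitely many relative positions, so general frames avoid all these hypersurfaces
(`onFrames_forall_solutions`).

For the last clause of a fibration the flags are moved independently: by automorphisms of `X` that
extend automorphisms of `V`, to vary the flags in `V`, and by automorphisms trivial on `V` that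
preserve `L`, to vary those in `X / V`. As long as the tuple stays general, `V` does not change. The
moved frames depend polynomially on the target frames and pass through the original ones, so a
general target is reached within the open set. -/

namespace Schubert

/-! ### Polynomial maps that are not dominant. -/

section Polynomials

/-- A hypersurface in `n`-dimensional affine space is not mapped dominantly to a space of
dimension at least `n` by a polynomial map, nor is the whole space if the target is bigger. -/
theorem exists_ne_zero_vanishing_on_image {K τ κ : Type*} [Field K] [Fintype τ] [Fintype κ]
    (g : κ → MvPolynomial τ K) (q : MvPolynomial τ K)
    (hcard : Fintype.card τ ≤ Fintype.card κ) (hq : Fintype.card τ < Fintype.card κ ∨ q ≠ 0) :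
    ∃ r : MvPolynomial κ K, r ≠ 0 ∧ ∀ x : τ → K, MvPolynomial.eval x q = 0 →
      MvPolynomial.eval (fun j => MvPolynomial.eval x (g j)) r = 0 := by
  classical
  have key : ∀ (x : τ → K) (r : MvPolynomial κ K),
      MvPolynomial.eval (fun j => MvPolynomial.eval x (g j)) r =
        MvPolynomial.eval x (MvPolynomial.aeval g r) := by
    intro x r
    induction r using MvPolynomial.induction_on with
    | C a => simp
    | add p q hp hq => simp [hp, hq]
    | mul_X p i hp => simp [hp]
  have trd : Algebra.trdeg K (MvPolynomial τ K) = (Fintype.card τ : Cardinal) := by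
    rw [MvPolynomial.trdeg_of_isDomain]; simp
  by_cases hg : AlgebraicIndependent K g
  · have h1 := hg.lift_cardinalMk_le_trdeg
    rw [trd] at h1
    simp only [Cardinal.mk_fintype, Cardinal.lift_natCast, Nat.cast_le] at h1
    have hq0 : q ≠ 0 := hq.resolve_left (by omega)
    have h2 : ¬ AlgebraicIndependent K (fun o : Option κ => o.elim q g) := by
      intro h
      have h3 := h.lift_cardinalMk_le_trdeg
      rw [trd] at h3
      simp only [Cardinal.mk_fintype, Cardinal.lift_natCast, Nat.cast_le,
        Fintype.card_option] at h3
      omega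
    rw [AlgebraicIndependent.option_iff] at h2
    -- The `g j` now have the full transcendence degree, so `q` is a root of some `P` over `K[g]`
    -- with nonzero constant coefficient. The equation `P(q) = 0` makes that coefficient a multiple
    -- of `q`, and as an element of `K[g]` it is `r` evaluated at `g`.
    have h3 : IsAlgebraic (Algebra.adjoin K (Set.range g)) q := by
      by_contra hc
      exact h2 ⟨hg, hc⟩
    obtain ⟨P, hP0, hP⟩ := h3.exists_nonzero_coeff_and_aeval_eq_zero
      (mem_nonZeroDivisors_of_ne_zero hq0)
    have h4 : ((P.coeff 0 : Algebra.adjoin K (Set.range g)) : MvPolynomial τ K) ∈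
        Algebra.adjoin K (Set.range g) := (P.coeff 0).2
    have h4' := (Algebra.adjoin_range_eq_range_aeval K g).le h4
    obtain ⟨r, hr⟩ := h4'
    refine ⟨r, ?_, ?_⟩
    · rintro rfl
      apply hP0
      ext1
      simpa using hr.symm
    · intro x hx
      have hr' : MvPolynomial.aeval g r = ((P.coeff 0 : Algebra.adjoin K (Set.range g)) :
          MvPolynomial τ K) := hr
      rw [key, hr']
      have h5 := hP
      rw [← Polynomial.divX_mul_X_add P] at h5
      simp only [map_add, map_mul, Polynomial.aeval_X, Polynomial.aeval_C] at h5
      have h6 := congrArg (MvPolynomial.eval x) h5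
      simp only [map_add, map_mul, hx, mul_zero, zero_add, map_zero] at h6
      exact h6
  · rw [algebraicIndependent_iff] at hg
    push Not at hg
    obtain ⟨r, hr, hr0⟩ := hg
    exact ⟨r, hr0, fun x _ => by rw [key, hr, map_zero]⟩

end Polynomials

/-! ### Frames, and open sets of tuples of flags. -/

section Frames

variable {K V : Type*} [Field K] [AddCommGroup V] [Module K V]

/-- The tuple of flags of a tuple of frames. -/
def flagsOf {s : ℕ} (f : Fin s → Basis (Fin (finrank K V)) K V) : Fin s → CompleteFlag K V :=
  fun i => CompleteFlag.ofBasis (f i)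

variable [FiniteDimensional K V]

/-- The flag spanned by an adapted basis. -/
theorem CompleteFlag.exists_ofBasis (F : CompleteFlag K V) :
    ∃ f : Basis (Fin (finrank K V)) K V, CompleteFlag.ofBasis f = F := by
  have h0 : ∀ j : Fin (finrank K V), ∃ v, v ∈ F.sub (j + 1) ∧ v ∉ F.sub j := by
    intro j
    have : ¬ F.sub (j + 1) ≤ F.sub j := by
      intro h
      have := Submodule.finrank_mono h
      rw [F.finrank_sub, F.finrank_sub] at this
      have := j.2
      omega
    exact Set.not_subset.mp this
  choose v hv1 hv2 using h0
  have hspan : ∀ m ≤ finrank K V,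
      Submodule.span K (v '' {i | (i : ℕ) < m}) = F.sub m := by
    intro m
    induction m with
    | zero =>
      intro _
      have : F.sub 0 = ⊥ := by
        rw [← Submodule.finrank_eq_zero (R := K), F.finrank_sub]; simp
      simp [this]
    | succ m ih =>
      intro hm
      have ihm := ih (by omega)
      have hle : Submodule.span K (v '' {i | (i : ℕ) < m + 1}) ≤ F.sub (m + 1) := by
        rw [Submodule.span_le]
        rintro _ ⟨i, hi, rfl⟩
        exact F.mono (show (i : ℕ) + 1 ≤ m + 1 from Nat.succ_le_of_lt hi) (hv1 i)
      have hlt : F.sub m < Submodule.span K (v '' {i | (i : ℕ) < m + 1}) := by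
        refine lt_of_le_of_ne ?_ ?_
        · rw [← ihm]
          exact Submodule.span_mono (Set.image_mono fun i hi => Nat.lt_succ_of_lt hi)
        · intro h
          apply hv2 ⟨m, hm⟩
          show v ⟨m, hm⟩ ∈ F.sub m
          rw [h]
          exact Submodule.subset_span ⟨⟨m, hm⟩, Nat.lt_succ_self m, rfl⟩
      refine Submodule.eq_of_le_of_finrank_le hle ?_
      have := Submodule.finrank_lt_finrank_of_lt hlt
      rw [F.finrank_sub] at this ⊢
      omega
  have htop : ⊤ ≤ Submodule.span K (Set.range v) := by
    have h1 := hspan _ le_rfl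
    have h2 : F.sub (finrank K V) = ⊤ := by
      apply Submodule.eq_top_of_finrank_eq
      rw [F.finrank_sub]; simp
    rw [← h2, ← h1]
    exact Submodule.span_mono (Set.image_subset_range _ _)
  refine ⟨basisOfTopLeSpanOfCardEqFinrank v htop (by simp), ?_⟩
  ext1
  funext m
  rcases le_or_gt m (finrank K V) with hm | hm
  · simp only [CompleteFlag.ofBasis, coe_basisOfTopLeSpanOfCardEqFinrank]
    exact hspan m hm
  · have : ∀ G : CompleteFlag K V, G.sub m = ⊤ := by
      intro G
      apply Submodule.eq_top_of_finrank_eq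
      rw [G.finrank_sub]; omega
    rw [this, this]

theorem exists_flagsOf {s : ℕ} (F : Fin s → CompleteFlag K V) :
    ∃ f : Fin s → Basis (Fin (finrank K V)) K V, flagsOf f = F := by
  choose f hf using fun i => (F i).exists_ofBasis
  exact ⟨f, funext hf⟩

/-- A nonzero polynomial in the coordinates does not vanish at some tuple of frames. -/
theorem exists_evalFrames_ne_zero [Infinite K] {s : ℕ}
    (p : MvPolynomial (Fin s × Fin (finrank K V) × Fin (finrank K V)) K) (hp : p ≠ 0) :
    ∃ f : Fin s → Basis (Fin (finrank K V)) K V, evalFrames p f ≠ 0 := by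
  classical
  let D : Fin s → MvPolynomial (Fin s × Fin (finrank K V) × Fin (finrank K V)) K := fun i =>
    MvPolynomial.rename (fun x : Fin (finrank K V) × Fin (finrank K V) => (i, x.1, x.2))
      (Matrix.mvPolynomialX (Fin (finrank K V)) (Fin (finrank K V)) K).det
  have hD : ∀ i, D i ≠ 0 := by
    intro i h
    have hinj : Function.Injective
        (fun x : Fin (finrank K V) × Fin (finrank K V) => (i, x.1, x.2)) := by
      rintro ⟨a, b⟩ ⟨c, d⟩ h
      simpa using h
    exact Matrix.det_mvPolynomialX_ne_zero (Fin (finrank K V)) K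
      ((MvPolynomial.rename_injective _ hinj) (by rw [map_zero]; exact h))
  -- The determinants ensure that the point found consists of bases, not just of tuples of vectors.
  have hne : p * ∏ i, D i ≠ 0 := mul_ne_zero hp (Finset.prod_ne_zero_iff.mpr fun i _ => hD i)
  obtain ⟨x, hx⟩ : ∃ x, MvPolynomial.eval x (p * ∏ i, D i) ≠ 0 := by
    by_contra h
    push Not at h
    exact hne (MvPolynomial.funext fun x => by simpa using h x)
  rw [map_mul, map_prod] at hx
  have hx1 := left_ne_zero_of_mul hx
  have hx2 := Finset.prod_ne_zero_iff.mp (right_ne_zero_of_mul hx)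
  let A : Fin s → Matrix (Fin (finrank K V)) (Fin (finrank K V)) K := fun i =>
    Matrix.of fun m c => x (i, m, c)
  have hA : ∀ i, (A i).det ≠ 0 := by
    intro i
    have h1 := hx2 i (Finset.mem_univ _)
    have h2 : MvPolynomial.eval x (D i) = (A i).det := by
      simp only [D, MvPolynomial.eval_rename]
      rw [RingHom.map_det]
      congr 1
      ext m c
      simp [A, Matrix.mvPolynomialX]
    rwa [h2] at h1
  let v : Fin s → Fin (finrank K V) → V := fun i m => (finBasis K V).equivFun.symm (A i m)
  have hli : ∀ i, LinearIndependent K (v i) := by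
    intro i
    have h1 : LinearIndependent K (A i).row := by
      rw [Matrix.linearIndependent_rows_iff_isUnit, Matrix.isUnit_iff_isUnit_det]
      exact (hA i).isUnit
    exact h1.map' ((finBasis K V).equivFun.symm : (Fin (finrank K V) → K) →ₗ[K] V)
      (LinearEquiv.ker _)
  refine ⟨fun i => basisOfTopLeSpanOfCardEqFinrank (v i)
    ((hli i).span_eq_top_of_card_eq_finrank' (by simp)).ge (by simp), ?_⟩
  convert hx1 using 1
  unfold evalFrames
  congr 2
  funext y
  obtain ⟨i, m, c⟩ := y
  simp only [coe_basisOfTopLeSpanOfCardEqFinrank, v]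
  rw [← Basis.equivFun_apply, LinearEquiv.apply_symm_apply]
  rfl

/-- The property `P` of tuples of flags holds outside a hypersurface in the space of frames. -/
def OnFrames {s : ℕ} (P : (Fin s → CompleteFlag K V) → Prop) : Prop :=
  ∃ r : MvPolynomial (Fin s × Fin (finrank K V) × Fin (finrank K V)) K, r ≠ 0 ∧
    ∀ f : Fin s → Basis (Fin (finrank K V)) K V, evalFrames r f ≠ 0 → P (flagsOf f)

theorem OnFrames.and {s : ℕ} {P Q : (Fin s → CompleteFlag K V) → Prop} (hP : OnFrames P)
    (hQ : OnFrames Q) : OnFrames fun F => P F ∧ Q F := by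
  obtain ⟨p, hp, hp'⟩ := hP
  obtain ⟨q, hq, hq'⟩ := hQ
  refine ⟨p * q, mul_ne_zero hp hq, fun f hf => ?_⟩
  unfold evalFrames at hf
  rw [map_mul] at hf
  exact ⟨hp' f (left_ne_zero_of_mul hf), hq' f (right_ne_zero_of_mul hf)⟩

theorem OnFrames.forall_fintype {s : ℕ} {ι : Type*} [Fintype ι]
    {P : ι → (Fin s → CompleteFlag K V) → Prop} (hP : ∀ i, OnFrames (P i)) :
    OnFrames fun F => ∀ i, P i F := by
  choose p hp hp' using hP
  refine ⟨∏ i, p i, Finset.prod_ne_zero_iff.mpr fun i _ => hp i, fun f hf i => hp' i f ?_⟩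
  unfold evalFrames at hf
  rw [map_prod] at hf
  exact Finset.prod_ne_zero_iff.mp hf i (Finset.mem_univ _)

theorem OnFrames.mono {s : ℕ} {P Q : (Fin s → CompleteFlag K V) → Prop} (hP : OnFrames P)
    (h : ∀ F, P F → Q F) : OnFrames Q := by
  obtain ⟨p, hp, hp'⟩ := hP
  exact ⟨p, hp, fun f hf => h _ (hp' f hf)⟩

/-- The Zariski interior of a property of tuples of flags. -/
def zariskiInterior {s : ℕ} (P : (Fin s → CompleteFlag K V) → Prop) :
    Set (Fin s → CompleteFlag K V) :=
  {F | ∃ (f : Fin s → Basis (Fin (finrank K V)) K V)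
    (p : MvPolynomial (Fin s × Fin (finrank K V) × Fin (finrank K V)) K),
    flagsOf f = F ∧ evalFrames p f ≠ 0 ∧
      ∀ g : Fin s → Basis (Fin (finrank K V)) K V, evalFrames p g ≠ 0 → P (flagsOf g)}

theorem zariskiInterior_subset {s : ℕ} {P : (Fin s → CompleteFlag K V) → Prop}
    {F : Fin s → CompleteFlag K V} (hF : F ∈ zariskiInterior P) : P F := by
  obtain ⟨f, p, rfl, h, h'⟩ := hF
  exact h' f h

theorem OnFrames.nonempty_interior [Infinite K] {s : ℕ} {P : (Fin s → CompleteFlag K V) → Prop}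
    (hP : OnFrames P) : (zariskiInterior P).Nonempty := by
  obtain ⟨p, hp, hp'⟩ := hP
  obtain ⟨f, hf⟩ := exists_evalFrames_ne_zero p hp
  exact ⟨flagsOf f, f, p, rfl, hf, hp'⟩

/-- Polynomial substitution in the coordinates of frames. -/
theorem exists_evalFrames_comp {V₁ V₂ : Type*} [AddCommGroup V₁] [Module K V₁]
    [FiniteDimensional K V₁] [AddCommGroup V₂] [Module K V₂] [FiniteDimensional K V₂] {r s : ℕ}
    (Ψ : (Fin r → Basis (Fin (finrank K V₁)) K V₁) → Fin s → Basis (Fin (finrank K V₂)) K V₂)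
    (hΨ : ∀ i m c, ∃ φ : MvPolynomial (Fin r × Fin (finrank K V₁) × Fin (finrank K V₁)) K,
      ∀ e, evalFrames φ e = (finBasis K V₂).repr (Ψ e i m) c)
    (p : MvPolynomial (Fin s × Fin (finrank K V₂) × Fin (finrank K V₂)) K) :
    ∃ p' : MvPolynomial (Fin r × Fin (finrank K V₁) × Fin (finrank K V₁)) K,
      ∀ e, evalFrames p' e = evalFrames p (Ψ e) := by
  choose φ hφ using hΨ
  refine ⟨MvPolynomial.bind₁ (fun x => φ x.1 x.2.1 x.2.2) p, fun e => ?_⟩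
  unfold evalFrames
  rw [← MvPolynomial.coe_aeval_eq_eval, RingHom.coe_coe, MvPolynomial.aeval_bind₁,
    ← MvPolynomial.coe_aeval_eq_eval, RingHom.coe_coe]
  congr 2
  funext x
  rw [← hφ]
  unfold evalFrames
  rw [MvPolynomial.aeval_eq_eval]

theorem exists_evalFrames_eq_const {r : ℕ} (a : K) :
    ∃ φ : MvPolynomial (Fin r × Fin (finrank K V) × Fin (finrank K V)) K,
      ∀ e : Fin r → Basis (Fin (finrank K V)) K V, evalFrames φ e = a :=
  ⟨MvPolynomial.C a, fun e => by simp [evalFrames]⟩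

theorem exists_evalFrames_eq_add {r : ℕ} {a b : (Fin r → Basis (Fin (finrank K V)) K V) → K}
    (ha : ∃ φ : MvPolynomial (Fin r × Fin (finrank K V) × Fin (finrank K V)) K,
      ∀ e, evalFrames φ e = a e)
    (hb : ∃ φ : MvPolynomial (Fin r × Fin (finrank K V) × Fin (finrank K V)) K,
      ∀ e, evalFrames φ e = b e) :
    ∃ φ : MvPolynomial (Fin r × Fin (finrank K V) × Fin (finrank K V)) K,
      ∀ e, evalFrames φ e = a e + b e := by
  obtain ⟨φ, hφ⟩ := ha
  obtain ⟨ψ, hψ⟩ := hb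
  refine ⟨φ + ψ, fun e => ?_⟩
  rw [← hφ, ← hψ]
  simp [evalFrames]

/-- A linear function of the vectors of one frame is polynomial in the coordinates. -/
theorem exists_evalFrames_eq_sum {r : ℕ} (i : Fin r) (ℓ : Fin (finrank K V) → V →ₗ[K] K) :
    ∃ φ : MvPolynomial (Fin r × Fin (finrank K V) × Fin (finrank K V)) K,
      ∀ e : Fin r → Basis (Fin (finrank K V)) K V, evalFrames φ e = ∑ j, ℓ j (e i j) := by
  refine ⟨∑ j, ∑ c, MvPolynomial.C (ℓ j (finBasis K V c)) * MvPolynomial.X (i, j, c),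
    fun e => ?_⟩
  unfold evalFrames
  simp only [map_sum, map_mul, MvPolynomial.eval_C, MvPolynomial.eval_X]
  refine Finset.sum_congr rfl fun j _ => ?_
  conv_rhs => rw [← (finBasis K V).sum_repr (e i j)]
  simp only [map_sum, map_smul, smul_eq_mul]
  exact Finset.sum_congr rfl fun c _ => mul_comm _ _

/-- Openness must be tested at every frame `f` of the flags, whereas the interior supplies a
polynomial at one frame `f'`. Let `A i g` carry `f i` to `g i`. Applied to `f' i` it gives a frame
`Ψ g i` that is linear in `g i`, spans the same flag as `g i`, and equals `f' i` at `g = f`; so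
pulling the polynomial back along `Ψ` transfers the test to `f`. -/
theorem isZariskiOpen_interior {s : ℕ} (P : (Fin s → CompleteFlag K V) → Prop) :
    IsZariskiOpen (zariskiInterior P) := by
  rintro f ⟨f', p, hff', hp, hP⟩
  have hff : ∀ i m, f' i m = ∑ l, (f i).repr (f' i m) l • f i l := fun i m =>
    ((f i).sum_repr _).symm
  let A : ∀ i, (Fin s → Basis (Fin (finrank K V)) K V) → (V ≃ₗ[K] V) := fun i g =>
    (f i).equiv (g i) (Equiv.refl _)
  let Ψ : (Fin s → Basis (Fin (finrank K V)) K V) → Fin s → Basis (Fin (finrank K V)) K V :=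
    fun g i => (f' i).map (A i g)
  obtain ⟨p', hp'⟩ := exists_evalFrames_comp Ψ (by
    intro i m c
    obtain ⟨φ, hφ⟩ := exists_evalFrames_eq_sum i
      (fun l => (f i).repr (f' i m) l • (finBasis K V).coord c)
    refine ⟨φ, fun e => ?_⟩
    rw [hφ]
    have h1 : (Ψ e i) m = ∑ l, (f i).repr (f' i m) l • e i l := by
      simp only [Ψ, Basis.map_apply]
      conv_lhs => rw [hff i m]
      rw [map_sum]
      simp [A]
    rw [h1]
    simp) p
  have hflag : ∀ g, flagsOf (Ψ g) = flagsOf g := by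
    intro g
    funext i
    have hmap : ∀ (h : Basis (Fin (finrank K V)) K V) m, (CompleteFlag.ofBasis (h.map (A i g))).sub m
        = ((CompleteFlag.ofBasis h).sub m).map (A i g : V →ₗ[K] V) := by
      intro h m
      simp only [CompleteFlag.ofBasis]
      rw [Submodule.map_span, ← Set.image_comp]
      rfl
    have h2 : (f i).map (A i g) = g i := by
      apply Basis.eq_of_apply_eq
      intro j
      simp [A]
    have h1 := congrArg CompleteFlag.sub (congrFun hff' i)
    ext1
    funext m
    have h3 := congrFun h1 m
    show (CompleteFlag.ofBasis ((f' i).map (A i g))).sub m = _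
    rw [hmap]
    change (CompleteFlag.ofBasis (f' i)).sub m = (CompleteFlag.ofBasis (f i)).sub m at h3
    rw [h3, ← hmap, h2]
    rfl
  refine ⟨p', ?_, fun g hg => ⟨Ψ g, p, hflag g, by rwa [← hp'], hP⟩⟩
  rw [hp']
  have : Ψ f = f' := by
    funext i
    apply Basis.eq_of_apply_eq
    intro j
    have : A i f = LinearEquiv.refl K V := by
      apply (f i).ext'
      intro j
      simp [A]
    simp [Ψ, this]
  rwa [this]

/-- If a polynomial family of tuples of frames meets the nonvanishing locus of a polynomial, then
general members of the family lie in it. -/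
theorem generally_of_family {V₁ V₂ : Type*} [AddCommGroup V₁] [Module K V₁]
    [FiniteDimensional K V₁] [AddCommGroup V₂] [Module K V₂] [FiniteDimensional K V₂] {r s : ℕ}
    (Ψ : (Fin r → Basis (Fin (finrank K V₁)) K V₁) → Fin s → Basis (Fin (finrank K V₂)) K V₂)
    (hΨ : ∀ i m c, ∃ φ : MvPolynomial (Fin r × Fin (finrank K V₁) × Fin (finrank K V₁)) K,
      ∀ e, evalFrames φ e = (finBasis K V₂).repr (Ψ e i m) c)
    (p : MvPolynomial (Fin s × Fin (finrank K V₂) × Fin (finrank K V₂)) K)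
    (e₀ : Fin r → Basis (Fin (finrank K V₁)) K V₁) (h₀ : evalFrames p (Ψ e₀) ≠ 0)
    (P : (Fin r → CompleteFlag K V₁) → Prop)
    (hP : ∀ e, evalFrames p (Ψ e) ≠ 0 → P (flagsOf e)) : Generally P := by
  obtain ⟨p', hp'⟩ := exists_evalFrames_comp Ψ hΨ p
  have h : ∀ e, evalFrames p' e ≠ 0 → P (flagsOf e) := fun e he => hP e (by rwa [← hp'])
  exact ⟨zariskiInterior P, isZariskiOpen_interior P,
    ⟨flagsOf e₀, e₀, p', rfl, by rwa [hp'], h⟩, fun F hF => zariskiInterior_subset hF⟩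

theorem Generally.mono {s : ℕ} {P Q : (Fin s → CompleteFlag K V) → Prop} (hP : Generally P)
    (h : ∀ F, P F → Q F) : Generally Q := by
  obtain ⟨U, h1, h2, h3⟩ := hP
  exact ⟨U, h1, h2, fun F hF => h F (h3 F hF)⟩

end Frames

/-! ### Inversions of the set of jumps and sizes of partitions. -/

section Counting

/-- The number of elements of `J` below the `j`-th element is `j`. -/
theorem card_filter_lt_orderEmbOfFin {d k : ℕ} {J : Finset (Fin d)} (hJ : J.card = k)
    (j : Fin k) : (J.filter fun l => l < J.orderEmbOfFin hJ j).card = j := by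
  have h : (J.filter fun l => l < J.orderEmbOfFin hJ j) =
      (Finset.univ.filter fun i : Fin k => i < j).map (J.orderEmbOfFin hJ).toEmbedding := by
    ext l
    simp only [Finset.mem_filter, Finset.mem_map, Finset.mem_univ, true_and]
    constructor
    · rintro ⟨h1, h2⟩
      have h3 : l ∈ Set.range (J.orderEmbOfFin hJ) := by rw [Finset.range_orderEmbOfFin]; exact h1
      obtain ⟨i, rfl⟩ := h3
      exact ⟨i, by simpa using h2, rfl⟩
    · rintro ⟨i, h1, rfl⟩
      exact ⟨Finset.orderEmbOfFin_mem _ _ _, by simpa using h1⟩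
  rw [h, Finset.card_map]
  simp only [Fin.lt_def]
  rw [Fin.card_filter_val_lt]
  have := j.2
  omega

/-- The pairs formed by an element of `J` and a smaller element of the complement. -/
def inversions {d : ℕ} (J : Finset (Fin d)) : Finset (Fin d × Fin d) :=
  Finset.univ.filter fun x => x.1 ∈ J ∧ x.2 ∉ J ∧ x.2 < x.1

/-- Of the elements below the `j`-th element of `J`, exactly `j` belong to `J`; the others are its
inversions. -/
theorem card_inversions {d k : ℕ} {J : Finset (Fin d)} (hJ : J.card = k) :
    (inversions J).card = ∑ j : Fin k, ((J.orderEmbOfFin hJ j : ℕ) - j) ∧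
      ∀ j : Fin k, (j : ℕ) ≤ J.orderEmbOfFin hJ j := by
  have hle : ∀ j : Fin k, (J.filter fun l => l < J.orderEmbOfFin hJ j).card +
      ((Finset.univ.filter fun l : Fin d => l ∉ J ∧ l < J.orderEmbOfFin hJ j)).card =
        (J.orderEmbOfFin hJ j : ℕ) := by
    intro j
    rw [← Finset.card_union_of_disjoint]
    · have : (J.filter fun l => l < J.orderEmbOfFin hJ j) ∪
        (Finset.univ.filter fun l : Fin d => l ∉ J ∧ l < J.orderEmbOfFin hJ j) =
        Finset.univ.filter fun l : Fin d => (l : ℕ) < (J.orderEmbOfFin hJ j : ℕ) := by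
        ext l
        simp only [Finset.mem_union, Finset.mem_filter, Finset.mem_univ, true_and, Fin.lt_def]
        tauto
      rw [this, Fin.card_filter_val_lt]
      have := (J.orderEmbOfFin hJ j).2
      omega
    · rw [Finset.disjoint_left]
      intro l h1 h2
      simp only [Finset.mem_filter] at h1 h2
      exact h2.2.1 h1.1
  have hle' : ∀ j : Fin k, (j : ℕ) ≤ J.orderEmbOfFin hJ j := by
    intro j
    have := hle j
    rw [card_filter_lt_orderEmbOfFin] at this
    omega
  refine ⟨?_, hle'⟩
  have h1 : inversions J = J.biUnion fun m =>
      (Finset.univ.filter fun l : Fin d => l ∉ J ∧ l < m).image fun l => (m, l) := by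
    ext ⟨m, l⟩
    simp [inversions]
  rw [h1, Finset.card_biUnion]
  · have h2 : J = Finset.univ.map (J.orderEmbOfFin hJ).toEmbedding := by simp
    simp only [Finset.card_image_of_injective _ (Prod.mk_right_injective _)]
    conv_lhs => rw [h2]
    rw [Finset.sum_map]
    refine Finset.sum_congr rfl fun j _ => ?_
    have := hle j
    rw [card_filter_lt_orderEmbOfFin] at this
    simp only [Finset.map_orderEmbOfFin_univ, RelEmbedding.coe_toEmbedding]
    omega
  · intro m _ m' _ hmm
    rw [Function.onFun, Finset.disjoint_left]
    rintro ⟨x, y⟩ h1 h2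
    simp only [Finset.mem_image, Prod.mk.injEq] at h1 h2
    obtain ⟨_, _, rfl, _⟩ := h1
    obtain ⟨_, _, h, _⟩ := h2
    exact hmm h.symm

/-- A Schubert condition bounds the `j`-th jump by `d - k + j - l j` (counting from zero), hence its
number of inversions by `d - k - l j`. Equality of the sums forces every jump to its maximum, so
only the open cell can have full dimension. -/
theorem card_inversions_add_le {d k : ℕ} {J : Finset (Fin d)} (hJ : J.card = k) (l : ℕ → ℕ)
    (hl : ∀ j < k, l j ≤ d - k)
    (h : ∀ j < k, j + 1 ≤ (J.filter fun m : Fin _ => (m : ℕ) < d - k + (j + 1) - l j).card) :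
    (inversions J).card + ∑ j ∈ Finset.range k, l j ≤ k * (d - k) ∧
      ((inversions J).card + ∑ j ∈ Finset.range k, l j = k * (d - k) →
        ∀ j : Fin k, (J.orderEmbOfFin hJ j : ℕ) + l j = d - k + j) := by
  obtain ⟨h1, h2⟩ := card_inversions hJ
  have h3 : ∀ j : Fin k, (J.orderEmbOfFin hJ j : ℕ) < d - k + (j + 1) - l j := by
    intro j
    by_contra hc
    push Not at hc
    have h4 := h j j.2
    have h5 : (J.filter fun m : Fin _ => (m : ℕ) < d - k + (j + 1) - l j) ⊆
        J.filter fun m => m < J.orderEmbOfFin hJ j := by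
      intro m hm
      simp only [Finset.mem_filter, Fin.lt_def] at hm ⊢
      exact ⟨hm.1, by omega⟩
    have h6 := Finset.card_le_card h5
    rw [card_filter_lt_orderEmbOfFin] at h6
    omega
  have h4 : ∀ j ∈ Finset.univ, ((J.orderEmbOfFin hJ j : ℕ) - (j : ℕ)) + l j ≤ d - k := by
    intro (j : Fin k) _
    have h5 := h3 j
    have h6 := hl j j.2
    have h7 := h2 j
    omega
  have h5 : ∑ j : Fin k, (d - k) = k * (d - k) := by simp
  rw [h1, Finset.sum_range, ← Finset.sum_add_distrib, ← h5]
  refine ⟨Finset.sum_le_sum h4, fun h6 j => ?_⟩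
  have h7 := (Finset.sum_eq_sum_iff_of_le h4).mp h6 j (Finset.mem_univ j)
  have h8 := h3 j
  have h9 := h2 j
  have h10 := hl j j.2
  omega

end Counting

/-! ### Coordinates for frames and a subspace in fixed relative position. -/

section Cells

/-- Coordinates for pairs of a tuple of frames and a subspace in given relative positions. -/
abbrev CellVar (s d : ℕ) : Type :=
  (Fin d × Fin d) ⊕ ((Σ _ : Fin s, Fin d × Fin d) ⊕
    ((Σ _ : Fin s, Fin d × Fin d) ⊕ (Σ _ : Fin s, Fin d × Fin d)))

namespace CellVar

variable {s d : ℕ}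

/-- A coordinate of a vector of the basis of the subspace. -/
def basisCoord (m c : Fin d) : CellVar s d := Sum.inl (m, c)

/-- A coefficient of a vector of the subspace with respect to the basis. -/
def coeff (i : Fin s) (m m' : Fin d) : CellVar s d := Sum.inr (Sum.inl ⟨i, m, m'⟩)

/-- A coordinate of a frame vector not at a jump. -/
def freeCoord (i : Fin s) (m c : Fin d) : CellVar s d := Sum.inr (Sum.inr (Sum.inl ⟨i, m, c⟩))

/-- A coefficient of the difference of a frame vector at a jump and a vector of the subspace. -/
def corr (i : Fin s) (m l : Fin d) : CellVar s d := Sum.inr (Sum.inr (Sum.inr ⟨i, m, l⟩))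

/-- The coordinates that occur when the relative positions are given by `J`. -/
def used (J : Fin s → Finset (Fin d)) (i₀ : Fin s) : Finset (CellVar s d) :=
  Finset.disjSum (J i₀ ×ˢ Finset.univ) (Finset.disjSum
    ((Finset.univ.erase i₀).sigma fun i => J i ×ˢ J i₀) (Finset.disjSum
    (Finset.univ.sigma fun i => (J i)ᶜ ×ˢ Finset.univ)
    (Finset.univ.sigma fun i => inversions (J i))))

variable (J : Fin s → Finset (Fin d)) (i₀ : Fin s)

theorem basisCoord_mem_used {m c : Fin d} : basisCoord m c ∈ used J i₀ ↔ m ∈ J i₀ := by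
  simp [used, basisCoord]

theorem coeff_mem_used {i : Fin s} {m m' : Fin d} :
    coeff i m m' ∈ used J i₀ ↔ i ≠ i₀ ∧ m ∈ J i ∧ m' ∈ J i₀ := by
  simp [used, coeff]

theorem freeCoord_mem_used {i : Fin s} {m c : Fin d} :
    freeCoord i m c ∈ used J i₀ ↔ m ∉ J i := by
  simp [used, freeCoord]

theorem corr_mem_used {i : Fin s} {m l : Fin d} :
    corr i m l ∈ used J i₀ ↔ m ∈ J i ∧ l ∉ J i ∧ l < m := by
  simp [used, corr, inversions]

/-- The basis of the subspace takes `k * d` coordinates, each frame other than `i₀` takes `k * k`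
coefficients, and each frame takes `(d - k) * d` free coordinates and its inversions. The frame `i₀`
has no coefficients because the basis is adapted to it; this is the `k * k` on the left. -/
theorem card_used {k : ℕ} (hJ : ∀ i, (J i).card = k) :
    (used J i₀).card + k * k =
      k * d + s * (k * k) + s * ((d - k) * d) + ∑ i, (inversions (J i)).card := by
  have hs : 1 ≤ s := by have := i₀.2; omega
  simp only [used, Finset.card_disjSum, Finset.card_product, Finset.card_sigma,
    Finset.card_compl, hJ, Fintype.card_fin, Finset.card_univ, Finset.sum_const,
    Finset.card_erase_of_mem (Finset.mem_univ i₀), smul_eq_mul]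
  obtain ⟨s', rfl⟩ : ∃ s', s = s' + 1 := ⟨s - 1, by omega⟩
  simp only [Nat.add_sub_cancel]
  ring

end CellVar

variable {K V : Type*} [Field K] [AddCommGroup V] [Module K V] [FiniteDimensional K V]

/-- The vectors of the basis of the subspace. -/
noncomputable def cellBasis {s : ℕ} (x : CellVar s (finrank K V) → K) (m : Fin (finrank K V)) :
    V := ∑ c, x (CellVar.basisCoord m c) • finBasis K V c

/-- `x` describes the tuple of frames `f` and the subspace `H`, where `J i` is the set of jumps of
the dimension of the intersection of `H` with the `i`-th flag. -/
structure IsCell {s : ℕ} (J : Fin s → Finset (Fin (finrank K V))) (i₀ : Fin s)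
    (f : Fin s → Basis (Fin (finrank K V)) K V) (H : Submodule K V)
    (x : CellVar s (finrank K V) → K) : Prop where
  finrank_inf : ∀ i m, finrank K ↥(H ⊓ (flagsOf f i).sub m) =
    ((J i).filter fun l : Fin _ => (l : ℕ) < m).card
  span_eq : Submodule.span K (cellBasis x '' (J i₀ : Set (Fin (finrank K V)))) = H
  free : ∀ i, ∀ m ∉ J i, ∀ c, (finBasis K V).repr (f i m) c = x (CellVar.freeCoord i m c)
  sub_mem : ∀ m ∈ J i₀, f i₀ m - cellBasis x m ∈
    Submodule.span K (f i₀ '' {l | l < m ∧ l ∉ J i₀})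
  sub_sum_mem : ∀ i ≠ i₀, ∀ m ∈ J i,
    f i m - ∑ m' ∈ J i₀, x (CellVar.coeff i m m') • cellBasis x m' ∈
      Submodule.span K (f i '' {l | l < m ∧ l ∉ J i})

theorem CompleteFlag.sub_zero (F : CompleteFlag K V) : F.sub 0 = ⊥ := by
  rw [← Submodule.finrank_eq_zero (R := K), F.finrank_sub]; simp

theorem CompleteFlag.sub_eq_top (F : CompleteFlag K V) {m : ℕ} (hm : finrank K V ≤ m) :
    F.sub m = ⊤ := by
  apply Submodule.eq_top_of_finrank_eq
  rw [F.finrank_sub]; omega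

/-- The dimension of the intersection with a subspace grows at most as the subspace. -/
theorem finrank_inf_le_add {A B : Submodule K V} (hAB : A ≤ B) (H : Submodule K V) :
    finrank K ↥(H ⊓ B) + finrank K A ≤ finrank K ↥(H ⊓ A) + finrank K B := by
  have h1 := Submodule.finrank_sup_add_finrank_inf_eq (H ⊓ B) A
  have h2 : (H ⊓ B) ⊓ A = H ⊓ A := by rw [inf_assoc, inf_eq_right.mpr hAB]
  have h3 : finrank K ↥((H ⊓ B) ⊔ A) ≤ finrank K B :=
    Submodule.finrank_mono (sup_le inf_le_right hAB)
  rw [h2] at h1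
  omega

/-- This is Gaussian elimination of `H` against the frame: at every pivot there is a vector of `H`
with leading coefficient one whose remaining terms use only earlier basis vectors that are not
pivots. -/
theorem exists_jumps (f : Basis (Fin (finrank K V)) K V) (H : Submodule K V) :
    ∃ J : Finset (Fin (finrank K V)),
      (∀ m, finrank K ↥(H ⊓ (CompleteFlag.ofBasis f).sub m) =
        (J.filter fun l : Fin _ => (l : ℕ) < m).card) ∧
      ∀ m ∈ J, ∃ h ∈ H, f m - h ∈ Submodule.span K (f '' {l | l < m ∧ l ∉ J}) := by
  classical
  set F := CompleteFlag.ofBasis f with hF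
  let J : Finset (Fin (finrank K V)) := Finset.univ.filter fun m =>
    finrank K ↥(H ⊓ F.sub m) < finrank K ↥(H ⊓ F.sub (m + 1))
  have hstep : ∀ m, finrank K ↥(H ⊓ F.sub (m + 1)) ≤ finrank K ↥(H ⊓ F.sub m) + 1 := by
    intro m
    have h1 := finrank_inf_le_add (F.mono (Nat.le_succ m)) H
    rw [F.finrank_sub, F.finrank_sub] at h1
    simp only [Nat.succ_eq_add_one] at h1
    omega
  have hmono : ∀ m, finrank K ↥(H ⊓ F.sub m) ≤ finrank K ↥(H ⊓ F.sub (m + 1)) := fun m =>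
    Submodule.finrank_mono (inf_le_inf_left _ (F.mono (Nat.le_succ m)))
  have hcard : ∀ m, finrank K ↥(H ⊓ F.sub m) = (J.filter fun l : Fin _ => (l : ℕ) < m).card := by
    intro m
    induction m with
    | zero => simp [F.sub_zero]
    | succ m ih =>
      by_cases hm : m < finrank K V
      · by_cases hmJ : (⟨m, hm⟩ : Fin _) ∈ J
        · have h1 : (J.filter fun l : Fin _ => (l : ℕ) < m + 1) =
              insert ⟨m, hm⟩ (J.filter fun l : Fin _ => (l : ℕ) < m) := by
            ext l
            simp only [Finset.mem_filter, Finset.mem_insert, Fin.ext_iff]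
            constructor
            · rintro ⟨h1, h2⟩
              by_cases h3 : (l : ℕ) = m
              · exact Or.inl h3
              · exact Or.inr ⟨h1, by omega⟩
            · rintro (h | ⟨h1, h2⟩)
              · have : l = ⟨m, hm⟩ := Fin.ext h
                subst this
                exact ⟨hmJ, by simp⟩
              · exact ⟨h1, by omega⟩
          rw [h1, Finset.card_insert_of_notMem (by simp), ← ih]
          have h2 : finrank K ↥(H ⊓ F.sub m) < finrank K ↥(H ⊓ F.sub (m + 1)) := by
            simpa [J] using hmJ
          have := hstep m
          omega
        · have h1 : (J.filter fun l : Fin _ => (l : ℕ) < m + 1) = J.filter fun l : Fin _ => (l : ℕ) < m := by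
            ext l
            simp only [Finset.mem_filter]
            constructor
            · rintro ⟨h1, h2⟩
              refine ⟨h1, ?_⟩
              by_contra h3
              have : l = ⟨m, hm⟩ := Fin.ext (show (l : ℕ) = m by omega)
              exact hmJ (this ▸ h1)
            · rintro ⟨h1, h2⟩
              exact ⟨h1, by omega⟩
          rw [h1, ← ih]
          have h2 : ¬ finrank K ↥(H ⊓ F.sub m) < finrank K ↥(H ⊓ F.sub (m + 1)) := by
            simpa [J] using hmJ
          have := hmono m
          omega
      · have h1 : (J.filter fun l : Fin _ => (l : ℕ) < m + 1) = J.filter fun l : Fin _ => (l : ℕ) < m := by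
          ext l
          simp only [Finset.mem_filter]
          have := l.2
          constructor
          · rintro ⟨h1, h2⟩
            exact ⟨h1, by omega⟩
          · rintro ⟨h1, h2⟩
            exact ⟨h1, by omega⟩
        rw [h1, ← ih, F.sub_eq_top (by omega), F.sub_eq_top (by omega)]
  -- Inductively, every member of the flag is generated by its intersection with `H` and its basis
  -- vectors at non-jumps: at a jump, a vector of `H` new in this step replaces the basis vector.
  have hsub : ∀ m, F.sub m ≤ (H ⊓ F.sub m) ⊔
      Submodule.span K (f '' {l | (l : ℕ) < m ∧ l ∉ J}) := by
    intro m
    induction m with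
    | zero => simp [F.sub_zero]
    | succ m ih =>
      have hle : (H ⊓ F.sub m) ⊔ Submodule.span K (f '' {l | (l : ℕ) < m ∧ l ∉ J}) ≤
          (H ⊓ F.sub (m + 1)) ⊔ Submodule.span K (f '' {l | (l : ℕ) < m + 1 ∧ l ∉ J}) :=
        sup_le_sup (inf_le_inf_left _ (F.mono (Nat.le_succ m)))
          (Submodule.span_mono (Set.image_mono fun l hl => ⟨Nat.lt_succ_of_lt hl.1, hl.2⟩))
      have hsplit : ∀ l : Fin (finrank K V), (l : ℕ) < m + 1 →
          f l ∈ (H ⊓ F.sub (m + 1)) ⊔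
            Submodule.span K (f '' {l | (l : ℕ) < m + 1 ∧ l ∉ J}) := by
        intro l hl
        by_cases hlm : (l : ℕ) < m
        · exact (ih.trans hle) (Submodule.subset_span ⟨l, hlm, rfl⟩)
        · by_cases hlJ : l ∈ J
          · have h2 : finrank K ↥(H ⊓ F.sub l) < finrank K ↥(H ⊓ F.sub (l + 1)) := by
              simpa [J] using hlJ
            have hlm' : (l : ℕ) = m := by omega
            rw [hlm'] at h2
            obtain ⟨v, hv1, hv2⟩ : ∃ v, v ∈ H ⊓ F.sub (m + 1) ∧ v ∉ H ⊓ F.sub m := by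
              by_contra hc
              push Not at hc
              exact absurd (Submodule.finrank_mono (show H ⊓ F.sub (m + 1) ≤ H ⊓ F.sub m from hc))
                (by omega)
            have h3 : F.sub (m + 1) = K ∙ f l ⊔ F.sub m := by
              simp only [hF, CompleteFlag.ofBasis]
              rw [← Submodule.span_union, Set.singleton_union, ← Set.image_insert_eq]
              congr 2
              ext l'
              simp only [Set.mem_ofPred_eq, Set.mem_insert_iff, Fin.ext_iff]
              omega
            have h4 := hv1.2
            rw [h3] at h4
            obtain ⟨y, hy, w, hw, hyw⟩ := Submodule.mem_sup.mp h4
            obtain ⟨α, rfl⟩ := Submodule.mem_span_singleton.mp hy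
            have hα : α ≠ 0 := by
              rintro rfl
              simp only [zero_smul, zero_add] at hyw
              exact hv2 ⟨hv1.1, hyw ▸ hw⟩
            have h5 : f l = α⁻¹ • (v - w) := by
              rw [← hyw, add_sub_cancel_right, smul_smul, inv_mul_cancel₀ hα, one_smul]
            rw [h5]
            exact Submodule.smul_mem _ _ (Submodule.sub_mem _ (Submodule.mem_sup_left hv1)
              ((ih.trans hle) hw))
          · exact Submodule.mem_sup_right (Submodule.subset_span ⟨l, ⟨hl, hlJ⟩, rfl⟩)
      conv_lhs => simp only [hF, CompleteFlag.ofBasis]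
      rw [Submodule.span_le]
      rintro _ ⟨l, hl, rfl⟩
      exact hsplit l hl
  refine ⟨J, hcard, fun m hm => ?_⟩
  have h2 : finrank K ↥(H ⊓ F.sub m) < finrank K ↥(H ⊓ F.sub (m + 1)) := by
    simpa [J] using hm
  have h3 : f m ∈ F.sub (m + 1) := Submodule.subset_span ⟨m, Nat.lt_succ_self _, rfl⟩
  obtain ⟨h, hh, y, hy, hhy⟩ := Submodule.mem_sup.mp (hsub _ h3)
  refine ⟨h, hh.1, ?_⟩
  rw [← hhy, add_sub_cancel_left]
  refine Submodule.span_mono (Set.image_mono ?_) hy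
  rintro l ⟨h4, h5⟩
  refine ⟨?_, h5⟩
  rw [Fin.lt_def]
  rcases Nat.lt_succ_iff_lt_or_eq.mp h4 with h6 | h6
  · exact h6
  · exact absurd (Fin.ext h6 ▸ hm) h5

end Cells

/-! ### Basis vectors and members of the flag. -/

section AdaptedBasis

variable {K V : Type*} [Field K] [AddCommGroup V] [Module K V]

theorem span_lt_le_flag (f : Basis (Fin (finrank K V)) K V) (J : Finset (Fin (finrank K V)))
    (m : Fin (finrank K V)) :
    Submodule.span K (f '' {l | l < m ∧ l ∉ J}) ≤ (CompleteFlag.ofBasis f).sub m :=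
  Submodule.span_mono (Set.image_mono fun _ hl => hl.1)

theorem basis_mem_flag (f : Basis (Fin (finrank K V)) K V) {m : Fin (finrank K V)} {n : ℕ}
    (h : (m : ℕ) < n) : f m ∈ (CompleteFlag.ofBasis f).sub n :=
  Submodule.subset_span ⟨m, h, rfl⟩

theorem basis_notMem_flag (f : Basis (Fin (finrank K V)) K V) {m : Fin (finrank K V)} {n : ℕ}
    (h : n ≤ (m : ℕ)) : f m ∉ (CompleteFlag.ofBasis f).sub n := by
  intro hc
  have h1 := f.linearIndependent.notMem_span_image (s := {i : Fin (finrank K V) | (i : ℕ) < n})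
    (x := m) (by simpa using h)
  exact h1 hc

end AdaptedBasis

/-! ### The dimension count and its consequences for general flags. -/

section DimensionCount

variable {K V : Type*} [Field K] [AddCommGroup V] [Module K V] [FiniteDimensional K V]

open CellVar

/-- A coordinate of a frame vector as a polynomial in the cell coordinates. -/
noncomputable def framePoly (K : Type*) [Field K] {s d : ℕ} (J : Fin s → Finset (Fin d))
    (i₀ : Fin s) (i : Fin s) (m c : Fin d) : MvPolynomial (CellVar s d) K :=
  if m ∈ J i then
    (if i = i₀ then MvPolynomial.X (basisCoord m c) else
      ∑ m', MvPolynomial.X (coeff i m m') * MvPolynomial.X (basisCoord m' c)) +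
      ∑ l, MvPolynomial.X (corr i m l) * MvPolynomial.X (freeCoord i l c)
  else MvPolynomial.X (freeCoord i m c)

/-- Modulo the basis vectors at non-jumps, `h m` equals `f m`, so the `h m` are independent, and
there are as many of them as the dimension of `H`. -/
theorem span_jumps_eq {f : Basis (Fin (finrank K V)) K V} {H : Submodule K V}
    {J : Finset (Fin (finrank K V))} (hJ : J.card = finrank K H) {h : Fin (finrank K V) → V}
    (hh : ∀ m ∈ J, h m ∈ H ∧ f m - h m ∈ Submodule.span K (f '' {l | l < m ∧ l ∉ J})) :
    Submodule.span K (h '' (J : Set (Fin (finrank K V)))) = H := by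
  set Z := Submodule.span K (f '' {l | l ∉ J}) with hZ
  have hli : LinearIndependent K fun l : J => h l := by
    apply LinearIndependent.of_comp Z.mkQ
    have h1 : (Z.mkQ ∘ fun l : J => h l) = Z.mkQ ∘ fun l : J => f l := by
      funext l
      have h2 := (hh l l.2).2
      have h3 : f l - h l ∈ Z := Submodule.span_mono (Set.image_mono fun l hl => hl.2) h2
      simp only [Function.comp_apply, Submodule.mkQ_apply]
      exact ((Submodule.Quotient.eq Z).mpr h3).symm
    rw [h1]
    refine (f.linearIndependent.comp _ Subtype.val_injective).map ?_
    rw [Submodule.ker_mkQ, hZ]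
    have h2 := f.linearIndependent.disjoint_span_image (s := (J : Set _)) (t := {l | l ∉ J})
      (Set.disjoint_left.mpr fun l h1 h2 => h2 h1)
    have h3 : Set.range (fun l : J => f l) = f '' (J : Set _) := by
      ext y; simp
    have h4 : Set.range (f ∘ (Subtype.val : J → _)) = f '' (J : Set _) := h3
    rw [h4]
    exact h2
  have hr : h '' (J : Set (Fin (finrank K V))) = Set.range fun l : J => h l := by
    ext y; simp
  apply Submodule.eq_of_le_of_finrank_le
  · rw [Submodule.span_le]
    rintro _ ⟨m, hm, rfl⟩
    exact (hh m hm).1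
  · rw [hr, finrank_span_eq_card hli, Fintype.card_coe, hJ]

/-- Echelon vectors of `H` for the frame `i₀` serve as its basis, and those for the other frames are
expressed in it. A frame vector at a jump is then its echelon vector plus a combination of earlier
frame vectors at non-jumps, so all frames are polynomial in the chosen coordinates. -/
theorem exists_isCell {s k : ℕ} (i₀ : Fin s) (f : Fin s → Basis (Fin (finrank K V)) K V)
    (H : Submodule K V) (hH : finrank K H = k) :
    ∃ (J : Fin s → Finset (Fin (finrank K V))) (x : CellVar s (finrank K V) → K),
      (∀ i, (J i).card = k) ∧ IsCell J i₀ f H x ∧ (∀ t ∉ used J i₀, x t = 0) ∧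
      ∀ i m c, MvPolynomial.eval x (framePoly K J i₀ i m c) = (finBasis K V).repr (f i m) c := by
  classical
  choose J hJ1 hJ2 using fun i => exists_jumps (f i) H
  have hcard : ∀ i, (J i).card = k := by
    intro i
    have h1 := hJ1 i (finrank K V)
    rw [CompleteFlag.sub_eq_top _ le_rfl, inf_top_eq, hH] at h1
    rw [h1, Finset.filter_true_of_mem fun l _ => l.2]
  have hJ3 : ∀ i m, ∃ h : V, m ∈ J i → h ∈ H ∧
      f i m - h ∈ Submodule.span K (f i '' {l | l < m ∧ l ∉ J i}) := by
    intro i m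
    by_cases hm : m ∈ J i
    · obtain ⟨h, h1, h2⟩ := hJ2 i m hm
      exact ⟨h, fun _ => ⟨h1, h2⟩⟩
    · exact ⟨0, fun h => absurd h hm⟩
  choose h hh using hJ3
  have hspan : Submodule.span K (h i₀ '' (J i₀ : Set (Fin (finrank K V)))) = H :=
    span_jumps_eq ((hcard i₀).trans hH.symm) fun m hm => hh i₀ m hm
  have hT : ∀ i m, ∃ T : Fin (finrank K V) → K, m ∈ J i →
      h i m = ∑ m' ∈ J i₀, T m' • h i₀ m' := by
    intro i m
    by_cases hm : m ∈ J i
    · have h1 := (hh i m hm).1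
      rw [← hspan, Submodule.mem_span_image_finset_iff_exists_fun] at h1
      obtain ⟨T, hT⟩ := h1
      refine ⟨fun l => if hl : l ∈ J i₀ then T ⟨l, hl⟩ else 0, fun _ => ?_⟩
      rw [← hT, ← Finset.sum_coe_sort (J i₀)
        (fun l => (if hl : l ∈ J i₀ then T ⟨l, hl⟩ else 0) • h i₀ l)]
      exact Finset.sum_congr rfl fun l _ => by rw [dif_pos l.2]
    · exact ⟨0, fun h => absurd h hm⟩
  choose T hT using hT
  -- The value zero at unused coordinates lets `framePoly` sum over all indices.
  let x : CellVar s (finrank K V) → K := fun t => match t with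
    | Sum.inl (m, c) => if m ∈ J i₀ then (finBasis K V).repr (h i₀ m) c else 0
    | Sum.inr (Sum.inl ⟨i, m, m'⟩) => if i ≠ i₀ ∧ m ∈ J i ∧ m' ∈ J i₀ then T i m m' else 0
    | Sum.inr (Sum.inr (Sum.inl ⟨i, m, c⟩)) =>
      if m ∉ J i then (finBasis K V).repr (f i m) c else 0
    | Sum.inr (Sum.inr (Sum.inr ⟨i, m, l⟩)) =>
      if m ∈ J i ∧ l ∉ J i ∧ l < m then (f i).repr (f i m - h i m) l else 0
  have xU : ∀ m c, x (basisCoord m c) =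
      if m ∈ J i₀ then (finBasis K V).repr (h i₀ m) c else 0 := fun m c => rfl
  have xT : ∀ i m m', x (CellVar.coeff i m m') =
      if i ≠ i₀ ∧ m ∈ J i ∧ m' ∈ J i₀ then T i m m' else 0 := fun i m m' => rfl
  have xF : ∀ i m c, x (freeCoord i m c) =
      if m ∉ J i then (finBasis K V).repr (f i m) c else 0 := fun i m c => rfl
  have xC : ∀ i m l, x (corr i m l) =
      if m ∈ J i ∧ l ∉ J i ∧ l < m then (f i).repr (f i m - h i m) l else 0 :=
    fun i m l => rfl
  have hbasis : ∀ m ∈ J i₀, cellBasis x m = h i₀ m := by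
    intro m hm
    unfold cellBasis
    simp only [xU, if_pos hm]
    exact (finBasis K V).sum_repr _
  have himg : cellBasis x '' (J i₀ : Set (Fin (finrank K V))) = h i₀ '' (J i₀ : Set _) :=
    Set.image_congr fun m hm => hbasis m hm
  refine ⟨J, x, hcard, ⟨hJ1, ?_, ?_, ?_, ?_⟩, ?_, ?_⟩
  · rw [himg, hspan]
  · intro i m hm c
    rw [xF, if_pos hm]
  · intro m hm
    rw [hbasis m hm]
    exact (hh i₀ m hm).2
  · intro i hi m hm
    have h1 : ∑ m' ∈ J i₀, x (CellVar.coeff i m m') • cellBasis x m' = h i m := by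
      rw [hT i m hm]
      refine Finset.sum_congr rfl fun m' hm' => ?_
      rw [hbasis m' hm', xT, if_pos ⟨hi, hm, hm'⟩]
    rw [h1]
    exact (hh i m hm).2
  · rintro (⟨m, c⟩ | ⟨i, m, m'⟩ | ⟨i, m, c⟩ | ⟨i, m, l⟩) ht
    · exact if_neg fun hm => ht ((basisCoord_mem_used J i₀).mpr hm)
    · exact if_neg fun hm => ht ((coeff_mem_used J i₀).mpr hm)
    · exact if_neg fun hm => ht ((freeCoord_mem_used J i₀).mpr hm)
    · exact if_neg fun hm => ht ((corr_mem_used J i₀).mpr hm)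
  · intro i m c
    unfold framePoly
    by_cases hm : m ∈ J i
    · rw [if_pos hm]
      have h0 := (hh i m hm).2
      rw [Basis.mem_span_image] at h0
      have h2 : ∀ l, ¬ (l ∉ J i ∧ l < m) → (f i).repr (f i m - h i m) l = 0 := by
        intro l hl
        by_contra hc
        have := h0 (Finsupp.mem_support_iff.mpr hc)
        exact hl ⟨this.2, this.1⟩
      have h3 : (finBasis K V).repr (f i m) c = (finBasis K V).repr (h i m) c +
          ∑ l, (f i).repr (f i m - h i m) l * (finBasis K V).repr (f i l) c := by
        have h4 : f i m = h i m + ∑ l, (f i).repr (f i m - h i m) l • f i l := by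
          rw [(f i).sum_repr]; abel
        conv_lhs => rw [h4]
        simp
      rw [h3, map_add]
      congr 1
      · split_ifs with hi
        · subst hi
          rw [MvPolynomial.eval_X, xU, if_pos hm]
        · simp only [map_sum, map_mul, MvPolynomial.eval_X, xU, xT]
          rw [hT i m hm, ← Finset.sum_subset (Finset.subset_univ (J i₀))]
          · simp only [map_sum, map_smul, Finsupp.coe_finsetSum, Finset.sum_apply,
              Finsupp.coe_smul, Pi.smul_apply, smul_eq_mul]
            refine Finset.sum_congr rfl fun m' hm' => ?_
            rw [if_pos ⟨hi, hm, hm'⟩, if_pos hm']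
          · intro m' _ hm'
            rw [if_neg hm', mul_zero]
      · simp only [map_sum, map_mul, MvPolynomial.eval_X, xF, xC]
        refine Finset.sum_congr rfl fun l _ => ?_
        by_cases hl : l ∉ J i ∧ l < m
        · rw [if_pos ⟨hm, hl⟩, if_pos hl.1]
        · rw [h2 l hl, if_neg fun h => hl h.2]
          simp
    · rw [if_neg hm, MvPolynomial.eval_X, xF, if_pos hm]

/-- The dimension count: an instance given by general flags has no solutions satisfying a closed
condition, if either there are too many Schubert conditions, or the closed condition is not
satisfied by all pairs of an instance and a solution. -/
theorem onFrames_forall_solutions {s k : ℕ} (hk : k ≤ finrank K V) (lam : Fin s → ℕ → ℕ)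
    (i₀ : Fin s) (hlam : ∀ i, ∀ j < k, lam i j ≤ finrank K V - k)
    (hsum : k * (finrank K V - k) ≤ ∑ i, ∑ j ∈ Finset.range k, lam i j)
    (Bad : (Fin s → CompleteFlag K V) → Submodule K V → Prop)
    (hbad : ∑ i, ∑ j ∈ Finset.range k, lam i j = k * (finrank K V - k) →
      ∀ (J : Fin s → Finset (Fin (finrank K V))) (p : Fin s → Fin k → Fin (finrank K V)),
      (∀ i, StrictMono (p i)) → (∀ i j, (p i j : ℕ) + lam i j = finrank K V - k + j) →
      (∀ i m, m ∈ J i ↔ ∃ j, p i j = m) →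
      ∃ q : MvPolynomial (CellVar s (finrank K V)) K,
        (∃ x, (∀ t ∉ used J i₀, x t = 0) ∧ MvPolynomial.eval x q ≠ 0) ∧
        ∀ x f H, IsCell J i₀ f H x → Bad (flagsOf f) H → MvPolynomial.eval x q = 0) :
    OnFrames fun F : Fin s → CompleteFlag K V => ∀ H ∈ solutions k lam F, ¬ Bad F H := by
  classical
  set d := finrank K V with hd
  let Valid : (Fin s → Finset (Fin d)) → Prop := fun J =>
    ∀ i, (J i).card = k ∧ ∀ j < k, j + 1 ≤
      ((J i).filter fun m : Fin _ => (m : ℕ) < d - k + (j + 1) - lam i j).card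
  have main : ∀ J, Valid J → ∃ r : MvPolynomial (Fin s × Fin d × Fin d) K, r ≠ 0 ∧
      ∀ x f H, IsCell J i₀ f H x → (∀ t ∉ used J i₀, x t = 0) → Bad (flagsOf f) H →
        MvPolynomial.eval (fun y => MvPolynomial.eval x (framePoly K J i₀ y.1 y.2.1 y.2.2)) r
          = 0 := by
    intro J hJ
    have hinv := fun i => card_inversions_add_le (hJ i).1 (lam i) (hlam i) (hJ i).2
    have hused := card_used J i₀ fun i => (hJ i).1
    have hsum' : ∑ i, ((inversions (J i)).card + ∑ j ∈ Finset.range k, lam i j) ≤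
        ∑ _i : Fin s, k * (d - k) := Finset.sum_le_sum fun i _ => (hinv i).1
    have hsum'' := hsum'
    simp only [Finset.sum_const, Finset.card_univ, Fintype.card_fin, smul_eq_mul,
      Finset.sum_add_distrib] at hsum''
    -- With the bound on inversions this identity says that a cell has at most `s * (d * d)`
    -- coordinates, the number for `s` frames.
    have hcalc : k * d + s * (k * k) + s * ((d - k) * d) + s * (k * (d - k)) =
        k * k + k * (d - k) + s * (d * d) := by
      obtain ⟨e, he⟩ := Nat.exists_eq_add_of_le hk
      rw [he]
      simp only [Nat.add_sub_cancel_left]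
      ring
    have hle : (used J i₀).card ≤ s * (d * d) := by omega
    -- Setting the unused coordinates to zero makes the number of variables that of `used J i₀`.
    let restr : MvPolynomial (CellVar s d) K →ₐ[K] MvPolynomial (used J i₀) K :=
      MvPolynomial.aeval fun t => if h : t ∈ used J i₀ then MvPolynomial.X ⟨t, h⟩ else 0
    have hrestr : ∀ (x : CellVar s d → K), (∀ t ∉ used J i₀, x t = 0) → ∀ p,
        MvPolynomial.eval (fun t : used J i₀ => x t) (restr p) = MvPolynomial.eval x p := by
      intro x hx p
      induction p using MvPolynomial.induction_on with
      | C a => simp [restr]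
      | add p q hp hq => simp [hp, hq]
      | mul_X p t hp =>
        rw [map_mul, map_mul, map_mul, hp]
        congr 1
        simp only [restr, MvPolynomial.aeval_X, MvPolynomial.eval_X]
        split_ifs with h
        · simp
        · rw [map_zero, hx t h]
    have hex : ∃ q : MvPolynomial (CellVar s d) K,
        (Fintype.card (used J i₀) < Fintype.card (Fin s × Fin d × Fin d) ∨ restr q ≠ 0) ∧
        ∀ x f H, IsCell J i₀ f H x → Bad (flagsOf f) H → MvPolynomial.eval x q = 0 := by
      -- A cell that is too small is not dominant anyway, and `q = 0` suffices. Otherwise all the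
      -- inequalities above are equalities, the jumps are the extremal ones, and the equation of the
      -- closed condition is needed.
      by_cases hlt : (used J i₀).card < s * (d * d)
      · refine ⟨0, Or.inl (by simpa using hlt), fun _ _ _ _ _ => map_zero _⟩
      · have hsumeq : ∑ i, ∑ j ∈ Finset.range k, lam i j = k * (d - k) := by omega
        have heq : ∑ i, ((inversions (J i)).card + ∑ j ∈ Finset.range k, lam i j) =
            ∑ _i : Fin s, k * (d - k) := by
          simp only [Finset.sum_const, Finset.card_univ, Fintype.card_fin, smul_eq_mul,
            Finset.sum_add_distrib]
          omega
        have heq' := (Finset.sum_eq_sum_iff_of_le fun i _ => (hinv i).1).mp heq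
        obtain ⟨q, ⟨x, hx, hq⟩, hq'⟩ := hbad hsumeq J
          (fun i j => (J i).orderEmbOfFin (hJ i).1 j)
          (fun i => ((J i).orderEmbOfFin (hJ i).1).strictMono)
          (fun i j => (hinv i).2 (heq' i (Finset.mem_univ i)) j)
          (fun i m => by
            rw [← Set.mem_range, Finset.range_orderEmbOfFin]; rfl)
        refine ⟨q, Or.inr fun h0 => hq ?_, hq'⟩
        rw [← hrestr x hx, h0, map_zero]
    obtain ⟨q, hq, hq'⟩ := hex
    obtain ⟨r, hr, hr'⟩ := exists_ne_zero_vanishing_on_image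
      (fun y : Fin s × Fin d × Fin d => restr (framePoly K J i₀ y.1 y.2.1 y.2.2)) (restr q)
      (by simpa using hle) hq
    refine ⟨r, hr, fun x f H hc hx hB => ?_⟩
    have h1 := hr' (fun t : used J i₀ => x t) (by rw [hrestr x hx]; exact hq' x f H hc hB)
    simpa only [hrestr x hx] using h1
  choose! r hr hr' using main
  refine ⟨∏ J ∈ Finset.univ.filter Valid, r J, Finset.prod_ne_zero_iff.mpr fun J hJ =>
    hr J (Finset.mem_filter.mp hJ).2, fun f hf H hH hB => ?_⟩
  obtain ⟨J, x, hJ, hc, hx, hev⟩ := exists_isCell i₀ f H hH.1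
  have hvalid : Valid J := by
    refine fun i => ⟨hJ i, fun j hj => ?_⟩
    rw [← hc.finrank_inf]
    exact (hH.2 i).2 j hj
  unfold evalFrames at hf
  rw [map_prod] at hf
  refine Finset.prod_ne_zero_iff.mp hf J (Finset.mem_filter.mpr ⟨Finset.mem_univ _, hvalid⟩) ?_
  have h1 := hr' J hvalid x f H hc hx hB
  simpa only [hev] using h1

/-- Too many Schubert conditions with respect to general flags have no common solutions. -/
theorem onFrames_solutions_eq_empty {s k : ℕ} (hk : k ≤ finrank K V) (lam : Fin s → ℕ → ℕ)
    (i₀ : Fin s) (hlam : ∀ i, ∀ j < k, lam i j ≤ finrank K V - k)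
    (hsum : k * (finrank K V - k) < ∑ i, ∑ j ∈ Finset.range k, lam i j) :
    OnFrames fun F : Fin s → CompleteFlag K V => ∀ H ∈ solutions k lam F, False := by
  refine (onFrames_forall_solutions hk lam i₀ hlam hsum.le (fun _ _ => True) ?_).mono
    fun F hF H hH => hF H hH trivial
  intro h
  omega

theorem IsCell.basis_mem {s : ℕ} {J : Fin s → Finset (Fin (finrank K V))} {i₀ : Fin s}
    {f : Fin s → Basis (Fin (finrank K V)) K V} {H : Submodule K V}
    {x : CellVar s (finrank K V) → K} (hc : IsCell J i₀ f H x) {m : Fin (finrank K V)}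
    (hm : m ∈ J i₀) : cellBasis x m ∈ H := by
  rw [← hc.span_eq]
  exact Submodule.subset_span ⟨m, hm, rfl⟩

/-- For general flags, the line in which a solution meets the subspace of its first Schubert
condition for one flag is not contained in the hyperplane of the last but one for another. -/
theorem onFrames_inf_inf_eq_bot {s k : ℕ} (hk : k ≤ finrank K V) (hk2 : 2 ≤ k)
    (lam : Fin s → ℕ → ℕ) (i₀ i₁ : Fin s) (hi : i₁ ≠ i₀)
    (hlam : ∀ i, ∀ j < k, lam i j ≤ finrank K V - k)
    (hsum : k * (finrank K V - k) ≤ ∑ i, ∑ j ∈ Finset.range k, lam i j)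
    (m₀ m₁ : ℕ) (hm₁ : m₁ + lam i₁ 0 = finrank K V - k + 1)
    (hm₀ : m₀ + lam i₀ (k - 2) = finrank K V - 1) :
    OnFrames fun F : Fin s → CompleteFlag K V => ∀ H ∈ solutions k lam F,
      H ⊓ (F i₁).sub m₁ ⊓ (F i₀).sub m₀ = ⊥ := by
  have hmain := onFrames_forall_solutions hk lam i₀ hlam hsum
    (fun F H => H ⊓ (F i₁).sub m₁ ⊓ (F i₀).sub m₀ ≠ ⊥) ?_
  · exact hmain.mono fun F hF H hH => not_not.mp (hF H hH)
  intro _ J p hp hpl hJ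
  have hp0 : p i₁ ⟨0, by omega⟩ ∈ J i₁ := (hJ _ _).mpr ⟨_, rfl⟩
  have hpk : p i₀ ⟨k - 1, by omega⟩ ∈ J i₀ := (hJ _ _).mpr ⟨_, rfl⟩
  have e0 := hpl i₁ ⟨0, by omega⟩
  have ek := hpl i₀ ⟨k - 1, by omega⟩
  have ek2 := hpl i₀ ⟨k - 2, by omega⟩
  have elt : p i₀ ⟨k - 2, by omega⟩ < p i₀ ⟨k - 1, by omega⟩ :=
    hp i₀ (Fin.lt_def.mpr (by simp only; omega))
  set a := p i₁ ⟨0, by omega⟩ with ha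
  set b := p i₀ ⟨k - 1, by omega⟩ with hb
  have hin : CellVar.coeff i₁ a b ∈ used J i₀ := (coeff_mem_used J i₀).mpr ⟨hi, hp0, hpk⟩
  -- Here `a` is the first jump for `i₁` and `b` the last for `i₀`. The line `H ∩ F^{i₁}_{m₁}` is
  -- spanned by the echelon vector at `a`. All basis vectors of `H` but the one at `b` lie in
  -- `F^{i₀}_{m₀}`, so the line lies there only if its coefficient at `b` vanishes.
  refine ⟨MvPolynomial.X (CellVar.coeff i₁ a b),
    ⟨fun t => if t = CellVar.coeff i₁ a b then 1 else 0, ?_, by simp⟩, ?_⟩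
  · intro t ht
    exact if_neg fun h : t = _ => ht (h ▸ hin)
  intro x f H hc hB
  rw [MvPolynomial.eval_X]
  by_contra hT
  set h := ∑ m' ∈ J i₀, x (CellVar.coeff i₁ a m') • cellBasis x m' with hh
  have hhH : h ∈ H := Submodule.sum_mem _ fun m' hm' =>
    Submodule.smul_mem _ _ (hc.basis_mem hm')
  have hsub := span_lt_le_flag _ _ _ (hc.sub_sum_mem i₁ hi a hp0)
  have ham : (a : ℕ) < m₁ := by simp only at e0; omega
  have hh1 : h ∈ (flagsOf f i₁).sub m₁ := by
    have h1 := Submodule.sub_mem _ (basis_mem_flag (f i₁) (Nat.lt_succ_self (a : ℕ)))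
      ((CompleteFlag.ofBasis (f i₁)).mono (Nat.le_succ _) hsub)
    rw [sub_sub_cancel] at h1
    exact (flagsOf f i₁).mono ham h1
  have hh0 : h ≠ 0 := by
    intro h0
    rw [← hh, h0, sub_zero] at hsub
    exact basis_notMem_flag (f i₁) le_rfl hsub
  have hlt : ∀ m' ∈ J i₀, m' ≠ b → (m' : ℕ) < m₀ := by
    intro m' hm' hne
    obtain ⟨j, rfl⟩ := (hJ _ _).mp hm'
    have hj : (j : ℕ) ≤ k - 2 := by
      by_contra hc
      apply hne
      rw [hb]
      congr 1
      ext1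
      simp only
      omega
    have h1 : p i₀ j ≤ p i₀ ⟨k - 2, by omega⟩ := (hp i₀).monotone (Fin.le_def.mpr hj)
    rw [Fin.le_def] at h1
    simp only at ek2
    omega
  have hbm : m₀ ≤ (b : ℕ) := by
    rw [Fin.lt_def] at elt
    simp only at ek2
    omega
  have hone : finrank K ↥(H ⊓ (flagsOf f i₁).sub m₁) = 1 := by
    rw [hc.finrank_inf, Finset.card_eq_one]
    refine ⟨a, ?_⟩
    ext l
    simp only [Finset.mem_filter, Finset.mem_singleton]
    constructor
    · rintro ⟨hl, hlm⟩
      obtain ⟨j, rfl⟩ := (hJ _ _).mp hl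
      by_contra hne
      have hj : (⟨0, by omega⟩ : Fin k) < j := by
        rw [Fin.lt_def]
        by_contra hj
        apply hne
        rw [ha]
        congr 1
        ext1
        simp only at hj ⊢
        omega
      have h1 := Fin.lt_def.mp (hp i₁ hj)
      simp only at e0
      omega
    · rintro rfl
      exact ⟨hp0, ham⟩
  have hle : H ⊓ (flagsOf f i₁).sub m₁ ≤ (flagsOf f i₀).sub m₀ := by
    have h1 : 0 < finrank K ↥(H ⊓ (flagsOf f i₁).sub m₁ ⊓ (flagsOf f i₀).sub m₀) := by
      rw [Nat.pos_iff_ne_zero]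
      intro h0
      exact hB (Submodule.finrank_eq_zero.mp h0)
    have h2 := Submodule.eq_of_le_of_finrank_le
      (inf_le_left : H ⊓ (flagsOf f i₁).sub m₁ ⊓ (flagsOf f i₀).sub m₀ ≤ _) (by omega)
    rw [← h2]
    exact inf_le_right
  have hhm := hle ⟨hhH, hh1⟩
  have hum : ∀ m' ∈ J i₀, m' ≠ b → cellBasis x m' ∈ (flagsOf f i₀).sub m₀ := by
    intro m' hm' hne
    have h1 := span_lt_le_flag _ _ _ (hc.sub_mem m' hm')
    have h2 := Submodule.sub_mem _ (basis_mem_flag (f i₀) (Nat.lt_succ_self (m' : ℕ)))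
      ((CompleteFlag.ofBasis (f i₀)).mono (Nat.le_succ _) h1)
    rw [sub_sub_cancel] at h2
    exact (flagsOf f i₀).mono (hlt m' hm' hne) h2
  rw [hh, ← Finset.add_sum_erase _ _ hpk] at hhm
  have h3 : ∑ m' ∈ (J i₀).erase b, x (CellVar.coeff i₁ a m') • cellBasis x m' ∈
      (flagsOf f i₀).sub m₀ := Submodule.sum_mem _ fun m' hm' =>
    Submodule.smul_mem _ _ (hum m' (Finset.mem_of_mem_erase hm') (Finset.ne_of_mem_erase hm'))
  have h4 := (Submodule.add_mem_iff_left _ h3).mp hhm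
  have h5 := (Submodule.smul_mem_iff _ hT).mp h4
  have h6 := span_lt_le_flag _ _ _ (hc.sub_mem b hpk)
  have h7 := Submodule.add_mem _ h6 ((flagsOf f i₀).mono hbm h5)
  rw [sub_add_cancel] at h7
  exact basis_notMem_flag (f i₀) le_rfl h7

/-- For general flags, a solution together with the five-dimensional subspace of one flag does not
span the two-dimensional subspace of another, if it meets the former in a plane and the latter in
a line. -/
theorem onFrames_not_le_sup {s k : ℕ} (hk : k + 4 ≤ finrank K V) (hk2 : 2 ≤ k)
    (lam : Fin s → ℕ → ℕ) (i₀ i₁ : Fin s) (hi : i₁ ≠ i₀)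
    (hlam : ∀ i, ∀ j < k, lam i j ≤ finrank K V - k)
    (hsum : k * (finrank K V - k) ≤ ∑ i, ∑ j ∈ Finset.range k, lam i j)
    (h₀ : lam i₀ 0 + 1 = finrank K V - k) (h₁ : lam i₁ 0 + 3 = finrank K V - k)
    (h₁' : lam i₁ 1 + 3 = finrank K V - k) :
    OnFrames fun F : Fin s → CompleteFlag K V => ∀ H ∈ solutions k lam F,
      ¬ (F i₀).sub 2 ≤ (F i₁).sub 5 ⊔ H := by
  refine onFrames_forall_solutions (by omega) lam i₀ hlam hsum
    (fun F H => (F i₀).sub 2 ≤ (F i₁).sub 5 ⊔ H) ?_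
  intro _ J p hp hpl hJ
  have e0 := hpl i₀ ⟨0, by omega⟩
  have e1 := hpl i₁ ⟨0, by omega⟩
  have e1' := hpl i₁ ⟨1, by omega⟩
  simp only at e0 e1 e1'
  have hmin : ∀ i j, (p i ⟨0, by omega⟩ : ℕ) ≤ p i j := fun i j =>
    (hp i).monotone (Fin.le_def.mpr (Nat.zero_le _))
  have hz : (⟨0, by omega⟩ : Fin (finrank K V)) ∉ J i₀ := by
    rw [hJ]
    rintro ⟨j, hj⟩
    have := hmin i₀ j
    rw [hj] at this
    simp only at this
    omega
  have hn : ∀ n : Fin 3, (⟨n, by omega⟩ : Fin (finrank K V)) ∉ J i₁ := by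
    intro n
    rw [hJ]
    rintro ⟨j, hj⟩
    have := hmin i₁ j
    rw [hj] at this
    simp only at this
    omega
  -- Counting from zero, the first jump for `i₀` is at 1 and the first two for `i₁` are at 3 and 4.
  -- Thus the vector 0 of `f i₀` and the vectors 0, 1, 2 of `f i₁` have free coordinates, and the
  -- latter span `F^{i₁}_5` modulo `H`.
  have hjump : ∀ l : Fin (finrank K V), (l : ℕ) < 5 → l ∉ J i₁ → (l : ℕ) < 3 := by
    intro l hl hlJ
    by_contra hc
    apply hlJ
    rw [hJ]
    by_cases h3 : (l : ℕ) = 3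
    · exact ⟨⟨0, by omega⟩, Fin.ext (by omega)⟩
    · exact ⟨⟨1, by omega⟩, Fin.ext (by omega)⟩
  obtain ⟨col⟩ : Nonempty ((Fin k ⊕ (Unit ⊕ Fin 3)) ↪ Fin (finrank K V)) :=
    Function.Embedding.nonempty_of_card_le (by simp; omega)
  -- The equation is a minor of size `k + 4` in the coordinates of the basis of `H` and of these
  -- four frame vectors. These are distinct coordinates of the cell, so they can be chosen to make
  -- the matrix the identity; if the minor is nonzero, the first vector of `f i₀` is not in
  -- `F^{i₁}_5 + H`.
  let v : (Fin k ⊕ (Unit ⊕ Fin 3)) × (Fin k ⊕ (Unit ⊕ Fin 3)) → CellVar s (finrank K V) :=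
    fun y => match y.1 with
      | Sum.inl j => basisCoord (p i₀ j) (col y.2)
      | Sum.inr (Sum.inl _) => freeCoord i₀ ⟨0, by omega⟩ (col y.2)
      | Sum.inr (Sum.inr n) => freeCoord i₁ ⟨n, by omega⟩ (col y.2)
  have hv : Function.Injective v := by
    rintro ⟨j | _ | n, c⟩ ⟨j' | _ | n', c'⟩ h <;>
      simp only [v, basisCoord, freeCoord, Sum.inl.injEq, Sum.inr.injEq, Prod.mk.injEq,
        Sigma.mk.injEq, heq_eq_eq, EmbeddingLike.apply_eq_iff_eq, reduceCtorEq, hi, hi.symm,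
        (hp i₀).injective.eq_iff, false_and, true_and, Fin.mk.injEq] at h ⊢
    · exact h
    · exact h
    · exact ⟨Fin.ext h.1, h.2⟩
  have hused : ∀ y, v y ∈ used J i₀ := by
    rintro ⟨j | _ | n, c⟩
    · exact (basisCoord_mem_used J i₀).mpr ((hJ _ _).mpr ⟨j, rfl⟩)
    · exact (freeCoord_mem_used J i₀).mpr hz
    · exact (freeCoord_mem_used J i₀).mpr (hn n)
  have hdet : ∀ x : CellVar s (finrank K V) → K, MvPolynomial.eval x (MvPolynomial.rename v
      (Matrix.mvPolynomialX (Fin k ⊕ (Unit ⊕ Fin 3)) (Fin k ⊕ (Unit ⊕ Fin 3)) K).det) =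
      (Matrix.of fun r c => x (v (r, c))).det := by
    intro x
    rw [MvPolynomial.eval_rename, RingHom.map_det]
    congr 1
    ext r c
    simp [Matrix.mvPolynomialX]
  refine ⟨MvPolynomial.rename v (Matrix.mvPolynomialX _ _ K).det,
    ⟨Function.extend v (fun y => (1 : Matrix _ _ K) y.1 y.2) 0, ?_, ?_⟩, ?_⟩
  · intro t ht
    rw [Function.extend_apply']
    · rfl
    · rintro ⟨y, rfl⟩
      exact ht (hused y)
  · rw [hdet]
    simp only [hv.extend_apply]
    exact (Matrix.det_one (R := K) (n := Fin k ⊕ (Unit ⊕ Fin 3))).trans_ne one_ne_zero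
  intro x f H hc hB
  rw [hdet]
  by_contra hne
  let w : Fin k ⊕ (Unit ⊕ Fin 3) → V := fun r => match r with
    | Sum.inl j => cellBasis x (p i₀ j)
    | Sum.inr (Sum.inl _) => f i₀ ⟨0, by omega⟩
    | Sum.inr (Sum.inr n) => f i₁ ⟨n, by omega⟩
  have hw : ∀ r c, (finBasis K V).repr (w r) (col c) = x (v (r, c)) := by
    rintro (j | _ | n) c
    · simp only [w, v, cellBasis]
      rw [Basis.repr_sum_self]
    · exact hc.free _ _ hz _
    · exact hc.free _ _ (hn n) _
  have hli : LinearIndependent K w := by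
    let P : V →ₗ[K] (Fin k ⊕ (Unit ⊕ Fin 3) → K) :=
      LinearMap.pi fun c => (finBasis K V).coord (col c)
    apply LinearIndependent.of_comp P
    have h1 : (P ∘ w) = (Matrix.of fun r c => x (v (r, c))).row := by
      funext r c
      simp only [P, Function.comp_apply, LinearMap.pi_apply, Basis.coord_apply, hw]
      rfl
    rw [h1, Matrix.linearIndependent_rows_iff_isUnit, Matrix.isUnit_iff_isUnit_det]
    exact Ne.isUnit hne
  refine hli.notMem_span_image (s := {r | r ≠ Sum.inr (Sum.inl ())})
    (x := Sum.inr (Sum.inl ())) (by simp) ?_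
  set S := Submodule.span K (w '' {r | r ≠ Sum.inr (Sum.inl ())}) with hS
  have hwS : ∀ r, r ≠ Sum.inr (Sum.inl ()) → w r ∈ S := fun r hr =>
    Submodule.subset_span ⟨r, hr, rfl⟩
  have hHS : H ≤ S := by
    rw [← hc.span_eq, Submodule.span_le]
    rintro _ ⟨m, hm, rfl⟩
    obtain ⟨j, rfl⟩ := (hJ _ _).mp hm
    exact hwS (Sum.inl j) (by simp)
  have hfree : ∀ l : Fin (finrank K V), (l : ℕ) < 5 → l ∉ J i₁ → f i₁ l ∈ S := fun l hl hlJ =>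
    hwS (Sum.inr (Sum.inr ⟨l, hjump l hl hlJ⟩)) (by simp)
  have hF : (flagsOf f i₁).sub 5 ≤ S := by
    refine Submodule.span_le.mpr ?_
    rintro _ ⟨l, hl, rfl⟩
    by_cases hlJ : l ∈ J i₁
    · have h1 := hc.sub_sum_mem i₁ hi l hlJ
      have h2 : Submodule.span K (f i₁ '' {l' | l' < l ∧ l' ∉ J i₁}) ≤ S := by
        rw [Submodule.span_le]
        rintro _ ⟨l', hl', rfl⟩
        exact hfree l' (lt_trans (Fin.lt_def.mp hl'.1) hl) hl'.2
      have h3 : ∑ m' ∈ J i₀, x (CellVar.coeff i₁ l m') • cellBasis x m' ∈ S :=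
        Submodule.sum_mem _ fun m' hm' => Submodule.smul_mem _ _ (hHS (hc.basis_mem hm'))
      have h4 := Submodule.add_mem _ (h2 h1) h3
      rwa [sub_add_cancel] at h4
    · exact hfree l hl hlJ
  exact (sup_le hF hHS) (hB (basis_mem_flag (f i₀) (by simp)))

end DimensionCount

/-! ### Traces and images of flags, and automorphisms acting on flags. -/

section FlagMaps

variable {K V : Type*} [Field K] [AddCommGroup V] [Module K V]

theorem finrank_comap_subtype (A W : Submodule K V) :
    finrank K (A.comap W.subtype) = finrank K ↥(W ⊓ A) := by
  rw [← Submodule.map_comap_subtype, Submodule.finrank_map_subtype_eq]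

/-- The traces of a flag on a subspace. -/
def traceChain (F : CompleteFlag K V) (W : Submodule K V) (m : ℕ) : Submodule K W :=
  (F.sub m).comap W.subtype

/-- The images in a quotient of the traces of a flag on a subspace. -/
def quotChain (F : CompleteFlag K V) (W L : Submodule K V) (m : ℕ) : Submodule K (V ⧸ W) :=
  (L ⊓ F.sub m).map W.mkQ

theorem finrank_traceChain (F : CompleteFlag K V) (W : Submodule K V) (m : ℕ) :
    finrank K (traceChain F W m) = finrank K ↥(W ⊓ F.sub m) :=
  finrank_comap_subtype _ _

/-- The image of a complete flag under a linear automorphism. -/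
def CompleteFlag.map (B : V ≃ₗ[K] V) (F : CompleteFlag K V) : CompleteFlag K V where
  sub j := (F.sub j).map (B : V →ₗ[K] V)
  mono := fun _ _ h => Submodule.map_mono (F.mono h)
  finrank_sub j := by rw [LinearEquiv.finrank_map_eq, F.finrank_sub]

theorem CompleteFlag.map_sub (B : V ≃ₗ[K] V) (F : CompleteFlag K V) (j : ℕ) :
    (F.map B).sub j = (F.sub j).map (B : V →ₗ[K] V) := rfl

theorem CompleteFlag.ofBasis_map (B : V ≃ₗ[K] V) (f : Basis (Fin (finrank K V)) K V) :
    CompleteFlag.ofBasis (f.map B) = (CompleteFlag.ofBasis f).map B := by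
  ext1
  funext m
  simp only [CompleteFlag.ofBasis, CompleteFlag.map]
  rw [Submodule.map_span, ← Set.image_comp]
  rfl

/-- The automorphism that acts by `θ` on the range of `ι` and trivially on the kernel of its
retraction `π`. -/
def extendAut {V₁ : Type*} [AddCommGroup V₁] [Module K V₁] (ι : V₁ →ₗ[K] V) (π : V →ₗ[K] V₁)
    (h : ∀ v, π (ι v) = v) (θ : V₁ ≃ₗ[K] V₁) : V ≃ₗ[K] V :=
  LinearEquiv.ofLinearMap (LinearMap.id - ι ∘ₗ π + ι ∘ₗ (θ : V₁ →ₗ[K] V₁) ∘ₗ π)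
    (LinearMap.id - ι ∘ₗ π + ι ∘ₗ (θ.symm : V₁ →ₗ[K] V₁) ∘ₗ π)
    (by ext v; simp [h]) (by ext v; simp [h])

section

variable {V₁ : Type*} [AddCommGroup V₁] [Module K V₁] {ι : V₁ →ₗ[K] V} {π : V →ₗ[K] V₁}
  (h : ∀ v, π (ι v) = v) (θ : V₁ ≃ₗ[K] V₁)

theorem extendAut_apply (v : V) : extendAut ι π h θ v = v - ι (π v) + ι (θ (π v)) := rfl

theorem extendAut_apply_incl (v : V₁) : extendAut ι π h θ (ι v) = ι (θ v) := by
  simp [extendAut_apply, h]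

theorem retract_extendAut_apply (v : V) : π (extendAut ι π h θ v) = θ (π v) := by
  simp [extendAut_apply, h]

end

variable [FiniteDimensional K V]

/-- Applying `B⁻¹` is linear in the coordinates of a frame, so the witnessing polynomial can be
pulled back. -/
theorem map_mem_zariskiInterior {s : ℕ} {P : (Fin s → CompleteFlag K V) → Prop}
    (B : V ≃ₗ[K] V) (hP : ∀ F, P F → P fun i => (F i).map B) {F : Fin s → CompleteFlag K V}
    (hF : F ∈ zariskiInterior P) : (fun i => (F i).map B) ∈ zariskiInterior P := by
  classical
  obtain ⟨f, p, rfl, hp, hp'⟩ := hF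
  obtain ⟨p', hp1⟩ := exists_evalFrames_comp
    (fun (g : Fin s → Basis (Fin (finrank K V)) K V) i => (g i).map B.symm) (by
      intro i m c
      obtain ⟨φ, hφ⟩ := exists_evalFrames_eq_sum i fun j =>
        if j = m then (finBasis K V).coord c ∘ₗ (B.symm : V →ₗ[K] V) else 0
      refine ⟨φ, fun e => ?_⟩
      rw [hφ, Finset.sum_eq_single m]
      · simp
      · intro j _ hj
        simp [hj]
      · simp) p
  have hback : ∀ g : Fin s → Basis (Fin (finrank K V)) K V,
      (fun i => ((flagsOf fun i => (g i).map B.symm) i).map B) = flagsOf g := by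
    intro g
    funext i
    simp only [flagsOf]
    rw [← CompleteFlag.ofBasis_map]
    congr 1
    apply Basis.eq_of_apply_eq
    intro j
    simp
  refine ⟨fun i => (f i).map B, p', ?_, ?_, ?_⟩
  · funext i
    exact CompleteFlag.ofBasis_map B (f i)
  · rw [hp1]
    convert hp using 2
    funext i
    apply Basis.eq_of_apply_eq
    intro j
    simp
  · intro g hg
    rw [hp1] at hg
    have := hP _ (hp' _ hg)
    rwa [hback] at this

/-- Moving some of the flags independently by general automorphisms that extend automorphisms of
a complemented space. -/
theorem generally_extendAut {V₁ : Type*} [AddCommGroup V₁] [Module K V₁] [FiniteDimensional K V₁]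
    {ι : V₁ →ₗ[K] V} {π : V →ₗ[K] V₁} (h : ∀ v, π (ι v) = v) {r s : ℕ}
    {P : (Fin s → CompleteFlag K V) → Prop} {F : Fin s → CompleteFlag K V}
    (hF : F ∈ zariskiInterior P) (ρ : Fin s → Option (Fin r)) (E : Fin r → CompleteFlag K V₁) :
    Generally fun E' : Fin r → CompleteFlag K V₁ => ∃ θ : Fin r → (V₁ ≃ₗ[K] V₁),
      (E' = fun j => (E j).map (θ j)) ∧
      (fun i => (ρ i).elim (F i) fun j => (F i).map (extendAut ι π h (θ j))) ∈
        zariskiInterior P := by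
  obtain ⟨f, p, rfl, hp, hp'⟩ := hF
  obtain ⟨e₀, rfl⟩ := exists_flagsOf E
  let θ : (Fin r → Basis (Fin (finrank K V₁)) K V₁) → Fin r → (V₁ ≃ₗ[K] V₁) :=
    fun e j => (e₀ j).equiv (e j) (Equiv.refl _)
  let Ψ : (Fin r → Basis (Fin (finrank K V₁)) K V₁) → Fin s → Basis (Fin (finrank K V)) K V :=
    fun e i => (ρ i).elim (f i) fun j => (f i).map (extendAut ι π h (θ e j))
  have hθ : ∀ e j v, θ e j v = ∑ l, (e₀ j).repr v l • e j l := by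
    intro e j v
    conv_lhs => rw [← (e₀ j).sum_repr v]
    rw [map_sum]
    simp [θ]
  -- At `e₀` all automorphisms are the identity, so the family passes through the given frames.
  have hΨ₀ : Ψ e₀ = f := by
    funext i
    have hid : ∀ j, extendAut ι π h (θ e₀ j) = LinearEquiv.refl K V := by
      intro j
      ext v
      rw [extendAut_apply, hθ, (e₀ j).sum_repr]
      simp
    simp only [Ψ]
    cases hρ : ρ i with
    | none => rfl
    | some j =>
      simp only [Option.elim_some, hid]
      apply Basis.eq_of_apply_eq
      intro m
      simp
  refine generally_of_family Ψ ?_ p e₀ (by rwa [hΨ₀]) _ ?_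
  · intro i m c
    simp only [Ψ]
    cases hρ : ρ i with
    | none => exact exists_evalFrames_eq_const (V := V₁) ((finBasis K V).repr (f i m) c)
    | some j =>
      simp only [Option.elim_some, Basis.map_apply, extendAut_apply, hθ, map_add,
        Finsupp.coe_add, Pi.add_apply]
      refine exists_evalFrames_eq_add (V := V₁)
        (exists_evalFrames_eq_const (K := K) (V := V₁) _) ?_
      obtain ⟨φ, hφ⟩ := exists_evalFrames_eq_sum (K := K) (V := V₁) j fun l =>
        (e₀ j).repr (π (f i m)) l • ((finBasis K V).coord c ∘ₗ ι)
      refine ⟨φ, fun e => ?_⟩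
      rw [hφ]
      simp
  · intro e he
    refine ⟨θ e, ?_, Ψ e, p, ?_, he, hp'⟩
    · funext j
      simp only [flagsOf]
      rw [← CompleteFlag.ofBasis_map]
      congr 1
      apply Basis.eq_of_apply_eq
      intro l
      simp [θ]
    · funext i
      simp only [flagsOf, Ψ]
      cases hρ : ρ i with
      | none => rfl
      | some j => exact CompleteFlag.ofBasis_map _ _

end FlagMaps

/-! ### The complete flag underlying a chain with repetitions. -/

section Induced

variable {K V : Type*} [Field K] [AddCommGroup V] [Module K V] [FiniteDimensional K V]

/-- The flag `E` consists of the members of the chain `C`. -/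
def IsInduced (C : ℕ → Submodule K V) (E : CompleteFlag K V) : Prop :=
  ∀ m, C m = E.sub (finrank K (C m))

/-- Dimensions in the chain grow by at most one, so every dimension occurs; the `j`-th member of the
flag is the first member of the chain of dimension at least `j`. -/
theorem exists_isInduced {C : ℕ → Submodule K V} (hC : Monotone C) (h0 : C 0 = ⊥)
    (htop : ∃ n, C n = ⊤) (hstep : ∀ m, finrank K (C (m + 1)) ≤ finrank K (C m) + 1) :
    ∃ E, IsInduced C E := by
  classical
  obtain ⟨n, hn⟩ := htop
  have hex : ∀ j, ∃ m, min j (finrank K V) ≤ finrank K (C m) := fun j =>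
    ⟨n, by rw [hn, finrank_top]; exact min_le_right _ _⟩
  have hdim : ∀ j, finrank K (C (Nat.find (hex j))) = min j (finrank K V) := by
    intro j
    apply le_antisymm _ (Nat.find_spec (hex j))
    rcases Nat.eq_zero_or_eq_succ_pred (Nat.find (hex j)) with h | h
    · rw [h, h0]; simp
    · have h1 := Nat.find_min (hex j) (m := (Nat.find (hex j)).pred) (by omega)
      have h2 := hstep (Nat.find (hex j)).pred
      rw [← Nat.succ_eq_add_one, ← h] at h2
      omega
  refine ⟨⟨fun j => C (Nat.find (hex j)), ?_, hdim⟩, ?_⟩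
  · intro i j hij
    apply hC
    apply Nat.find_min'
    exact (min_le_min_right _ hij).trans (Nat.find_spec (hex j))
  · intro m
    have h1 := hdim (finrank K (C m))
    replace h1 := h1.trans (min_eq_left (Submodule.finrank_le _))
    have h2 : Nat.find (hex (finrank K (C m))) ≤ m := Nat.find_min' _ (min_le_left _ _)
    exact (Submodule.eq_of_le_of_finrank_le (hC h2) h1.ge).symm

theorem IsInduced.unique {C : ℕ → Submodule K V} (h0 : C 0 = ⊥)
    (htop : ∃ n, C n = ⊤) (hstep : ∀ m, finrank K (C (m + 1)) ≤ finrank K (C m) + 1)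
    {E E' : CompleteFlag K V} (hE : IsInduced C E) (hE' : IsInduced C E') : E = E' := by
  classical
  ext1
  funext j
  obtain ⟨n, hn⟩ := htop
  rcases le_or_gt (finrank K V) j with hj | hj
  · rw [E.sub_eq_top hj, E'.sub_eq_top hj]
  have hex : ∃ m, j ≤ finrank K (C m) := ⟨n, by rw [hn, finrank_top]; omega⟩
  have hdim : finrank K (C (Nat.find hex)) = j := by
    apply le_antisymm _ (Nat.find_spec hex)
    rcases Nat.eq_zero_or_eq_succ_pred (Nat.find hex) with h | h
    · rw [h, h0]; simp
    · have h1 := Nat.find_min hex (m := (Nat.find hex).pred) (by omega)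
      have h2 := hstep (Nat.find hex).pred
      rw [← Nat.succ_eq_add_one, ← h] at h2
      omega
  rw [← hdim, ← hE, ← hE']

open Classical in
/-- The flag consisting of the members of the chain `C`, if there is one. -/
noncomputable def inducedFlag (C : ℕ → Submodule K V) : CompleteFlag K V :=
  if h : ∃ E, IsInduced C E then h.choose else CompleteFlag.ofBasis (finBasis K V)

theorem isInduced_inducedFlag {C : ℕ → Submodule K V} (h : ∃ E, IsInduced C E) :
    IsInduced C (inducedFlag C) := by
  rw [inducedFlag, dif_pos h]
  exact h.choose_spec

theorem CompleteFlag.finrank_inf_succ_le (F : CompleteFlag K V) (H : Submodule K V) (m : ℕ) :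
    finrank K ↥(H ⊓ F.sub (m + 1)) ≤ finrank K ↥(H ⊓ F.sub m) + 1 := by
  have h1 := finrank_inf_le_add (F.mono (Nat.le_succ m)) H
  rw [F.finrank_sub, F.finrank_sub] at h1
  simp only [Nat.succ_eq_add_one] at h1
  omega

theorem finrank_map_mkQ_add (A W : Submodule K V) :
    finrank K (A.map W.mkQ) + finrank K ↥(W ⊓ A) = finrank K A := by
  have h1 := (W.mkQ.domRestrict A).finrank_range_add_finrank_ker
  rw [LinearMap.range_domRestrict, LinearMap.ker_domRestrict, Submodule.ker_mkQ] at h1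
  rw [← h1]
  congr 1
  exact (finrank_comap_subtype W A ▸ by rw [inf_comm])

theorem traceChain_spec (F : CompleteFlag K V) (W : Submodule K V) :
    Monotone (traceChain F W) ∧ traceChain F W 0 = ⊥ ∧ (∃ n, traceChain F W n = ⊤) ∧
      ∀ m, finrank K (traceChain F W (m + 1)) ≤ finrank K (traceChain F W m) + 1 := by
  refine ⟨fun _ _ h => Submodule.comap_mono (F.mono h), ?_, ⟨finrank K V, ?_⟩, fun m => ?_⟩
  · simp [traceChain, F.sub_zero]
  · simp [traceChain, F.sub_eq_top le_rfl]
  · rw [finrank_traceChain, finrank_traceChain]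
    exact F.finrank_inf_succ_le W m

theorem finrank_map_le_succ {V' : Type*} [AddCommGroup V'] [Module K V'] (φ : V →ₗ[K] V')
    {A B : Submodule K V} (hAB : A ≤ B) (h : finrank K B ≤ finrank K A + 1) :
    finrank K (B.map φ) ≤ finrank K (A.map φ) + 1 := by
  have key : ∀ A : Submodule K V,
      finrank K (A.map φ) + finrank K ↥(A ⊓ LinearMap.ker φ) = finrank K A := by
    intro A
    have h1 := (φ.domRestrict A).finrank_range_add_finrank_ker
    rw [LinearMap.range_domRestrict, LinearMap.ker_domRestrict, finrank_comap_subtype] at h1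
    exact h1
  have h1 := key A
  have h2 := key B
  have h3 := Submodule.finrank_mono (inf_le_inf_right (LinearMap.ker φ) hAB)
  omega

theorem quotChain_spec (F : CompleteFlag K V) {W L : Submodule K V} (hL : L ⊔ W = ⊤) :
    Monotone (quotChain F W L) ∧ quotChain F W L 0 = ⊥ ∧ (∃ n, quotChain F W L n = ⊤) ∧
      ∀ m, finrank K (quotChain F W L (m + 1)) ≤ finrank K (quotChain F W L m) + 1 := by
  refine ⟨fun _ _ h => Submodule.map_mono (inf_le_inf_left _ (F.mono h)), ?_,
    ⟨finrank K V, ?_⟩, fun m => ?_⟩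
  · simp [quotChain, F.sub_zero]
  · have h1 : (L ⊔ W).map W.mkQ = L.map W.mkQ := by
      rw [Submodule.map_sup]
      simp
    simp only [quotChain, F.sub_eq_top le_rfl, inf_top_eq]
    rw [← h1, hL, Submodule.map_top, Submodule.range_mkQ]
  · exact finrank_map_le_succ _ (inf_le_inf_left _ (F.mono (Nat.le_succ m)))
      (F.finrank_inf_succ_le L m)

end Induced

/-! ### Auxiliary Schubert conditions given by their rows. -/

section Conditions

/-- Partitions given by their rows: four special ones and further ones. -/
def rowsProblem {t : ℕ} (l₀ l₁ l₂ l₃ : List ℕ) (x : Fin t → List ℕ) : Fin (4 + t) → ℕ → ℕ :=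
  Fin.append ![ofRows l₀, ofRows l₁, ofRows l₂, ofRows l₃] fun i => ofRows (x i)

/-- The rows `l` in one place and no rows elsewhere. -/
def singleRows {t : ℕ} (i : Fin t) (l : List ℕ) : Fin t → List ℕ := fun j => if j = i then l else []

theorem ofRows_le {l : List ℕ} {M : ℕ} (h : ∀ x ∈ l, x ≤ M) (j : ℕ) : ofRows l j ≤ M := by
  unfold ofRows
  rw [List.getD_eq_getElem?_getD]
  by_cases hj : j < l.length
  · rw [List.getElem?_eq_getElem hj]
    exact h _ (List.getElem_mem hj)
  · rw [List.getElem?_eq_none (by omega)]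
    exact Nat.zero_le _

theorem rowsProblem_le {t : ℕ} {l₀ l₁ l₂ l₃ : List ℕ} {x : Fin t → List ℕ} {M : ℕ}
    (h₀ : ∀ y ∈ l₀, y ≤ M) (h₁ : ∀ y ∈ l₁, y ≤ M) (h₂ : ∀ y ∈ l₂, y ≤ M) (h₃ : ∀ y ∈ l₃, y ≤ M)
    (hx : ∀ i, ∀ y ∈ x i, y ≤ M) (i : Fin (4 + t)) (j : ℕ) :
    rowsProblem l₀ l₁ l₂ l₃ x i j ≤ M := by
  unfold rowsProblem
  refine Fin.addCases (fun i => ?_) (fun i => ?_) i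
  · rw [Fin.append_left]
    fin_cases i
    · exact ofRows_le h₀ j
    · exact ofRows_le h₁ j
    · exact ofRows_le h₂ j
    · exact ofRows_le h₃ j
  · rw [Fin.append_right]
    exact ofRows_le (hx i) j

theorem sum_append_four {M : Type*} [AddCommMonoid M] {t : ℕ} (u : Fin (4 + t) → M) :
    ∑ i, u i = u (Fin.castAdd t 0) + u (Fin.castAdd t 1) + u (Fin.castAdd t 2) +
      u (Fin.castAdd t 3) + ∑ i, u (Fin.natAdd 4 i) := by
  rw [Fin.sum_univ_add, Fin.sum_univ_four]

theorem sum_rowsProblem {t : ℕ} (k : ℕ) (l₀ l₁ l₂ l₃ : List ℕ) (x : Fin t → List ℕ) :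
    ∑ i, ∑ j ∈ Finset.range k, rowsProblem l₀ l₁ l₂ l₃ x i j =
      ∑ j ∈ Finset.range k, ofRows l₀ j + ∑ j ∈ Finset.range k, ofRows l₁ j +
      ∑ j ∈ Finset.range k, ofRows l₂ j + ∑ j ∈ Finset.range k, ofRows l₃ j +
      ∑ i, ∑ j ∈ Finset.range k, ofRows (x i) j := by
  rw [sum_append_four]
  simp only [rowsProblem, Fin.append_left, Fin.append_right]
  rfl

theorem sum_singleRows {t : ℕ} (k : ℕ) (i : Fin t) (l : List ℕ) :
    ∑ i', ∑ j ∈ Finset.range k, ofRows (singleRows i l i') j =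
      ∑ j ∈ Finset.range k, ofRows l j := by
  rw [Finset.sum_eq_single i]
  · simp [singleRows]
  · intro i' _ hi'
    simp [singleRows, hi', ofRows]
  · simp

end Conditions

/-! ### The genericity conditions and why general flags satisfy them. -/

section General

variable {K X : Type*} [Field K] [AddCommGroup X] [Module K X]

/-- The conditions on tuples of flags for which a fibration is constructed, in terms of
nonexistence of certain subspaces in special position. -/
structure IsGeneral (a b : ℕ) {t : ℕ} (lam : Fin (4 + t) → ℕ → ℕ)
    (F : Fin (4 + t) → CompleteFlag K X) : Prop where
  line₁ : ∀ H ∈ solutions 1 (rowsProblem [3] [b + 1] [] [] fun _ => []) F, False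
  line₂ : ∀ H ∈ solutions 1 (rowsProblem [b + 2] [b - 1] [] [] fun _ => []) F, False
  plane₂ : ∀ H ∈ solutions 2 (rowsProblem [b + 1, 3] [b - 2] [2] [1] fun _ => []) F, False
  plane₃ : ∀ H ∈ solutions 2 (rowsProblem [b + 1, 3] [b - 2] [1] [2] fun _ => []) F, False
  plane : ∀ i, ∀ H ∈ solutions 2
    (rowsProblem [b + 1, 3] [b - 2] [1] [1] (singleRows i [1])) F, False
  space₁ : ∀ H ∈ solutions 3
    (rowsProblem [b, 2] [b, b - 2] [1, 1] [1, 1] fun _ => []) F, False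
  inf_plane : ∀ H ∈ solutions 2 (rowsProblem [b + 1, 3] [b - 2] [1] [1] fun _ => []) F,
    H ⊓ (F (Fin.castAdd t 2)).sub (b + 2) ⊓ (F (Fin.castAdd t 3)).sub (b + 2) = ⊥
  inf_space : ∀ i, ∀ H ∈ solutions 3
    (rowsProblem [b, 2] [b - 3] [1, 1] [1, 1] (singleRows i [b])) F,
    H ⊓ (F (Fin.castAdd t 1)).sub 5 ⊓ (F (Fin.castAdd t 0)).sub (b + 1) = ⊥
  inf_space₂ : ∀ H ∈ solutions 3
    (rowsProblem [b, 2] [b - 3] [b + 1, 1] [1, 1] fun _ => []) F,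
    H ⊓ (F (Fin.castAdd t 1)).sub 5 ⊓ (F (Fin.castAdd t 0)).sub (b + 1) = ⊥
  inf_space₃ : ∀ H ∈ solutions 3
    (rowsProblem [b, 2] [b - 3] [1, 1] [b + 1, 1] fun _ => []) F,
    H ⊓ (F (Fin.castAdd t 1)).sub 5 ⊓ (F (Fin.castAdd t 0)).sub (b + 1) = ⊥
  inf_main : ∀ H ∈ solutions (2 + a) lam F,
    H ⊓ (F (Fin.castAdd t 1)).sub 4 ⊓ (F (Fin.castAdd t 0)).sub (b + 1) = ⊥
  not_le_main : ∀ H ∈ solutions (2 + a) lam F,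
    ¬ (F (Fin.castAdd t 0)).sub 2 ≤ (F (Fin.castAdd t 1)).sub 5 ⊔ H

theorem exists_map_of_mem_solutions {k s : ℕ} {lam : Fin s → ℕ → ℕ} {F : Fin s → CompleteFlag K X}
    (B : X ≃ₗ[K] X) {H : Submodule K X} (hH : H ∈ solutions k lam fun i => (F i).map B) :
    ∃ H' ∈ solutions k lam F, H = H'.map (B : X →ₗ[K] X) := by
  have hB : Function.Injective (B : X →ₗ[K] X) := B.injective
  have h1 : H = (H.comap (B : X →ₗ[K] X)).map (B : X →ₗ[K] X) :=
    (Submodule.map_comap_eq_of_surjective B.surjective H).symm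
  refine ⟨H.comap (B : X →ₗ[K] X), ?_, h1⟩
  have hd : finrank K (H.comap (B : X →ₗ[K] X)) = finrank K H := by
    conv_rhs => rw [h1]
    exact (LinearEquiv.finrank_map_eq B _).symm
  refine ⟨hd.trans hH.1, fun i => ⟨hd.trans hH.1, fun j hj => ?_⟩⟩
  have h2 := (hH.2 i).2 j hj
  rw [CompleteFlag.map_sub, h1, ← Submodule.map_inf _ hB, LinearEquiv.finrank_map_eq] at h2
  exact h2

theorem IsGeneral.map {a b t : ℕ} {lam : Fin (4 + t) → ℕ → ℕ}
    {F : Fin (4 + t) → CompleteFlag K X} (hF : IsGeneral a b lam F) (B : X ≃ₗ[K] X) :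
    IsGeneral a b lam fun i => (F i).map B := by
  have hB : Function.Injective (B : X →ₗ[K] X) := B.injective
  have hinf : ∀ (H : Submodule K X) (i j : Fin (4 + t)) (m n : ℕ),
      H ⊓ (F i).sub m ⊓ (F j).sub n = ⊥ →
      H.map (B : X →ₗ[K] X) ⊓ ((F i).map B).sub m ⊓ ((F j).map B).sub n = ⊥ := by
    intro H i j m n h
    rw [CompleteFlag.map_sub, CompleteFlag.map_sub, ← Submodule.map_inf _ hB,
      ← Submodule.map_inf _ hB, h, Submodule.map_bot]
  constructor
  case not_le_main =>
    intro H hH hle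
    obtain ⟨H', hH', rfl⟩ := exists_map_of_mem_solutions B hH
    rw [CompleteFlag.map_sub, CompleteFlag.map_sub, ← Submodule.map_sup,
      Submodule.map_le_map_iff_of_injective hB] at hle
    exact hF.not_le_main H' hH' hle
  all_goals intro H
  case plane => 
    intro H hH
    obtain ⟨H', hH', -⟩ := exists_map_of_mem_solutions B hH
    exact hF.plane _ H' hH'
  case inf_space =>
    intro H hH
    obtain ⟨H', hH', rfl⟩ := exists_map_of_mem_solutions B hH
    exact hinf _ _ _ _ _ (hF.inf_space _ H' hH')
  all_goals
    intro hH
    obtain ⟨H', hH', rfl⟩ := exists_map_of_mem_solutions B hH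
  · exact hF.line₁ H' hH'
  · exact hF.line₂ H' hH'
  · exact hF.plane₂ H' hH'
  · exact hF.plane₃ H' hH'
  · exact hF.space₁ H' hH'
  · exact hinf _ _ _ _ _ (hF.inf_plane H' hH')
  · exact hinf _ _ _ _ _ (hF.inf_space₂ H' hH')
  · exact hinf _ _ _ _ _ (hF.inf_space₃ H' hH')
  · exact hinf _ _ _ _ _ (hF.inf_main H' hH')

variable [FiniteDimensional K X]

/-- Each condition is either an overdetermined Schubert problem or a closed condition on the
solutions of a problem of exactly the right size. Numerically, everything reduces to comparing `k *
(4 + b - k)` with a sum of rows. -/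
theorem onFrames_isGeneral {a b t : ℕ} (hX : finrank K X = 4 + b) (hab : a + 2 ≤ b) (ha : 0 < a)
    (lam : Fin (4 + t) → ℕ → ℕ) (hlam : IsSchubertProblem (2 + a) (4 + b) lam)
    (h₀ : lam (Fin.castAdd t 0) 0 = b - a + 1) (h₀' : lam (Fin.castAdd t 0) a = 2)
    (h₁ : lam (Fin.castAdd t 1) 0 = b - a - 1) (h₁' : lam (Fin.castAdd t 1) 1 = b - a - 1) :
    OnFrames fun F : Fin (4 + t) → CompleteFlag K X => IsGeneral a b lam F := by
  have hne : ∀ {i j : Fin 4}, i ≠ j → Fin.castAdd t i ≠ Fin.castAdd t j := fun h h' =>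
    h (Fin.castAdd_injective 4 t h')
  have empty : ∀ (k : ℕ) (l₀ l₁ l₂ l₃ : List ℕ) (x : Fin t → List ℕ), k ≤ 4 →
      (∀ y ∈ l₀, y ≤ 4 + b - k) → (∀ y ∈ l₁, y ≤ 4 + b - k) → (∀ y ∈ l₂, y ≤ 4 + b - k) →
      (∀ y ∈ l₃, y ≤ 4 + b - k) → (∀ i, ∀ y ∈ x i, y ≤ 4 + b - k) →
      k * (4 + b - k) < ∑ j ∈ Finset.range k, ofRows l₀ j + ∑ j ∈ Finset.range k, ofRows l₁ j +
        ∑ j ∈ Finset.range k, ofRows l₂ j + ∑ j ∈ Finset.range k, ofRows l₃ j +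
        ∑ i, ∑ j ∈ Finset.range k, ofRows (x i) j →
      OnFrames fun F : Fin (4 + t) → CompleteFlag K X =>
        ∀ H ∈ solutions k (rowsProblem l₀ l₁ l₂ l₃ x) F, False := by
    intro k l₀ l₁ l₂ l₃ x hk b₀ b₁ b₂ b₃ bx hsum
    refine onFrames_solutions_eq_empty (by omega) _ (Fin.castAdd t 0) ?_ ?_
    · intro i j _
      rw [hX]
      exact rowsProblem_le b₀ b₁ b₂ b₃ bx i j
    · rw [hX, sum_rowsProblem]
      exact hsum
  have meet : ∀ (k : ℕ) (l₀ l₁ l₂ l₃ : List ℕ) (x : Fin t → List ℕ) (i₀ i₁ : Fin 4) (m₀ m₁ : ℕ),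
      2 ≤ k → k ≤ 4 → i₁ ≠ i₀ →
      (∀ y ∈ l₀, y ≤ 4 + b - k) → (∀ y ∈ l₁, y ≤ 4 + b - k) → (∀ y ∈ l₂, y ≤ 4 + b - k) →
      (∀ y ∈ l₃, y ≤ 4 + b - k) → (∀ i, ∀ y ∈ x i, y ≤ 4 + b - k) →
      k * (4 + b - k) ≤ ∑ j ∈ Finset.range k, ofRows l₀ j + ∑ j ∈ Finset.range k, ofRows l₁ j +
        ∑ j ∈ Finset.range k, ofRows l₂ j + ∑ j ∈ Finset.range k, ofRows l₃ j +
        ∑ i, ∑ j ∈ Finset.range k, ofRows (x i) j →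
      m₁ + (![ofRows l₀, ofRows l₁, ofRows l₂, ofRows l₃] : Fin 4 → ℕ → ℕ) i₁ 0 = 4 + b - k + 1 →
      m₀ + (![ofRows l₀, ofRows l₁, ofRows l₂, ofRows l₃] : Fin 4 → ℕ → ℕ) i₀ (k - 2) =
        4 + b - 1 →
      OnFrames fun F : Fin (4 + t) → CompleteFlag K X =>
        ∀ H ∈ solutions k (rowsProblem l₀ l₁ l₂ l₃ x) F,
          H ⊓ (F (Fin.castAdd t i₁)).sub m₁ ⊓ (F (Fin.castAdd t i₀)).sub m₀ = ⊥ := by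
    intro k l₀ l₁ l₂ l₃ x i₀ i₁ m₀ m₁ hk2 hk hi b₀ b₁ b₂ b₃ bx hsum e₁ e₀
    refine onFrames_inf_inf_eq_bot (by omega) hk2 _ _ _ (hne hi) ?_ ?_ _ _ ?_ ?_
    · intro i j _
      rw [hX]
      exact rowsProblem_le b₀ b₁ b₂ b₃ bx i j
    · rw [hX, sum_rowsProblem]
      exact hsum
    · rw [hX, rowsProblem, Fin.append_left, e₁]
    · rw [hX, rowsProblem, Fin.append_left, e₀]
  have hlam' : ∀ i, ∀ j < 2 + a, lam i j ≤ finrank K X - (2 + a) := fun i j _ => by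
    rw [hX]
    exact ((hlam.1 i).1 (Nat.zero_le j)).trans (hlam.1 i).2.1
  have hsum : (2 + a) * (finrank K X - (2 + a)) ≤
      ∑ i, ∑ j ∈ Finset.range (2 + a), lam i j := by
    rw [hX]
    exact hlam.2.ge
  -- The row `p` of a problem in `Gr(1, 4 + b)` stands for the member of dimension `4 + b - p`. So
  -- this says `F⁰_{b+1} ∩ F¹_3 = 0`, and the next one `F⁰_2 ∩ F¹_5 = 0`.
  have p1 := empty 1 [3] [b + 1] [] [] (fun _ => []) (by omega) (by simp) (by simp)
    (by simp) (by simp) (by simp) (by simp [ofRows])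
  have p2 := empty 1 [b + 2] [b - 1] [] [] (fun _ => []) (by omega) (by simp; omega)
    (by simp; omega) (by simp) (by simp) (by simp) (by simp [ofRows]; omega)
  have p3 := empty 2 [b + 1, 3] [b - 2] [2] [1] (fun _ => []) (by omega) (by simp; omega)
    (by simp; omega) (by simp; omega) (by simp; omega) (by simp)
    (by simp [ofRows, Finset.sum_range_succ]; omega)
  have p4 := empty 2 [b + 1, 3] [b - 2] [1] [2] (fun _ => []) (by omega) (by simp; omega)
    (by simp; omega) (by simp; omega) (by simp; omega) (by simp)
    (by simp [ofRows, Finset.sum_range_succ]; omega)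
  have p5 : ∀ i : Fin t, _ := fun i => empty 2 [b + 1, 3] [b - 2] [1] [1] (singleRows i [1])
    (by omega) (by simp; omega) (by simp; omega) (by simp; omega) (by simp; omega)
    (by intro j y; unfold singleRows; split_ifs <;> simp; omega)
    (by rw [sum_singleRows]; simp [ofRows, Finset.sum_range_succ]; omega)
  have p6 := empty 3 [b, 2] [b, b - 2] [1, 1] [1, 1] (fun _ => []) (by omega) (by simp; omega)
    (by simp; omega) (by simp; omega) (by simp; omega) (by simp)
    (by simp [ofRows, Finset.sum_range_succ]; omega)
  -- The rows up to here are those of the base planes `h`. Their number of conditions is `2 * (b +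
  -- 2)`, exactly the dimension of `Gr(2, 4 + b)`.
  have p7 := meet 2 [b + 1, 3] [b - 2] [1] [1] (fun _ => []) 3 2 (b + 2) (b + 2) (by omega)
    (by omega) (by decide) (by simp; omega) (by simp; omega) (by simp; omega) (by simp; omega)
    (by simp) (by simp [ofRows, Finset.sum_range_succ]; omega) (by simp [ofRows]; omega)
    (by simp [ofRows]; omega)
  -- These problems concern the spaces `h + K v` and have exactly the size `3 * (b + 1)`, so they
  -- may have solutions. Their rows forget that the line `h ∩ F¹_5` lies in `F⁰_{b+1}`; the closed
  -- condition recovers this and gives the contradiction.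
  have p8 : ∀ i : Fin t, _ := fun i => meet 3 [b, 2] [b - 3] [1, 1] [1, 1] (singleRows i [b])
    0 1 (b + 1) 5 (by omega) (by omega) (by decide) (by simp; omega) (by simp; omega)
    (by simp; omega) (by simp; omega)
    (by intro j y; unfold singleRows; split_ifs <;> simp; omega)
    (by rw [sum_singleRows]; simp [ofRows, Finset.sum_range_succ]; omega) (by simp [ofRows]; omega)
    (by simp [ofRows]; omega)
  have p9 := meet 3 [b, 2] [b - 3] [b + 1, 1] [1, 1] (fun _ => [])
    0 1 (b + 1) 5 (by omega) (by omega) (by decide) (by simp; omega) (by simp; omega)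
    (by simp; omega) (by simp; omega) (by simp)
    (by simp [ofRows, Finset.sum_range_succ]; omega) (by simp [ofRows]; omega)
    (by simp [ofRows]; omega)
  have p10 := meet 3 [b, 2] [b - 3] [1, 1] [b + 1, 1] (fun _ => [])
    0 1 (b + 1) 5 (by omega) (by omega) (by decide) (by simp; omega) (by simp; omega)
    (by simp; omega) (by simp; omega) (by simp)
    (by simp [ofRows, Finset.sum_range_succ]; omega) (by simp [ofRows]; omega)
    (by simp [ofRows]; omega)
  have p11 := onFrames_inf_inf_eq_bot (K := K) (V := X) (k := 2 + a) (by omega) (by omega) lam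
    (Fin.castAdd t 0) (Fin.castAdd t 1) (hne (by decide)) hlam' hsum (b + 1) 4
    (by rw [hX, h₁]; omega) (by rw [Nat.add_sub_cancel_left, hX, h₀']; omega)
  have p12 := onFrames_not_le_sup (K := K) (V := X) (k := 2 + a) (by omega) (by omega) lam
    (Fin.castAdd t 0) (Fin.castAdd t 1) (hne (by decide)) hlam' hsum
    (by rw [hX, h₀]; omega) (by rw [hX, h₁]; omega) (by rw [hX, h₁']; omega)
  refine (p1.and (p2.and (p3.and (p4.and ((OnFrames.forall_fintype p5).and (p6.and (p7.and
    ((OnFrames.forall_fintype p8).and (p9.and (p10.and (p11.and p12))))))))))).mono ?_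
  rintro F ⟨q1, q2, q3, q4, q5, q6, q7, q8, q9, q10, q11, q12⟩
  exact ⟨q1, q2, q3, q4, q5, q6, q7, q8, q9, q10, q11, q12⟩

end General

/-! ### Criteria for Schubert conditions. -/

section Membership

variable {K X : Type*} [Field K] [AddCommGroup X] [Module K X] [FiniteDimensional K X]

theorem CompleteFlag.finrank_add_le (F : CompleteFlag K X) (H : Submodule K X) (m : ℕ)
    (hm : m ≤ finrank K X) : finrank K H + m ≤ finrank K ↥(H ⊓ F.sub m) + finrank K X := by
  have h1 := Submodule.finrank_sup_add_finrank_inf_eq H (F.sub m)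
  have h2 := Submodule.finrank_le (H ⊔ F.sub m)
  rw [F.finrank_sub, min_eq_left hm] at h1
  omega

theorem le_finrank_inf_of_le {F : CompleteFlag K X} {H : Submodule K X} {j m m' : ℕ}
    (h : j ≤ finrank K ↥(H ⊓ F.sub m)) (hm : m ≤ m') : j ≤ finrank K ↥(H ⊓ F.sub m') :=
  h.trans (Submodule.finrank_mono (inf_le_inf_left _ (F.mono hm)))

/-- Going down one step in a flag loses at most one dimension of the intersection. This is why only
the corners of a partition have to be checked. -/
theorem le_finrank_inf_of_sub {F : CompleteFlag K X} {H : Submodule K X} {j i m m' : ℕ}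
    (h : j + i ≤ finrank K ↥(H ⊓ F.sub m)) (hm : m ≤ m' + i) : j ≤ finrank K ↥(H ⊓ F.sub m') := by
  induction i generalizing m with
  | zero => exact le_finrank_inf_of_le h hm
  | succ i ih =>
    rcases Nat.eq_zero_or_eq_succ_pred m with h0 | h0
    · rw [h0, F.sub_zero, inf_bot_eq, finrank_bot] at h
      omega
    · rw [h0] at h
      have h1 := F.finrank_inf_succ_le H m.pred
      rw [← Nat.succ_eq_add_one] at h1
      exact ih (m := m.pred) (by omega) (by omega)

theorem le_finrank_inf_of_codim {F : CompleteFlag K X} {H : Submodule K X} {k j m : ℕ}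
    (hH : finrank K H = k) (hj : j ≤ k) (hm : finrank K X + j ≤ m + k) :
    j ≤ finrank K ↥(H ⊓ F.sub m) := by
  have h1 : finrank K ↥(H ⊓ F.sub (finrank K X)) = k := by
    rw [F.sub_eq_top le_rfl, inf_top_eq, hH]
  exact le_finrank_inf_of_sub (i := k - j) (by rw [h1]; omega) (by omega)

theorem mem_schubertVariety_nil {F : CompleteFlag K X} {H : Submodule K X} {k : ℕ}
    (hH : finrank K H = k) : H ∈ schubertVariety k (ofRows []) F := by
  have := Submodule.finrank_le H
  refine ⟨hH, fun j hj => ?_⟩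
  exact le_finrank_inf_of_codim hH (by omega) (by simp [ofRows]; omega)

theorem mem_schubertVariety_one {F : CompleteFlag K X} {H : Submodule K X} {k p : ℕ}
    (hH : finrank K H = k) (m : ℕ) (h : 1 ≤ finrank K ↥(H ⊓ F.sub m))
    (hm : m + p ≤ finrank K X - k + 1) : H ∈ schubertVariety k (ofRows [p]) F := by
  have := Submodule.finrank_le H
  refine ⟨hH, fun j hj => ?_⟩
  rcases j with _ | j
  · exact le_finrank_inf_of_le h (by simp [ofRows]; omega)
  · exact le_finrank_inf_of_codim hH (by omega) (by simp [ofRows]; omega)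

theorem mem_schubertVariety_two {F : CompleteFlag K X} {H : Submodule K X} {k p q : ℕ}
    (hH : finrank K H = k) (m m' : ℕ) (h : 1 ≤ finrank K ↥(H ⊓ F.sub m))
    (hm : m + p ≤ finrank K X - k + 1) (h' : 2 ≤ finrank K ↥(H ⊓ F.sub m'))
    (hm' : m' + q ≤ finrank K X - k + 2) : H ∈ schubertVariety k (ofRows [p, q]) F := by
  have := Submodule.finrank_le H
  refine ⟨hH, fun j hj => ?_⟩
  rcases j with _ | _ | j
  · exact le_finrank_inf_of_le h (by simp [ofRows]; omega)
  · exact le_finrank_inf_of_le h' (by simp [ofRows]; omega)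
  · exact le_finrank_inf_of_codim hH (by omega) (by simp [ofRows]; omega)

set_option linter.unusedSectionVars false in
theorem mem_solutions_rowsProblem {t k : ℕ} {l₀ l₁ l₂ l₃ : List ℕ} {x : Fin t → List ℕ}
    {F : Fin (4 + t) → CompleteFlag K X} {H : Submodule K X} (hH : finrank K H = k)
    (h₀ : H ∈ schubertVariety k (ofRows l₀) (F (Fin.castAdd t 0)))
    (h₁ : H ∈ schubertVariety k (ofRows l₁) (F (Fin.castAdd t 1)))
    (h₂ : H ∈ schubertVariety k (ofRows l₂) (F (Fin.castAdd t 2)))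
    (h₃ : H ∈ schubertVariety k (ofRows l₃) (F (Fin.castAdd t 3)))
    (hx : ∀ i, H ∈ schubertVariety k (ofRows (x i)) (F (Fin.natAdd 4 i))) :
    H ∈ solutions k (rowsProblem l₀ l₁ l₂ l₃ x) F := by
  refine ⟨hH, fun i => ?_⟩
  unfold rowsProblem
  refine Fin.addCases (fun i => ?_) (fun i => ?_) i
  · rw [Fin.append_left]
    fin_cases i
    · exact h₀
    · exact h₁
    · exact h₂
    · exact h₃
  · rw [Fin.append_right]
    exact hx i

theorem one_le_finrank_of_mem {A : Submodule K X} {v : X} (hv : v ∈ A) (h0 : v ≠ 0) :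
    1 ≤ finrank K A := by
  rw [Nat.one_le_iff_ne_zero]
  intro h
  rw [Submodule.finrank_eq_zero] at h
  rw [h] at hv
  exact h0 ((Submodule.mem_bot K).mp hv)

theorem one_le_finrank_of_ne_bot {A : Submodule K X} (hA : A ≠ ⊥) : 1 ≤ finrank K A :=
  Nat.one_le_iff_ne_zero.mpr fun h => hA (Submodule.finrank_eq_zero.mp h)

theorem finrank_sup_span_singleton {A : Submodule K X} {v : X} (hv : v ∉ A) :
    finrank K ↥(A ⊔ K ∙ v) = finrank K A + 1 := by
  have h0 : v ≠ 0 := fun h => hv (h ▸ A.zero_mem)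
  have h1 := Submodule.finrank_sup_add_finrank_inf_eq A (K ∙ v)
  have h2 : A ⊓ K ∙ v = ⊥ := by
    rw [Submodule.eq_bot_iff]
    rintro y ⟨hy, hyv⟩
    obtain ⟨α, rfl⟩ := Submodule.mem_span_singleton.mp hyv
    rcases eq_or_ne α 0 with rfl | hα
    · simp
    · exact absurd ((Submodule.smul_mem_iff _ hα).mp hy) hv
  rw [h2, finrank_bot, finrank_span_singleton h0] at h1
  omega

/-- Adding a vector of `C + A` outside `A` to `A` increases the intersection with `C`. -/
theorem finrank_inf_lt_of_mem_sup {A C : Submodule K X} {v : X} (hv : v ∉ A) (hvC : v ∈ C ⊔ A) :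
    finrank K ↥(A ⊓ C) + 1 ≤ finrank K ↥((A ⊔ K ∙ v) ⊓ C) := by
  obtain ⟨c, hc, y, hy, rfl⟩ := Submodule.mem_sup.mp hvC
  have hcA : c ∉ A ⊓ C := fun h => hv (A.add_mem h.1 hy)
  rw [← finrank_sup_span_singleton hcA]
  apply Submodule.finrank_mono
  rw [sup_le_iff, Submodule.span_singleton_le_iff_mem]
  refine ⟨inf_le_inf_right _ le_sup_left, ?_, hc⟩
  have h1 := Submodule.sub_mem (A ⊔ K ∙ (c + y))
    (Submodule.mem_sup_right (Submodule.mem_span_singleton_self (c + y)))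
    (Submodule.mem_sup_left hy)
  rwa [add_sub_cancel_right] at h1

end Membership

/-! ### Base planes and their extensions in general position. -/

section Transversality

variable {K X : Type*} [Field K] [AddCommGroup X] [Module K X]

/-- The subspace attached to a tuple of flags. -/
def baseSpace (b : ℕ) {t : ℕ} (F : Fin (4 + t) → CompleteFlag K X) : Submodule K X :=
  (F (Fin.castAdd t 0)).sub 2 ⊔
    ((F (Fin.castAdd t 1)).sub 5 ⊓ (F (Fin.castAdd t 0)).sub (b + 1))

/-- The subspace that contains the solutions meeting `baseSpace` in `h`. -/
def liftSpace (b : ℕ) {t : ℕ} (F : Fin (4 + t) → CompleteFlag K X) (h : Submodule K X) :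
    Submodule K X :=
  ((F (Fin.castAdd t 2)).sub (b + 2) ⊔ h) ⊓ ((F (Fin.castAdd t 3)).sub (b + 2) ⊔ h)

/-- The solutions of the base problem, as subspaces of the whole space. -/
structure IsBasePlane (b : ℕ) {t : ℕ} (F : Fin (4 + t) → CompleteFlag K X) (h : Submodule K X) :
    Prop where
  finrank_eq : finrank K h = 2
  meet₀ : 1 ≤ finrank K ↥(h ⊓ (F (Fin.castAdd t 0)).sub 2)
  le₀ : h ≤ (F (Fin.castAdd t 0)).sub (b + 1)
  meet₁ : 1 ≤ finrank K ↥(h ⊓ (F (Fin.castAdd t 1)).sub 5)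
  meet₂ : 1 ≤ finrank K ↥(h ⊓ (F (Fin.castAdd t 2)).sub (b + 2))
  meet₃ : 1 ≤ finrank K ↥(h ⊓ (F (Fin.castAdd t 3)).sub (b + 2))

variable [FiniteDimensional K X] {a b t : ℕ} {lam : Fin (4 + t) → ℕ → ℕ}
  {F : Fin (4 + t) → CompleteFlag K X}

theorem IsGeneral.inf_eq_bot (hX : finrank K X = 4 + b) (hF : IsGeneral a b lam F) :
    (F (Fin.castAdd t 0)).sub (b + 1) ⊓ (F (Fin.castAdd t 1)).sub 3 = ⊥ := by
  by_contra hne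
  obtain ⟨v, hv, h0⟩ := Submodule.exists_mem_ne_zero_of_ne_bot hne
  have hd : finrank K (K ∙ v) = 1 := finrank_span_singleton h0
  have hm : ∀ {A : Submodule K X}, v ∈ A → 1 ≤ finrank K ↥(K ∙ v ⊓ A) := fun h =>
    one_le_finrank_of_mem ⟨Submodule.mem_span_singleton_self v, h⟩ h0
  exact hF.line₁ (K ∙ v) (mem_solutions_rowsProblem hd
    (mem_schubertVariety_one hd (b + 1) (hm hv.1) (by omega))
    (mem_schubertVariety_one hd 3 (hm hv.2) (by omega))
    (mem_schubertVariety_nil hd) (mem_schubertVariety_nil hd) fun i => mem_schubertVariety_nil hd)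

theorem IsGeneral.inf_eq_bot' (hX : finrank K X = 4 + b) (hb : 3 ≤ b)
    (hF : IsGeneral a b lam F) :
    (F (Fin.castAdd t 0)).sub 2 ⊓ (F (Fin.castAdd t 1)).sub 5 = ⊥ := by
  by_contra hne
  obtain ⟨v, hv, h0⟩ := Submodule.exists_mem_ne_zero_of_ne_bot hne
  have hd : finrank K (K ∙ v) = 1 := finrank_span_singleton h0
  have hm : ∀ {A : Submodule K X}, v ∈ A → 1 ≤ finrank K ↥(K ∙ v ⊓ A) := fun h =>
    one_le_finrank_of_mem ⟨Submodule.mem_span_singleton_self v, h⟩ h0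
  exact hF.line₂ (K ∙ v) (mem_solutions_rowsProblem hd
    (mem_schubertVariety_one hd 2 (hm hv.1) (by omega))
    (mem_schubertVariety_one hd 5 (hm hv.2) (by omega))
    (mem_schubertVariety_nil hd) (mem_schubertVariety_nil hd) fun i => mem_schubertVariety_nil hd)

namespace IsBasePlane

variable {h : Submodule K X}

set_option linter.unusedSectionVars false in
theorem two_le₀ (hh : IsBasePlane b F h) :
    2 ≤ finrank K ↥(h ⊓ (F (Fin.castAdd t 0)).sub (b + 1)) := by
  rw [inf_eq_left.mpr hh.le₀, hh.finrank_eq]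

theorem mem₀ (hX : finrank K X = 4 + b) (hh : IsBasePlane b F h) :
    h ∈ schubertVariety 2 (ofRows [b + 1, 3]) (F (Fin.castAdd t 0)) :=
  mem_schubertVariety_two hh.finrank_eq 2 (b + 1) hh.meet₀ (by omega) hh.two_le₀ (by omega)

theorem mem₁ (hX : finrank K X = 4 + b) (hb : 3 ≤ b) (hh : IsBasePlane b F h) :
    h ∈ schubertVariety 2 (ofRows [b - 2]) (F (Fin.castAdd t 1)) :=
  mem_schubertVariety_one hh.finrank_eq 5 hh.meet₁ (by omega)

theorem mem₂ (hX : finrank K X = 4 + b) (hh : IsBasePlane b F h) :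
    h ∈ schubertVariety 2 (ofRows [1]) (F (Fin.castAdd t 2)) :=
  mem_schubertVariety_one hh.finrank_eq (b + 2) hh.meet₂ (by omega)

theorem mem₃ (hX : finrank K X = 4 + b) (hh : IsBasePlane b F h) :
    h ∈ schubertVariety 2 (ofRows [1]) (F (Fin.castAdd t 3)) :=
  mem_schubertVariety_one hh.finrank_eq (b + 2) hh.meet₃ (by omega)

theorem inf_inf_eq_bot (hX : finrank K X = 4 + b) (hb : 3 ≤ b) (hF : IsGeneral a b lam F)
    (hh : IsBasePlane b F h) :
    h ⊓ (F (Fin.castAdd t 2)).sub (b + 2) ⊓ (F (Fin.castAdd t 3)).sub (b + 2) = ⊥ :=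
  hF.inf_plane h (mem_solutions_rowsProblem hh.finrank_eq (hh.mem₀ hX) (hh.mem₁ hX hb)
    (hh.mem₂ hX) (hh.mem₃ hX) fun _ => mem_schubertVariety_nil hh.finrank_eq)

theorem inf₂ (hX : finrank K X = 4 + b) (hb : 3 ≤ b) (hF : IsGeneral a b lam F)
    (hh : IsBasePlane b F h) : h ⊓ (F (Fin.castAdd t 2)).sub (b + 1) = ⊥ := by
  by_contra hne
  exact hF.plane₂ h (mem_solutions_rowsProblem hh.finrank_eq (hh.mem₀ hX) (hh.mem₁ hX hb)
    (mem_schubertVariety_one hh.finrank_eq (b + 1) (one_le_finrank_of_ne_bot hne) (by omega))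
    (hh.mem₃ hX) fun _ => mem_schubertVariety_nil hh.finrank_eq)

theorem inf₃ (hX : finrank K X = 4 + b) (hb : 3 ≤ b) (hF : IsGeneral a b lam F)
    (hh : IsBasePlane b F h) : h ⊓ (F (Fin.castAdd t 3)).sub (b + 1) = ⊥ := by
  by_contra hne
  exact hF.plane₃ h (mem_solutions_rowsProblem hh.finrank_eq (hh.mem₀ hX) (hh.mem₁ hX hb)
    (hh.mem₂ hX)
    (mem_schubertVariety_one hh.finrank_eq (b + 1) (one_le_finrank_of_ne_bot hne) (by omega))
    fun _ => mem_schubertVariety_nil hh.finrank_eq)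

theorem inf (hX : finrank K X = 4 + b) (hb : 3 ≤ b) (hF : IsGeneral a b lam F)
    (hh : IsBasePlane b F h) (i : Fin t) : h ⊓ (F (Fin.natAdd 4 i)).sub (b + 2) = ⊥ := by
  by_contra hne
  refine hF.plane i h (mem_solutions_rowsProblem hh.finrank_eq (hh.mem₀ hX) (hh.mem₁ hX hb)
    (hh.mem₂ hX) (hh.mem₃ hX) fun i' => ?_)
  unfold singleRows
  split_ifs with hi
  · subst hi
    exact mem_schubertVariety_one hh.finrank_eq (b + 2) (one_le_finrank_of_ne_bot hne) (by omega)
  · exact mem_schubertVariety_nil hh.finrank_eq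

theorem inf₁ (hX : finrank K X = 4 + b) (hF : IsGeneral a b lam F)
    (hh : IsBasePlane b F h) : h ⊓ (F (Fin.castAdd t 1)).sub 2 = ⊥ := by
  rw [eq_bot_iff, ← hF.inf_eq_bot hX]
  exact inf_le_inf hh.le₀ ((F _).mono (by omega))

section Extension

variable {v : X}

theorem finrank_extension (hh : IsBasePlane b F h) (hv : v ∉ h) :
    finrank K ↥(h ⊔ K ∙ v) = 3 := by
  rw [finrank_sup_span_singleton hv, hh.finrank_eq]

theorem extension_mem₀ (hX : finrank K X = 4 + b) (hh : IsBasePlane b F h) (hv : v ∉ h) :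
    h ⊔ K ∙ v ∈ schubertVariety 3 (ofRows [b, 2]) (F (Fin.castAdd t 0)) :=
  mem_schubertVariety_two (hh.finrank_extension hv) 2 (b + 1)
    (hh.meet₀.trans (Submodule.finrank_mono (inf_le_inf_right _ le_sup_left))) (by omega)
    (hh.two_le₀.trans (Submodule.finrank_mono (inf_le_inf_right _ le_sup_left))) (by omega)

theorem extension_mem₁ (hX : finrank K X = 4 + b) (hb : 3 ≤ b) (hh : IsBasePlane b F h)
    (hv : v ∉ h) : h ⊔ K ∙ v ∈ schubertVariety 3 (ofRows [b - 3]) (F (Fin.castAdd t 1)) :=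
  mem_schubertVariety_one (hh.finrank_extension hv) 5
    (hh.meet₁.trans (Submodule.finrank_mono (inf_le_inf_right _ le_sup_left))) (by omega)

/-- The line of `h` in `E_{b+2}` and the new vector, corrected by an element of `h`, give a
two-dimensional intersection with `E_{b+2}`; one dimension of it survives in `E_{b+1}`. -/
theorem extension_mem (hX : finrank K X = 4 + b) (hh : IsBasePlane b F h) (hv : v ∉ h)
    {E : CompleteFlag K X} (hE : 1 ≤ finrank K ↥(h ⊓ E.sub (b + 2)))
    (hvE : v ∈ E.sub (b + 2) ⊔ h) : h ⊔ K ∙ v ∈ schubertVariety 3 (ofRows [1, 1]) E := by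
  have h1 := finrank_inf_lt_of_mem_sup hv hvE
  have h2 : 1 + 1 ≤ finrank K ↥((h ⊔ K ∙ v) ⊓ E.sub (b + 2)) := by omega
  exact mem_schubertVariety_two (hh.finrank_extension hv) (b + 1) (b + 2)
    (le_finrank_inf_of_sub (i := 1) h2 le_rfl) (by omega) h2 (by omega)

set_option linter.unusedSectionVars false in
-- The extension contains `h ∩ F¹_5`, which lies in `F⁰_{b+1}` because `h` does. This contradicts
-- `inf_space` and its variants.
theorem extension_inf_ne_bot (hh : IsBasePlane b F h) :
    (h ⊔ K ∙ v) ⊓ (F (Fin.castAdd t 1)).sub 5 ⊓ (F (Fin.castAdd t 0)).sub (b + 1) ≠ ⊥ := by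
  intro hbot
  have h1 : h ⊓ (F (Fin.castAdd t 1)).sub 5 ≤ ⊥ := by
    rw [← hbot]
    exact le_inf (inf_le_inf_right _ le_sup_left) (inf_le_left.trans hh.le₀)
  have h2 := hh.meet₁
  rw [le_bot_iff.mp h1, finrank_bot] at h2
  omega

end Extension

/-- A nonzero `v` in the intersection is not in `h`, and `h + K v` would be a three-dimensional
space of the kind excluded by `inf_space`. This transversality makes the quotient flag have
dimension `m` at index `m + 2`. -/
theorem inf_liftSpace (hX : finrank K X = 4 + b) (hb : 3 ≤ b) (hF : IsGeneral a b lam F)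
    (hh : IsBasePlane b F h) (i : Fin t) :
    (F (Fin.natAdd 4 i)).sub 2 ⊓ liftSpace b F h = ⊥ := by
  by_contra hne
  obtain ⟨v, hv, h0⟩ := Submodule.exists_mem_ne_zero_of_ne_bot hne
  have hvh : v ∉ h := by
    intro hvh
    have h1 := hh.inf hX hb hF i
    have h2 : v ∈ h ⊓ (F (Fin.natAdd 4 i)).sub (b + 2) := ⟨hvh, (F _).mono (by omega) hv.1⟩
    rw [h1] at h2
    exact h0 ((Submodule.mem_bot K).mp h2)
  refine hh.extension_inf_ne_bot (v := v) (hF.inf_space i _ (mem_solutions_rowsProblem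
    (hh.finrank_extension hvh) (hh.extension_mem₀ hX hvh) (hh.extension_mem₁ hX hb hvh)
    (hh.extension_mem hX hvh hh.meet₂ hv.2.1) (hh.extension_mem hX hvh hh.meet₃ hv.2.2)
    fun i' => ?_))
  unfold singleRows
  split_ifs with hi
  · subst hi
    refine mem_schubertVariety_one (hh.finrank_extension hvh) 2 (one_le_finrank_of_mem
      ⟨Submodule.mem_sup_right (Submodule.mem_span_singleton_self v), hv.1⟩ h0) (by omega)
  · exact mem_schubertVariety_nil (hh.finrank_extension hvh)

/-- Here `v` also lies in `F¹_5`, so `h + K v` meets it in dimension two. The Schubert conditions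
alone are then too many. -/
theorem inf_liftSpace₁ (hX : finrank K X = 4 + b) (hb : 3 ≤ b) (hF : IsGeneral a b lam F)
    (hh : IsBasePlane b F h) : (F (Fin.castAdd t 1)).sub 2 ⊓ liftSpace b F h = ⊥ := by
  by_contra hne
  obtain ⟨v, hv, h0⟩ := Submodule.exists_mem_ne_zero_of_ne_bot hne
  have hvh : v ∉ h := by
    intro hvh
    have h1 := hh.inf₁ hX hF
    have h2 : v ∈ h ⊓ (F (Fin.castAdd t 1)).sub 2 := ⟨hvh, hv.1⟩
    rw [h1] at h2
    exact h0 ((Submodule.mem_bot K).mp h2)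
  have h5 := finrank_inf_lt_of_mem_sup (C := (F (Fin.castAdd t 1)).sub 5) hvh
    (Submodule.mem_sup_left ((F _).mono (by omega) hv.1))
  have := hh.meet₁
  exact hF.space₁ _ (mem_solutions_rowsProblem
    (hh.finrank_extension hvh) (hh.extension_mem₀ hX hvh)
    (mem_schubertVariety_two (hh.finrank_extension hvh) 2 5 (one_le_finrank_of_mem
      ⟨Submodule.mem_sup_right (Submodule.mem_span_singleton_self v), hv.1⟩ h0) (by omega)
      (by omega) (by omega))
    (hh.extension_mem hX hvh hh.meet₂ hv.2.1) (hh.extension_mem hX hvh hh.meet₃ hv.2.2)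
    fun i' => mem_schubertVariety_nil (hh.finrank_extension hvh))

theorem extension_mem_line (hX : finrank K X = 4 + b) (hh : IsBasePlane b F h) {v : X}
    (hv : v ∉ h) {E : CompleteFlag K X} (hE : 1 ≤ finrank K ↥(h ⊓ E.sub (b + 2)))
    (hvE : v ∈ E.sub 1) : h ⊔ K ∙ v ∈ schubertVariety 3 (ofRows [b + 1, 1]) E := by
  have h0 : v ≠ 0 := fun h0 => hv (h0 ▸ h.zero_mem)
  have h1 := finrank_inf_lt_of_mem_sup (C := E.sub (b + 2)) hv
    (Submodule.mem_sup_left (E.mono (by omega) hvE))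
  exact mem_schubertVariety_two (hh.finrank_extension hv) 1 (b + 2) (one_le_finrank_of_mem
      ⟨Submodule.mem_sup_right (Submodule.mem_span_singleton_self v), hvE⟩ h0) (by omega)
      (by omega) (by omega)

/-- The second flag lies in `F²_{b+2} + h` up to dimension `b + 2`, so on that range only the other
factor of `liftSpace` cuts it, and it is this factor that the line `F²_1` has to avoid. -/
theorem inf_sup₂ (hX : finrank K X = 4 + b) (hb : 3 ≤ b) (hF : IsGeneral a b lam F)
    (hh : IsBasePlane b F h) :
    (F (Fin.castAdd t 2)).sub 1 ⊓ ((F (Fin.castAdd t 3)).sub (b + 2) ⊔ h) = ⊥ := by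
  by_contra hne
  obtain ⟨v, hv, h0⟩ := Submodule.exists_mem_ne_zero_of_ne_bot hne
  have hvh : v ∉ h := by
    intro hvh
    have h1 := hh.inf₂ hX hb hF
    have h2 : v ∈ h ⊓ (F (Fin.castAdd t 2)).sub (b + 1) := ⟨hvh, (F _).mono (by omega) hv.1⟩
    rw [h1] at h2
    exact h0 ((Submodule.mem_bot K).mp h2)
  exact hh.extension_inf_ne_bot (v := v) (hF.inf_space₂ _ (mem_solutions_rowsProblem
    (hh.finrank_extension hvh) (hh.extension_mem₀ hX hvh) (hh.extension_mem₁ hX hb hvh)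
    (hh.extension_mem_line hX hvh hh.meet₂ hv.1) (hh.extension_mem hX hvh hh.meet₃ hv.2)
    fun i' => mem_schubertVariety_nil (hh.finrank_extension hvh)))

theorem inf_sup₃ (hX : finrank K X = 4 + b) (hb : 3 ≤ b) (hF : IsGeneral a b lam F)
    (hh : IsBasePlane b F h) :
    (F (Fin.castAdd t 3)).sub 1 ⊓ ((F (Fin.castAdd t 2)).sub (b + 2) ⊔ h) = ⊥ := by
  by_contra hne
  obtain ⟨v, hv, h0⟩ := Submodule.exists_mem_ne_zero_of_ne_bot hne
  have hvh : v ∉ h := by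
    intro hvh
    have h1 := hh.inf₃ hX hb hF
    have h2 : v ∈ h ⊓ (F (Fin.castAdd t 3)).sub (b + 1) := ⟨hvh, (F _).mono (by omega) hv.1⟩
    rw [h1] at h2
    exact h0 ((Submodule.mem_bot K).mp h2)
  exact hh.extension_inf_ne_bot (v := v) (hF.inf_space₃ _ (mem_solutions_rowsProblem
    (hh.finrank_extension hvh) (hh.extension_mem₀ hX hvh) (hh.extension_mem₁ hX hb hvh)
    (hh.extension_mem hX hvh hh.meet₂ hv.2) (hh.extension_mem_line hX hvh hh.meet₃ hv.1)
    fun i' => mem_schubertVariety_nil (hh.finrank_extension hvh)))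

end IsBasePlane

end Transversality

/-! ### Schubert conditions on a subspace and on its image. -/

section Comparison

theorem ofRows_replicate (n x j : ℕ) : ofRows (List.replicate n x) j = if j < n then x else 0 := by
  unfold ofRows
  rw [List.getD_eq_getElem?_getD, List.getElem?_replicate]
  split_ifs <;> rfl

theorem ofRows_cons_replicate_succ (y n x j : ℕ) :
    ofRows (y :: List.replicate n x) (j + 1) = if j < n then x else 0 := by
  rw [← ofRows_replicate]
  rfl

theorem ofRows_cons_zero (y : ℕ) (l : List ℕ) : ofRows (y :: l) 0 = y := rfl

variable {K X Y : Type*} [Field K] [AddCommGroup X] [Module K X] [FiniteDimensional K X]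
  [AddCommGroup Y] [Module K Y] [FiniteDimensional K Y] {a b : ℕ} {F : CompleteFlag K X}
  {G : CompleteFlag K Y} {H : Submodule K X} {M : Submodule K Y}

set_option linter.unusedSectionVars false in
-- The codimension rises from `b - a` to `b + 2 - a`, which is the shift of the flag by two; the two
-- new rows are zero and impose nothing.
theorem mem_schubertVariety_iff_of_partition (hX : finrank K X = 4 + b) (hY : finrank K Y = b)
    (hab : a ≤ b) (hH : finrank K H = 2 + a) (hM : finrank K M = a) {l : ℕ → ℕ}
    (hl : IsPartitionFor a b l)
    (hdim : ∀ m ≤ b, finrank K ↥(H ⊓ F.sub (m + 2)) = finrank K ↥(M ⊓ G.sub m)) :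
    H ∈ schubertVariety (2 + a) l F ↔ M ∈ schubertVariety a l G := by
  have hle : ∀ j, l j ≤ b - a := fun j => (hl.1 (Nat.zero_le j)).trans hl.2.1
  have key : ∀ j < a, finrank K ↥(H ⊓ F.sub (finrank K X - (2 + a) + (j + 1) - l j)) =
      finrank K ↥(M ⊓ G.sub (finrank K Y - a + (j + 1) - l j)) := by
    intro j hj
    have := hle j
    have e : finrank K X - (2 + a) + (j + 1) - l j = finrank K Y - a + (j + 1) - l j + 2 := by
      omega
    rw [e, hdim _ (by omega)]
  constructor
  · intro h
    refine ⟨hM, fun j hj => ?_⟩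
    rw [← key j hj]
    exact h.2 j (by omega)
  · intro h
    refine ⟨hH, fun j hj => ?_⟩
    by_cases hja : j < a
    · rw [key j hja]
      exact h.2 j hja
    · have h0 : l j = 0 := by
        have := hl.1 (show a ≤ j by omega)
        rw [hl.2.2] at this
        omega
      exact le_finrank_inf_of_codim hH (by omega) (by rw [h0]; omega)

set_option linter.unusedSectionVars false in
-- The added column absorbs one of the two steps by which the codimension rises, so the shift is
-- one. The column has one row beyond `l`, and this row is the hypothesis `hcol`.
theorem mem_schubertVariety_iff_of_column_add (hX : finrank K X = 4 + b) (hY : finrank K Y = b)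
    (hab : a ≤ b) (hH : finrank K H = 2 + a) (hM : finrank K M = a) {l : ℕ → ℕ}
    (hl : IsPartitionFor a b l)
    (hdim : ∀ m ≤ b, finrank K ↥(H ⊓ F.sub (m + 1)) = finrank K ↥(M ⊓ G.sub m))
    (hcol : a + 1 ≤ finrank K ↥(H ⊓ F.sub (b + 2))) :
    H ∈ schubertVariety (2 + a) (ofRows (List.replicate (a + 1) 1) + l) F ↔
      M ∈ schubertVariety a l G := by
  have hle : ∀ j, l j ≤ b - a := fun j => (hl.1 (Nat.zero_le j)).trans hl.2.1
  have hz : ∀ j, a ≤ j → l j = 0 := fun j hj => by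
    have := hl.1 hj
    rw [hl.2.2] at this
    omega
  have key : ∀ j < a, finrank K ↥(H ⊓ F.sub (finrank K X - (2 + a) + (j + 1) -
      (ofRows (List.replicate (a + 1) 1) + l) j)) =
      finrank K ↥(M ⊓ G.sub (finrank K Y - a + (j + 1) - l j)) := by
    intro j hj
    have := hle j
    have e : finrank K X - (2 + a) + (j + 1) - (1 + l j) =
        finrank K Y - a + (j + 1) - l j + 1 := by
      omega
    rw [Pi.add_apply, ofRows_replicate, if_pos (by omega), e, hdim _ (by omega)]
  constructor
  · intro h
    refine ⟨hM, fun j hj => ?_⟩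
    rw [← key j hj]
    exact h.2 j (by omega)
  · intro h
    refine ⟨hH, fun j hj => ?_⟩
    by_cases hja : j < a
    · rw [key j hja]
      exact h.2 j hja
    · rw [Pi.add_apply, hz j (by omega), ofRows_replicate]
      by_cases hja' : j = a
      · subst hja'
        rw [if_pos (by omega)]
        exact le_finrank_inf_of_le hcol (by omega)
      · rw [if_neg (by omega)]
        exact le_finrank_inf_of_codim hH (by omega) (by omega)

/-- Both sides have a single corner: dimension two in `F_5`, and dimension one in `G_2`. The extra
dimension comes from `h`. -/
theorem mem_schubertVariety_iff_of_two_rows (hX : finrank K X = 4 + b) (hY : finrank K Y = b)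
    (hab : a + 2 ≤ b) (ha : 0 < a) (hH : finrank K H = 2 + a) (hM : finrank K M = a)
    (hdim : finrank K ↥(H ⊓ F.sub 5) = finrank K ↥(M ⊓ G.sub 2) + 1) :
    H ∈ schubertVariety (2 + a) (ofRows [b - a - 1, b - a - 1]) F ↔
      M ∈ schubertVariety a (ofRows [b - a - 1]) G := by
  constructor
  · intro h
    have h1 : 2 ≤ finrank K ↥(H ⊓ F.sub 5) :=
      le_finrank_inf_of_le (h.2 1 (by omega)) (by simp [ofRows]; omega)
    exact mem_schubertVariety_one hM 2 (by omega) (by omega)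
  · intro h
    have h1 : 1 ≤ finrank K ↥(M ⊓ G.sub 2) :=
      le_finrank_inf_of_le (h.2 0 (by omega)) (by simp [ofRows]; omega)
    exact mem_schubertVariety_two hH 4 5
      (le_finrank_inf_of_sub (i := 1) (m := 5) (by omega) (by omega)) (by omega) (by omega)
      (by omega)

/-- The first row is the hypothesis `hline`. The other rows have one corner, dimension `a + 1` in
`F_{b+1}`, matching dimension `a - 1` in `G_{b-3}`; the difference of two is that `h` lies in
`F_{b+1}`. -/
theorem mem_schubertVariety_iff_of_hook (hX : finrank K X = 4 + b) (hY : finrank K Y = b)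
    (hab : a + 2 ≤ b) (ha : 0 < a) (hH : finrank K H = 2 + a) (hM : finrank K M = a)
    (hline : 1 ≤ finrank K ↥(H ⊓ F.sub 2))
    (hdim : finrank K ↥(H ⊓ F.sub (b + 1)) = finrank K ↥(M ⊓ G.sub (b - 3)) + 2) :
    H ∈ schubertVariety (2 + a) (ofRows ((b - a + 1) :: List.replicate a 2)) F ↔
      M ∈ schubertVariety a (ofRows (List.replicate (a - 1) 2)) G := by
  constructor
  · intro h
    have h1 : a + 1 ≤ finrank K ↥(H ⊓ F.sub (b + 1)) := by
      refine le_finrank_inf_of_le (h.2 a (by omega)) ?_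
      obtain ⟨a', rfl⟩ : ∃ a', a = a' + 1 := ⟨a - 1, by omega⟩
      rw [ofRows_cons_replicate_succ, if_pos (by omega)]
      omega
    refine ⟨hM, fun j hj => ?_⟩
    rw [ofRows_replicate]
    by_cases hja : j < a - 1
    · rw [if_pos hja]
      exact le_finrank_inf_of_sub (i := a - 1 - (j + 1)) (m := b - 3) (by omega) (by omega)
    · rw [if_neg hja]
      exact le_finrank_inf_of_codim hM (by omega) (by omega)
  · intro h
    have h1 : a - 1 ≤ finrank K ↥(M ⊓ G.sub (b - 3)) := by
      by_cases ha1 : a = 1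
      · omega
      · have h2 := h.2 (a - 2) (by omega)
        rw [ofRows_replicate, if_pos (by omega)] at h2
        have h3 : a - 2 + 1 = a - 1 := by omega
        rw [h3] at h2
        exact le_finrank_inf_of_le h2 (by omega)
    refine ⟨hH, fun j hj => ?_⟩
    rcases j with _ | j
    · rw [ofRows_cons_zero]
      exact le_finrank_inf_of_le hline (by omega)
    · rw [ofRows_cons_replicate_succ]
      by_cases hja : j < a
      · rw [if_pos hja]
        exact le_finrank_inf_of_sub (i := a - (j + 1)) (m := b + 1) (by omega) (by omega)
      · rw [if_neg hja]
        exact le_finrank_inf_of_codim hH (by omega) (by omega)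

end Comparison

/-! ### Dimensions of the attached subspaces and of the quotient flags. -/

section Geometry

variable {K X : Type*} [Field K] [AddCommGroup X] [Module K X]

theorem CompleteFlag.finrank_sub_of_le (E : CompleteFlag K X) {m : ℕ} (hm : m ≤ finrank K X) :
    finrank K (E.sub m) = m := by
  rw [E.finrank_sub, min_eq_left hm]

theorem finrank_inf_map_subtype (V : Submodule K X) (h : Submodule K V) (S : Submodule K X) :
    finrank K ↥(h ⊓ S.comap V.subtype) = finrank K ↥(h.map V.subtype ⊓ S) := by
  rw [← Submodule.finrank_map_subtype_eq V (h ⊓ S.comap V.subtype),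
    Submodule.map_inf _ V.injective_subtype, Submodule.map_comap_subtype, ← inf_assoc,
    inf_eq_left.mpr (Submodule.map_subtype_le V h)]

variable [FiniteDimensional K X] {a b t : ℕ} {lam : Fin (4 + t) → ℕ → ℕ}
  {F : Fin (4 + t) → CompleteFlag K X}

namespace IsGeneral

set_option linter.unusedSectionVars false in
theorem baseSpace_le (hb : 3 ≤ b) : baseSpace b F ≤ (F (Fin.castAdd t 0)).sub (b + 1) :=
  sup_le ((F _).mono (by omega)) inf_le_right

theorem finrank_inf (hX : finrank K X = 4 + b) (hb : 3 ≤ b) (hF : IsGeneral a b lam F) :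
    finrank K ↥((F (Fin.castAdd t 1)).sub 5 ⊓ (F (Fin.castAdd t 0)).sub (b + 1)) = 2 := by
  have h1 := (F (Fin.castAdd t 0)).finrank_add_le ((F (Fin.castAdd t 1)).sub 5) (b + 1) (by omega)
  have h2 := finrank_inf_le_add ((F (Fin.castAdd t 1)).mono (show 3 ≤ 5 by omega))
    ((F (Fin.castAdd t 0)).sub (b + 1))
  rw [hF.inf_eq_bot hX, finrank_bot, CompleteFlag.finrank_sub_of_le _ (by omega),
    CompleteFlag.finrank_sub_of_le _ (by omega)] at h2
  rw [CompleteFlag.finrank_sub_of_le _ (by omega)] at h1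
  rw [inf_comm] at h2
  omega

theorem finrank_baseSpace (hX : finrank K X = 4 + b) (hb : 3 ≤ b) (hF : IsGeneral a b lam F) :
    finrank K (baseSpace b F) = 4 := by
  have h1 := Submodule.finrank_sup_add_finrank_inf_eq ((F (Fin.castAdd t 0)).sub 2)
    ((F (Fin.castAdd t 1)).sub 5 ⊓ (F (Fin.castAdd t 0)).sub (b + 1))
  rw [hF.finrank_inf hX hb, CompleteFlag.finrank_sub_of_le _ (by omega), ← inf_assoc,
    hF.inf_eq_bot' hX hb, bot_inf_eq, finrank_bot] at h1
  exact h1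

set_option linter.unusedSectionVars false in
theorem finrank_base₀ (hX : finrank K X = 4 + b) :
    finrank K ↥(baseSpace b F ⊓ (F (Fin.castAdd t 0)).sub 2) = 2 := by
  have h : (F (Fin.castAdd t 0)).sub 2 ≤ baseSpace b F := le_sup_left
  rw [inf_eq_right.mpr h, CompleteFlag.finrank_sub_of_le]
  omega

theorem base_inf₁ (hb : 3 ≤ b) : baseSpace b F ⊓ (F (Fin.castAdd t 1)).sub 5 =
    (F (Fin.castAdd t 1)).sub 5 ⊓ (F (Fin.castAdd t 0)).sub (b + 1) := by
  apply le_antisymm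
  · exact le_inf inf_le_right (inf_le_left.trans (baseSpace_le hb))
  · exact le_inf le_sup_right inf_le_left

/-- A vector `v` of `V` is the sum of a vector of `F⁰_2` and one of `P`. If `v` is nonzero and in
both `F²_{b+2}` and `F³_{b+2}`, lines through the summands span a base plane that contains `v`,
which `inf_inf_eq_bot` forbids. -/
theorem base_inf_inf (hX : finrank K X = 4 + b) (hb : 3 ≤ b) (hF : IsGeneral a b lam F) :
    baseSpace b F ⊓ (F (Fin.castAdd t 2)).sub (b + 2) ⊓ (F (Fin.castAdd t 3)).sub (b + 2) = ⊥ := by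
  by_contra hne
  obtain ⟨v, ⟨⟨hvV, hv2⟩, hv3⟩, h0⟩ := Submodule.exists_mem_ne_zero_of_ne_bot hne
  obtain ⟨x, hx, y, hy, rfl⟩ := Submodule.mem_sup.mp hvV
  -- A summand may be zero; then any nonzero vector of the plane serves.
  have gen : ∀ {A : Submodule K X}, finrank K A = 2 → ∀ x ∈ A, ∃ x' ∈ A, x' ≠ 0 ∧ x ∈ K ∙ x' := by
    intro A hA x hx
    by_cases hx0 : x = 0
    · obtain ⟨x', hx', h'⟩ := Submodule.exists_mem_ne_zero_of_ne_bot (p := A) (by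
        rintro rfl
        rw [finrank_bot] at hA
        omega)
      exact ⟨x', hx', h', hx0 ▸ Submodule.zero_mem _⟩
    · exact ⟨x, hx, hx0, Submodule.mem_span_singleton_self x⟩
  obtain ⟨x', hx', hx0, hxx⟩ := gen (CompleteFlag.finrank_sub_of_le _ (by omega)) x hx
  obtain ⟨y', hy', hy0, hyy⟩ := gen (hF.finrank_inf hX hb) y hy
  have hxy : y' ∉ K ∙ x' := by
    intro h
    have h1 : y' ∈ (F (Fin.castAdd t 0)).sub 2 ⊓ (F (Fin.castAdd t 1)).sub 5 :=
      ⟨(Submodule.span_singleton_le_iff_mem _ _).mpr hx' h, hy'.1⟩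
    rw [hF.inf_eq_bot' hX hb] at h1
    exact hy0 ((Submodule.mem_bot K).mp h1)
  have hvh : x + y ∈ K ∙ x' ⊔ K ∙ y' := Submodule.add_mem_sup hxx hyy
  have hh : IsBasePlane b F (K ∙ x' ⊔ K ∙ y') := by
    refine ⟨?_, ?_, ?_, ?_, ?_, ?_⟩
    · rw [finrank_sup_span_singleton hxy, finrank_span_singleton hx0]
    · exact one_le_finrank_of_mem ⟨Submodule.mem_sup_left (Submodule.mem_span_singleton_self x'),
        hx'⟩ hx0
    · rw [sup_le_iff, Submodule.span_singleton_le_iff_mem, Submodule.span_singleton_le_iff_mem]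
      exact ⟨(F _).mono (by omega) hx', hy'.2⟩
    · exact one_le_finrank_of_mem ⟨Submodule.mem_sup_right (Submodule.mem_span_singleton_self y'),
        hy'.1⟩ hy0
    · exact one_le_finrank_of_mem ⟨hvh, hv2⟩ h0
    · exact one_le_finrank_of_mem ⟨hvh, hv3⟩ h0
  have h1 : x + y ∈ (K ∙ x' ⊔ K ∙ y') ⊓ (F (Fin.castAdd t 2)).sub (b + 2) ⊓
    (F (Fin.castAdd t 3)).sub (b + 2) := ⟨⟨hvh, hv2⟩, hv3⟩
  rw [hh.inf_inf_eq_bot hX hb hF] at h1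
  exact h0 ((Submodule.mem_bot K).mp h1)

/-- Both dimensions are at least two, and the two subspaces are independent in the four-dimensional
`V`. -/
theorem finrank_base₂₃ (hX : finrank K X = 4 + b) (hb : 3 ≤ b) (hF : IsGeneral a b lam F) :
    finrank K ↥(baseSpace b F ⊓ (F (Fin.castAdd t 2)).sub (b + 2)) = 2 ∧
    finrank K ↥(baseSpace b F ⊓ (F (Fin.castAdd t 3)).sub (b + 2)) = 2 := by
  have h1 := (F (Fin.castAdd t 2)).finrank_add_le (baseSpace b F) (b + 2) (by omega)
  have h2 := (F (Fin.castAdd t 3)).finrank_add_le (baseSpace b F) (b + 2) (by omega)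
  have h3 := Submodule.finrank_sup_add_finrank_inf_eq
    (baseSpace b F ⊓ (F (Fin.castAdd t 2)).sub (b + 2))
    (baseSpace b F ⊓ (F (Fin.castAdd t 3)).sub (b + 2))
  rw [← inf_inf_distrib_left, ← inf_assoc, hF.base_inf_inf hX hb, finrank_bot] at h3
  have h4 := Submodule.finrank_mono (sup_le
    (inf_le_left : baseSpace b F ⊓ (F (Fin.castAdd t 2)).sub (b + 2) ≤ baseSpace b F)
    (inf_le_left : baseSpace b F ⊓ (F (Fin.castAdd t 3)).sub (b + 2) ≤ baseSpace b F))
  rw [hF.finrank_baseSpace hX hb] at h1 h2 h4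
  omega

/-- The traces on `V` of `F⁰_2`, `F¹_5`, `F²_{b+2}`, `F³_{b+2}` all have dimension two, so they are
the second members of the induced flags. Lying in `F⁰_{b+1}` is automatic for subspaces of `V`. -/
theorem mem_solutions_base_iff (hX : finrank K X = 4 + b) (hb : 3 ≤ b) (hF : IsGeneral a b lam F)
    {E : Fin 4 → CompleteFlag K (baseSpace b F)}
    (hE : ∀ i, IsInduced (traceChain (F (Fin.castAdd t i)) (baseSpace b F)) (E i))
    (h : Submodule K (baseSpace b F)) :
    h ∈ solutions 2 (fun _ : Fin 4 => ofRows [1]) E ↔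
      IsBasePlane b F (h.map (baseSpace b F).subtype) := by
  have hV := hF.finrank_baseSpace hX hb
  have hd : ∀ i m, finrank K ↥(baseSpace b F ⊓ (F (Fin.castAdd t i)).sub m) = 2 →
      finrank K ↥(h ⊓ (E i).sub 2) =
        finrank K ↥(h.map (baseSpace b F).subtype ⊓ (F (Fin.castAdd t i)).sub m) := by
    intro i m him
    have h1 := hE i m
    rw [finrank_traceChain, him] at h1
    rw [← h1]
    exact finrank_inf_map_subtype _ _ _
  have d0 := hd 0 2 (finrank_base₀ hX)
  have d1 := hd 1 5 (by rw [base_inf₁ hb, hF.finrank_inf hX hb])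
  have d2 := hd 2 (b + 2) (hF.finrank_base₂₃ hX hb).1
  have d3 := hd 3 (b + 2) (hF.finrank_base₂₃ hX hb).2
  constructor
  · rintro ⟨h2, hS⟩
    have hm : ∀ i, 1 ≤ finrank K ↥(h ⊓ (E i).sub 2) := fun i =>
      le_finrank_inf_of_le ((hS i).2 0 (by omega)) (by simp [ofRows, hV])
    refine ⟨by rw [Submodule.finrank_map_subtype_eq, h2], ?_,
      (Submodule.map_subtype_le _ _).trans (baseSpace_le hb), ?_, ?_, ?_⟩
    · rw [← d0]; exact hm 0
    · rw [← d1]; exact hm 1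
    · rw [← d2]; exact hm 2
    · rw [← d3]; exact hm 3
  · intro hh
    have h2 : finrank K h = 2 := by rw [← hh.finrank_eq, Submodule.finrank_map_subtype_eq]
    refine ⟨h2, fun i => mem_schubertVariety_one h2 2 ?_ (by omega)⟩
    fin_cases i
    · exact hh.meet₀.trans d0.ge
    · exact hh.meet₁.trans d1.ge
    · exact hh.meet₂.trans d2.ge
    · exact hh.meet₃.trans d3.ge

end IsGeneral

namespace IsBasePlane

variable {h : Submodule K X}

theorem finrank_inf₂ (hX : finrank K X = 4 + b) (hb : 3 ≤ b) (hF : IsGeneral a b lam F)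
    (hh : IsBasePlane b F h) : finrank K ↥(h ⊓ (F (Fin.castAdd t 2)).sub (b + 2)) = 1 := by
  have h1 := hh.meet₂
  have h2 : finrank K ↥(h ⊓ (F (Fin.castAdd t 2)).sub (b + 2)) ≤ 1 := by
    have h3 := (F (Fin.castAdd t 2)).finrank_inf_succ_le h (b + 1)
    rw [hh.inf₂ hX hb hF, finrank_bot] at h3
    exact h3
  omega

theorem finrank_inf₃ (hX : finrank K X = 4 + b) (hb : 3 ≤ b) (hF : IsGeneral a b lam F)
    (hh : IsBasePlane b F h) : finrank K ↥(h ⊓ (F (Fin.castAdd t 3)).sub (b + 2)) = 1 := by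
  have h1 := hh.meet₃
  have h2 : finrank K ↥(h ⊓ (F (Fin.castAdd t 3)).sub (b + 2)) ≤ 1 := by
    have h3 := (F (Fin.castAdd t 3)).finrank_inf_succ_le h (b + 1)
    rw [hh.inf₃ hX hb hF, finrank_bot] at h3
    exact h3
  omega

theorem finrank_inf₁ (hX : finrank K X = 4 + b) (hb : 3 ≤ b) (hF : IsGeneral a b lam F)
    (hh : IsBasePlane b F h) : finrank K ↥(h ⊓ (F (Fin.castAdd t 1)).sub 5) = 1 := by
  have h1 := hh.meet₁
  have h2 := Submodule.finrank_sup_add_finrank_inf_eq (h ⊓ (F (Fin.castAdd t 1)).sub 5)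
    (h ⊓ (F (Fin.castAdd t 0)).sub 2)
  have h3 := Submodule.finrank_mono (sup_le
    (inf_le_left : h ⊓ (F (Fin.castAdd t 1)).sub 5 ≤ h)
    (inf_le_left : h ⊓ (F (Fin.castAdd t 0)).sub 2 ≤ h))
  have h4 : (h ⊓ (F (Fin.castAdd t 1)).sub 5) ⊓ (h ⊓ (F (Fin.castAdd t 0)).sub 2) = ⊥ := by
    rw [eq_bot_iff, ← hF.inf_eq_bot' hX hb]
    exact le_inf (inf_le_right.trans inf_le_right) (inf_le_left.trans inf_le_right)
  have h5 := hh.meet₀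
  rw [h4, finrank_bot] at h2
  rw [hh.finrank_eq] at h3
  omega

theorem finrank_sup₂ (hX : finrank K X = 4 + b) (hb : 3 ≤ b) (hF : IsGeneral a b lam F)
    (hh : IsBasePlane b F h) : finrank K ↥((F (Fin.castAdd t 2)).sub (b + 2) ⊔ h) = b + 3 := by
  have h1 := Submodule.finrank_sup_add_finrank_inf_eq ((F (Fin.castAdd t 2)).sub (b + 2)) h
  rw [inf_comm, hh.finrank_inf₂ hX hb hF, hh.finrank_eq,
    CompleteFlag.finrank_sub_of_le _ (by omega)] at h1
  omega

theorem finrank_sup₃ (hX : finrank K X = 4 + b) (hb : 3 ≤ b) (hF : IsGeneral a b lam F)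
    (hh : IsBasePlane b F h) : finrank K ↥((F (Fin.castAdd t 3)).sub (b + 2) ⊔ h) = b + 3 := by
  have h1 := Submodule.finrank_sup_add_finrank_inf_eq ((F (Fin.castAdd t 3)).sub (b + 2)) h
  rw [inf_comm, hh.finrank_inf₃ hX hb hF, hh.finrank_eq,
    CompleteFlag.finrank_sub_of_le _ (by omega)] at h1
  omega

set_option linter.unusedSectionVars false in
theorem _root_.Schubert.le_liftSpace : h ≤ liftSpace b F h := le_inf le_sup_right le_sup_right

/-- By the modular law `(S + h) ∩ V = h + (S ∩ V)` has dimension three for both `S`. Were `L ∩ V`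
larger than `h`, it would equal both of these and contain the two planes `S ∩ V`, which together
span `V`. -/
theorem liftSpace_inf (hX : finrank K X = 4 + b) (hb : 3 ≤ b) (hF : IsGeneral a b lam F)
    (hh : IsBasePlane b F h) (hV : h ≤ baseSpace b F) : liftSpace b F h ⊓ baseSpace b F = h := by
  symm
  apply Submodule.eq_of_le_of_finrank_le (le_inf le_liftSpace hV)
  rw [hh.finrank_eq]
  by_contra hc
  push Not at hc
  set V := baseSpace b F
  have mod : ∀ S : Submodule K X, (S ⊔ h) ⊓ V = h ⊔ (S ⊓ V) := fun S => by
    rw [sup_comm, sup_inf_assoc_of_le _ hV]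
  have dim : ∀ S : Submodule K X, finrank K ↥(V ⊓ S) = 2 → finrank K ↥(h ⊓ S) = 1 →
      liftSpace b F h ≤ S ⊔ h → S ⊓ V ≤ liftSpace b F h ⊓ V ∧
        finrank K ↥(liftSpace b F h ⊓ V) ≤ 3 := by
    intro S hS hhS hle
    have h1 := Submodule.finrank_sup_add_finrank_inf_eq h (S ⊓ V)
    have h2 : h ⊓ (S ⊓ V) = h ⊓ S := by
      rw [inf_comm S V, ← inf_assoc, inf_eq_left.mpr hV]
    rw [h2, hhS, hh.finrank_eq, inf_comm S V, hS] at h1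
    have h3 : liftSpace b F h ⊓ V ≤ h ⊔ V ⊓ S := by
      rw [inf_comm V S, ← mod]
      exact inf_le_inf_right _ hle
    have h4 := Submodule.eq_of_le_of_finrank_le h3 (by omega)
    rw [h4]
    refine ⟨?_, by omega⟩
    rw [inf_comm]
    exact le_sup_right
  obtain ⟨e1, e2⟩ := dim _ (hF.finrank_base₂₃ hX hb).1 (hh.finrank_inf₂ hX hb hF) inf_le_left
  obtain ⟨e3, e4⟩ := dim _ (hF.finrank_base₂₃ hX hb).2 (hh.finrank_inf₃ hX hb hF) inf_le_right
  have h1 := Submodule.finrank_mono (sup_le e1 e3)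
  have h2 := Submodule.finrank_sup_add_finrank_inf_eq
    ((F (Fin.castAdd t 2)).sub (b + 2) ⊓ V) ((F (Fin.castAdd t 3)).sub (b + 2) ⊓ V)
  have h3 := hF.base_inf_inf hX hb
  rw [inf_comm _ V, inf_comm _ V, ← inf_inf_distrib_left, ← inf_assoc, h3, finrank_bot,
    (hF.finrank_base₂₃ hX hb).1, (hF.finrank_base₂₃ hX hb).2] at h2
  rw [inf_comm _ V, inf_comm _ V] at h1
  rw [inf_comm _ V] at e2
  omega

/-- Two subspaces of codimension one meet in dimension at least `b + 2`, while `L ∩ V = h` and `dim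
(L + V) ≤ b + 4` give the opposite bound and force `L + V` to be everything. -/
theorem finrank_liftSpace (hX : finrank K X = 4 + b) (hb : 3 ≤ b) (hF : IsGeneral a b lam F)
    (hh : IsBasePlane b F h) (hV : h ≤ baseSpace b F) :
    finrank K (liftSpace b F h) = b + 2 ∧ liftSpace b F h ⊔ baseSpace b F = ⊤ := by
  have h1 := Submodule.finrank_sup_add_finrank_inf_eq ((F (Fin.castAdd t 2)).sub (b + 2) ⊔ h)
    ((F (Fin.castAdd t 3)).sub (b + 2) ⊔ h)
  rw [hh.finrank_sup₂ hX hb hF, hh.finrank_sup₃ hX hb hF] at h1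
  have h2 := Submodule.finrank_le ((F (Fin.castAdd t 2)).sub (b + 2) ⊔ h ⊔
    ((F (Fin.castAdd t 3)).sub (b + 2) ⊔ h))
  have h3 := Submodule.finrank_sup_add_finrank_inf_eq (liftSpace b F h) (baseSpace b F)
  rw [hh.liftSpace_inf hX hb hF hV, hh.finrank_eq, hF.finrank_baseSpace hX hb] at h3
  have h4 := Submodule.finrank_le (liftSpace b F h ⊔ baseSpace b F)
  have h5 : b + 2 ≤ finrank K (liftSpace b F h) := by
    unfold liftSpace
    omega
  exact ⟨by omega, Submodule.eq_top_of_finrank_eq (by omega)⟩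

theorem inf_liftSpace_inf (hX : finrank K X = 4 + b) (hb : 3 ≤ b) (hF : IsGeneral a b lam F)
    (hh : IsBasePlane b F h) (hV : h ≤ baseSpace b F) (S : Submodule K X) :
    baseSpace b F ⊓ (liftSpace b F h ⊓ S) = h ⊓ S := by
  rw [← inf_assoc, inf_comm (baseSpace b F), hh.liftSpace_inf hX hb hF hV]

theorem finrank_quotChain_add (hX : finrank K X = 4 + b) (hb : 3 ≤ b) (hF : IsGeneral a b lam F)
    (hh : IsBasePlane b F h) (hV : h ≤ baseSpace b F) (E : CompleteFlag K X) (m : ℕ) :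
    finrank K (quotChain E (baseSpace b F) (liftSpace b F h) m) + finrank K ↥(h ⊓ E.sub m) =
      finrank K ↥(liftSpace b F h ⊓ E.sub m) := by
  rw [← hh.inf_liftSpace_inf hX hb hF hV]
  exact finrank_map_mkQ_add _ _

/-- Since `L` has codimension two and misses the second member of the flag, it meets the member of
dimension `m + 2` in dimension exactly `m`; as `h` misses this member, the projection is injective
there. -/
theorem finrank_quotChain (hX : finrank K X = 4 + b) (hb : 3 ≤ b) (hF : IsGeneral a b lam F)
    (hh : IsBasePlane b F h) (hV : h ≤ baseSpace b F) (i : Fin t) (m : ℕ) (hm : m ≤ b) :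
    finrank K (quotChain (F (Fin.natAdd 4 i)) (baseSpace b F) (liftSpace b F h) (m + 2)) = m ∧
      finrank K ↥(h ⊓ (F (Fin.natAdd 4 i)).sub (m + 2)) = 0 := by
  have h1 := hh.finrank_quotChain_add hX hb hF hV (F (Fin.natAdd 4 i)) (m + 2)
  have h2 : h ⊓ (F (Fin.natAdd 4 i)).sub (m + 2) = ⊥ := by
    rw [eq_bot_iff, ← hh.inf hX hb hF i]
    exact inf_le_inf_left _ ((F _).mono (by omega))
  have h3 := (F (Fin.natAdd 4 i)).finrank_add_le (liftSpace b F h) (m + 2) (by omega)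
  have h4 := finrank_inf_le_add ((F (Fin.natAdd 4 i)).mono (show 2 ≤ m + 2 by omega))
    (liftSpace b F h)
  rw [inf_comm _ ((F (Fin.natAdd 4 i)).sub 2), hh.inf_liftSpace hX hb hF i, finrank_bot,
    CompleteFlag.finrank_sub_of_le _ (by omega), CompleteFlag.finrank_sub_of_le _ (by omega)] at h4
  rw [h2, finrank_bot] at h1 ⊢
  rw [(hh.finrank_liftSpace hX hb hF hV).1] at h3
  omega

theorem finrank_quotChain₁ (hX : finrank K X = 4 + b) (hb : 3 ≤ b) (hF : IsGeneral a b lam F)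
    (hh : IsBasePlane b F h) (hV : h ≤ baseSpace b F) :
    finrank K (quotChain (F (Fin.castAdd t 1)) (baseSpace b F) (liftSpace b F h) 5) = 2 := by
  have h1 := hh.finrank_quotChain_add hX hb hF hV (F (Fin.castAdd t 1)) 5
  have h3 := (F (Fin.castAdd t 1)).finrank_add_le (liftSpace b F h) 5 (by omega)
  have h4 := finrank_inf_le_add ((F (Fin.castAdd t 1)).mono (show 2 ≤ 5 by omega))
    (liftSpace b F h)
  rw [inf_comm _ ((F (Fin.castAdd t 1)).sub 2), hh.inf_liftSpace₁ hX hb hF, finrank_bot,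
    CompleteFlag.finrank_sub_of_le _ (by omega), CompleteFlag.finrank_sub_of_le _ (by omega)] at h4
  rw [hh.finrank_inf₁ hX hb hF] at h1
  rw [(hh.finrank_liftSpace hX hb hF hV).1] at h3
  omega

/-- As `V` lies in `F⁰_{b+1}` and `L + V = X`, the intersection `L ∩ F⁰_{b+1}` has dimension `b -
1`; it contains the plane `h`, which is lost in the quotient. -/
theorem finrank_quotChain₀ (hX : finrank K X = 4 + b) (hb : 3 ≤ b) (hF : IsGeneral a b lam F)
    (hh : IsBasePlane b F h) (hV : h ≤ baseSpace b F) :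
    finrank K (quotChain (F (Fin.castAdd t 0)) (baseSpace b F) (liftSpace b F h) (b + 1)) =
      b - 3 := by
  have h1 := hh.finrank_quotChain_add hX hb hF hV (F (Fin.castAdd t 0)) (b + 1)
  have h2 := Submodule.finrank_sup_add_finrank_inf_eq (liftSpace b F h)
    ((F (Fin.castAdd t 0)).sub (b + 1))
  have h3 : liftSpace b F h ⊔ (F (Fin.castAdd t 0)).sub (b + 1) = ⊤ := by
    rw [eq_top_iff, ← (hh.finrank_liftSpace hX hb hF hV).2]
    exact sup_le_sup_left (IsGeneral.baseSpace_le hb) _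
  rw [h3, finrank_top, hX, (hh.finrank_liftSpace hX hb hF hV).1,
    CompleteFlag.finrank_sub_of_le _ (by omega)] at h2
  rw [inf_eq_left.mpr hh.le₀, hh.finrank_eq] at h1
  omega

theorem finrank_quotChain₂ (hX : finrank K X = 4 + b) (hb : 3 ≤ b) (hF : IsGeneral a b lam F)
    (hh : IsBasePlane b F h) (hV : h ≤ baseSpace b F) (m : ℕ) (hm : m ≤ b) :
    finrank K (quotChain (F (Fin.castAdd t 2)) (baseSpace b F) (liftSpace b F h) (m + 1)) = m ∧
      finrank K ↥(h ⊓ (F (Fin.castAdd t 2)).sub (m + 1)) = 0 := by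
  have h1 := hh.finrank_quotChain_add hX hb hF hV (F (Fin.castAdd t 2)) (m + 1)
  have h2 : h ⊓ (F (Fin.castAdd t 2)).sub (m + 1) = ⊥ := by
    rw [eq_bot_iff, ← hh.inf₂ hX hb hF]
    exact inf_le_inf_left _ ((F _).mono (by omega))
  have h5 : liftSpace b F h ⊓ (F (Fin.castAdd t 2)).sub (m + 1) =
      ((F (Fin.castAdd t 3)).sub (b + 2) ⊔ h) ⊓ (F (Fin.castAdd t 2)).sub (m + 1) := by
    apply le_antisymm (inf_le_inf_right _ inf_le_right)
    exact le_inf (le_inf (inf_le_right.trans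
      (((F _).mono (by omega)).trans le_sup_left)) inf_le_left) inf_le_right
  have h3 := (F (Fin.castAdd t 2)).finrank_add_le ((F (Fin.castAdd t 3)).sub (b + 2) ⊔ h) (m + 1)
    (by omega)
  have h4 := finrank_inf_le_add ((F (Fin.castAdd t 2)).mono (show 1 ≤ m + 1 by omega))
    ((F (Fin.castAdd t 3)).sub (b + 2) ⊔ h)
  rw [inf_comm _ ((F (Fin.castAdd t 2)).sub 1), hh.inf_sup₂ hX hb hF, finrank_bot,
    CompleteFlag.finrank_sub_of_le _ (by omega), CompleteFlag.finrank_sub_of_le _ (by omega)] at h4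
  rw [h2, finrank_bot, h5] at h1
  rw [h2, finrank_bot]
  rw [hh.finrank_sup₃ hX hb hF] at h3
  omega

theorem finrank_quotChain₃ (hX : finrank K X = 4 + b) (hb : 3 ≤ b) (hF : IsGeneral a b lam F)
    (hh : IsBasePlane b F h) (hV : h ≤ baseSpace b F) (m : ℕ) (hm : m ≤ b) :
    finrank K (quotChain (F (Fin.castAdd t 3)) (baseSpace b F) (liftSpace b F h) (m + 1)) = m ∧
      finrank K ↥(h ⊓ (F (Fin.castAdd t 3)).sub (m + 1)) = 0 := by
  have h1 := hh.finrank_quotChain_add hX hb hF hV (F (Fin.castAdd t 3)) (m + 1)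
  have h2 : h ⊓ (F (Fin.castAdd t 3)).sub (m + 1) = ⊥ := by
    rw [eq_bot_iff, ← hh.inf₃ hX hb hF]
    exact inf_le_inf_left _ ((F _).mono (by omega))
  have h5 : liftSpace b F h ⊓ (F (Fin.castAdd t 3)).sub (m + 1) =
      ((F (Fin.castAdd t 2)).sub (b + 2) ⊔ h) ⊓ (F (Fin.castAdd t 3)).sub (m + 1) := by
    apply le_antisymm (inf_le_inf_right _ inf_le_left)
    exact le_inf (le_inf inf_le_left (inf_le_right.trans
      (((F _).mono (by omega)).trans le_sup_left))) inf_le_right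
  have h3 := (F (Fin.castAdd t 3)).finrank_add_le ((F (Fin.castAdd t 2)).sub (b + 2) ⊔ h) (m + 1)
    (by omega)
  have h4 := finrank_inf_le_add ((F (Fin.castAdd t 3)).mono (show 1 ≤ m + 1 by omega))
    ((F (Fin.castAdd t 2)).sub (b + 2) ⊔ h)
  rw [inf_comm _ ((F (Fin.castAdd t 3)).sub 1), hh.inf_sup₃ hX hb hF, finrank_bot,
    CompleteFlag.finrank_sub_of_le _ (by omega), CompleteFlag.finrank_sub_of_le _ (by omega)] at h4
  rw [h2, finrank_bot, h5] at h1
  rw [h2, finrank_bot]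
  rw [hh.finrank_sup₂ hX hb hF] at h3
  omega

/-- Intersection dimensions of a subspace between `h` and `liftSpace b F h` and of its image. -/
theorem finrank_inf_eq (hX : finrank K X = 4 + b) (hb : 3 ≤ b) (hF : IsGeneral a b lam F)
    (hh : IsBasePlane b F h) (hV : h ≤ baseSpace b F) {H : Submodule K X}
    (hHL : H ≤ liftSpace b F h) (hHV : H ⊓ baseSpace b F = h) {E : CompleteFlag K X}
    {G : CompleteFlag K (X ⧸ baseSpace b F)}
    (hG : IsInduced (quotChain E (baseSpace b F) (liftSpace b F h)) G) (m : ℕ) :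
    finrank K ↥(H ⊓ E.sub m) = finrank K ↥(H.map (baseSpace b F).mkQ ⊓
      G.sub (finrank K (quotChain E (baseSpace b F) (liftSpace b F h) m))) +
        finrank K ↥(h ⊓ E.sub m) := by
  rw [← hG m]
  have h1 : (H ⊓ E.sub m).map (baseSpace b F).mkQ = H.map (baseSpace b F).mkQ ⊓
      quotChain E (baseSpace b F) (liftSpace b F h) m := by
    apply le_antisymm
    · exact le_inf (Submodule.map_mono inf_le_left) (Submodule.map_mono (inf_le_inf_right _ hHL))
    · rintro _ ⟨⟨x, hx, rfl⟩, ⟨y, hy, hxy⟩⟩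
      refine ⟨y, ⟨?_, hy.2⟩, hxy⟩
      -- A representative in `L ∩ E_m` of the class of an element of `H` differs from it by an
      -- element of `L ∩ V = h`, which lies in `H`; hence the representative lies in `H` as well.
      have h2 : x - y ∈ baseSpace b F := by
        simp only [Submodule.mkQ_apply] at hxy
        exact (Submodule.Quotient.eq _).mp hxy.symm
      have h3 : x - y ∈ h := by
        rw [← hh.liftSpace_inf hX hb hF hV]
        exact ⟨Submodule.sub_mem _ (hHL hx) hy.1, h2⟩
      rw [← hHV] at h3
      have h4 := H.sub_mem hx h3.1
      rwa [sub_sub_cancel] at h4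
  rw [← h1]
  have h2 := finrank_map_mkQ_add (H ⊓ E.sub m) (baseSpace b F)
  rw [← inf_assoc, inf_comm (baseSpace b F) H, hHV] at h2
  exact h2.symm

end IsBasePlane

end Geometry

/-! ### The two Schubert problems and their sizes. -/

section Problems

/-- The problem that is fibered over the four lines. -/
def totalProblem (a b : ℕ) (nu3 nu4 : ℕ → ℕ) {t : ℕ} (nu : Fin t → ℕ → ℕ) :
    Fin (4 + t) → ℕ → ℕ :=
  Fin.append ![ofRows ((b - a + 1) :: List.replicate a 2), ofRows [b - a - 1, b - a - 1],
    ofRows (List.replicate (a + 1) 1) + nu3, ofRows (List.replicate (a + 1) 1) + nu4] nu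

/-- The problem in the fibers. -/
def fiberProblem (a b : ℕ) (nu3 nu4 : ℕ → ℕ) {t : ℕ} (nu : Fin t → ℕ → ℕ) :
    Fin (4 + t) → ℕ → ℕ :=
  Fin.append ![ofRows (List.replicate (a - 1) 2), ofRows [b - a - 1], nu3, nu4] nu

theorem forall_append_four {t : ℕ} {P : Fin (4 + t) → Prop} :
    (∀ i, P i) ↔ P (Fin.castAdd t 0) ∧ P (Fin.castAdd t 1) ∧ P (Fin.castAdd t 2) ∧
      P (Fin.castAdd t 3) ∧ ∀ i, P (Fin.natAdd 4 i) := by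
  constructor
  · exact fun h => ⟨h _, h _, h _, h _, fun i => h _⟩
  · rintro ⟨h₀, h₁, h₂, h₃, h⟩ i
    refine Fin.addCases (fun i => ?_) h i
    fin_cases i
    · exact h₀
    · exact h₁
    · exact h₂
    · exact h₃

variable {a b t : ℕ} {nu3 nu4 : ℕ → ℕ} {nu : Fin t → ℕ → ℕ}

theorem totalProblem_zero : totalProblem a b nu3 nu4 nu (Fin.castAdd t 0) =
    ofRows ((b - a + 1) :: List.replicate a 2) := by
  rw [totalProblem, Fin.append_left]; rfl

theorem totalProblem_one : totalProblem a b nu3 nu4 nu (Fin.castAdd t 1) =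
    ofRows [b - a - 1, b - a - 1] := by
  rw [totalProblem, Fin.append_left]; rfl

theorem totalProblem_two : totalProblem a b nu3 nu4 nu (Fin.castAdd t 2) =
    ofRows (List.replicate (a + 1) 1) + nu3 := by
  rw [totalProblem, Fin.append_left]; rfl

theorem totalProblem_three : totalProblem a b nu3 nu4 nu (Fin.castAdd t 3) =
    ofRows (List.replicate (a + 1) 1) + nu4 := by
  rw [totalProblem, Fin.append_left]; rfl

theorem totalProblem_natAdd (i : Fin t) : totalProblem a b nu3 nu4 nu (Fin.natAdd 4 i) = nu i := by
  rw [totalProblem, Fin.append_right]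

theorem fiberProblem_zero : fiberProblem a b nu3 nu4 nu (Fin.castAdd t 0) =
    ofRows (List.replicate (a - 1) 2) := by
  rw [fiberProblem, Fin.append_left]; rfl

theorem fiberProblem_one : fiberProblem a b nu3 nu4 nu (Fin.castAdd t 1) =
    ofRows [b - a - 1] := by
  rw [fiberProblem, Fin.append_left]; rfl

theorem fiberProblem_two : fiberProblem a b nu3 nu4 nu (Fin.castAdd t 2) = nu3 := by
  rw [fiberProblem, Fin.append_left]; rfl

theorem fiberProblem_three : fiberProblem a b nu3 nu4 nu (Fin.castAdd t 3) = nu4 := by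
  rw [fiberProblem, Fin.append_left]; rfl

theorem fiberProblem_natAdd (i : Fin t) : fiberProblem a b nu3 nu4 nu (Fin.natAdd 4 i) = nu i := by
  rw [fiberProblem, Fin.append_right]

/-- For `a ≥ 2` the partition `2^(a-1)` must have rows of length at most `b - a`; for `a = 1` the
bound is `b ≥ 3`. -/
theorem add_two_le_of_fiberProblem (hab : a < b) (hb : 3 ≤ b)
    (hnu : IsSchubertProblem a b (fiberProblem a b nu3 nu4 nu)) : a + 2 ≤ b := by
  have h1 := (hnu.1 (Fin.castAdd t 0)).2.1
  rw [fiberProblem_zero, ofRows_replicate] at h1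
  split_ifs at h1 <;> omega

theorem IsPartitionFor.eq_zero {k n : ℕ} {l : ℕ → ℕ} (hl : IsPartitionFor k n l) {j : ℕ}
    (hj : k ≤ j) : l j = 0 := by
  have h1 := hl.1 hj
  rw [hl.2.2] at h1
  omega

theorem IsPartitionFor.sum_range {k n : ℕ} {l : ℕ → ℕ} (hl : IsPartitionFor k n l) :
    ∑ j ∈ Finset.range (2 + k), l j = ∑ j ∈ Finset.range k, l j := by
  rw [add_comm, Finset.sum_range_succ, Finset.sum_range_succ, hl.eq_zero le_rfl,
    hl.eq_zero (Nat.le_succ k), add_zero, add_zero]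

theorem sum_range_ofRows_replicate (n k x : ℕ) (h : n ≤ k) :
    ∑ j ∈ Finset.range k, ofRows (List.replicate n x) j = n * x := by
  simp only [ofRows_replicate]
  rw [Finset.sum_ite, Finset.sum_const, Finset.sum_const_zero, add_zero, smul_eq_mul]
  congr 1
  rw [show Finset.filter (fun j => j < n) (Finset.range k) = Finset.range n by
    ext j; simp; omega, Finset.card_range]

theorem antitone_ofRows_replicate (n x : ℕ) : Antitone (ofRows (List.replicate n x)) := by
  apply antitone_nat_of_succ_le
  intro j
  rw [ofRows_replicate, ofRows_replicate]
  split_ifs <;> omega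

theorem isSchubertProblem_totalProblem (ha : 0 < a) (hab : a + 2 ≤ b)
    (hnu : IsSchubertProblem a b (fiberProblem a b nu3 nu4 nu)) :
    IsSchubertProblem (2 + a) (4 + b) (totalProblem a b nu3 nu4 nu) := by
  obtain ⟨hp, hs⟩ := hnu
  rw [forall_append_four] at hp
  obtain ⟨-, -, h₂, h₃, h⟩ := hp
  simp only [fiberProblem_two, fiberProblem_three, fiberProblem_natAdd] at h₂ h₃ h
  rw [sum_append_four] at hs
  simp only [fiberProblem_zero, fiberProblem_one, fiberProblem_two, fiberProblem_three,
    fiberProblem_natAdd] at hs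
  have hcol : ∀ {l : ℕ → ℕ}, IsPartitionFor a b l →
      IsPartitionFor (2 + a) (4 + b) (ofRows (List.replicate (a + 1) 1) + l) := by
    intro l hl
    refine ⟨(antitone_ofRows_replicate _ _).add hl.1, ?_, ?_⟩
    · have := hl.2.1
      rw [Pi.add_apply, ofRows_replicate, if_pos (by omega)]
      omega
    · rw [Pi.add_apply, hl.eq_zero (by omega), ofRows_replicate, if_neg (by omega)]
  constructor
  · rw [forall_append_four]
    simp only [totalProblem_zero, totalProblem_one, totalProblem_two, totalProblem_three,
      totalProblem_natAdd]
    refine ⟨⟨?_, ?_, ?_⟩, ⟨?_, ?_, ?_⟩, hcol h₂, hcol h₃, fun i => ⟨(h i).1, ?_, ?_⟩⟩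
    · apply antitone_nat_of_succ_le
      intro j
      rcases j with _ | j
      · rw [ofRows_cons_replicate_succ, ofRows_cons_zero]
        split_ifs; omega
      · rw [ofRows_cons_replicate_succ, ofRows_cons_replicate_succ]
        split_ifs <;> omega
    · rw [ofRows_cons_zero]
      omega
    · rw [show 2 + a = (a + 1) + 1 by omega, ofRows_cons_replicate_succ, if_neg (by omega)]
    · exact antitone_ofRows_replicate 2 (b - a - 1)
    · rw [ofRows_cons_zero]
      omega
    · exact (ofRows_replicate 2 (b - a - 1) (2 + a)).trans (if_neg (by omega))
    · have := (h i).2.1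
      omega
    · exact (h i).eq_zero (by omega)
  · rw [sum_append_four]
    simp only [totalProblem_zero, totalProblem_one, totalProblem_two, totalProblem_three,
      totalProblem_natAdd, Pi.add_apply, Finset.sum_add_distrib]
    simp only [h₂.sum_range, h₃.sum_range, (h _).sum_range]
    have e₁ : ∑ j ∈ Finset.range (2 + a), ofRows [b - a - 1, b - a - 1] j = 2 * (b - a - 1) :=
      sum_range_ofRows_replicate 2 _ (b - a - 1) (by omega)
    have e₁' : ∑ j ∈ Finset.range a, ofRows [b - a - 1] j = 1 * (b - a - 1) :=
      sum_range_ofRows_replicate 1 _ (b - a - 1) ha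
    have e₀ : ∑ j ∈ Finset.range (2 + a), ofRows ((b - a + 1) :: List.replicate a 2) j =
        a * 2 + (b - a + 1) := by
      rw [show 2 + a = (a + 1) + 1 by omega, Finset.sum_range_succ']
      congr 1
      exact sum_range_ofRows_replicate a (a + 1) 2 (by omega)
    rw [e₀, e₁, sum_range_ofRows_replicate (a + 1) (2 + a) 1 (by omega)]
    rw [e₁', sum_range_ofRows_replicate (a - 1) a 2 (by omega)] at hs
    -- Writing `b = a + 2 + c` and then `a = a' + 1` removes truncated subtraction from the count of
    -- boxes.
    obtain ⟨c, rfl⟩ := Nat.exists_eq_add_of_le hab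
    obtain ⟨a, rfl⟩ : ∃ a', a = a' + 1 := ⟨a - 1, by omega⟩
    have g₁ : a + 1 + 2 + c - (a + 1) = c + 2 := by omega
    have g₂ : 4 + (a + 1 + 2 + c) - (2 + (a + 1)) = c + 4 := by omega
    rw [g₁] at hs ⊢
    rw [g₂]
    simp only [Nat.add_sub_cancel, show c + 2 - 1 = c + 1 by omega] at hs ⊢
    linarith

end Problems

/-! ### Solutions of the total problem relative to the base plane. -/

section Solutions

variable {K X : Type*} [Field K] [AddCommGroup X] [Module K X] [FiniteDimensional K X]
  {a b t : ℕ} {nu3 nu4 : ℕ → ℕ} {nu : Fin t → ℕ → ℕ} {F : Fin (4 + t) → CompleteFlag K X}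
  {H : Submodule K X}

theorem finrank_add_le_finrank_inf {A B : Submodule K X} (hA : A ≤ H) (hB : B ≤ H) :
    finrank K A + finrank K B ≤ finrank K ↥(A ⊓ B) + finrank K H := by
  have h1 := Submodule.finrank_sup_add_finrank_inf_eq A B
  have h2 := Submodule.finrank_mono (sup_le hA hB)
  omega

set_option linter.unusedSectionVars false in
theorem finrank_inf_of_mem_solutions (hX : finrank K X = 4 + b) (ha : 0 < a) (hab : a + 2 ≤ b)
    (hH : H ∈ solutions (2 + a) (totalProblem a b nu3 nu4 nu) F) :
    1 ≤ finrank K ↥(H ⊓ (F (Fin.castAdd t 0)).sub 2) ∧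
    a + 1 ≤ finrank K ↥(H ⊓ (F (Fin.castAdd t 0)).sub (b + 1)) ∧
    2 ≤ finrank K ↥(H ⊓ (F (Fin.castAdd t 1)).sub 5) ∧
    a + 1 ≤ finrank K ↥(H ⊓ (F (Fin.castAdd t 2)).sub (b + 2)) ∧
    a + 1 ≤ finrank K ↥(H ⊓ (F (Fin.castAdd t 3)).sub (b + 2)) := by
  obtain ⟨h₀, h₁, h₂, h₃, -⟩ := forall_append_four.mp hH.2
  rw [totalProblem_zero] at h₀
  rw [totalProblem_one] at h₁
  rw [totalProblem_two] at h₂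
  rw [totalProblem_three] at h₃
  refine ⟨le_finrank_inf_of_le (h₀.2 0 (by omega)) ?_, le_finrank_inf_of_le (h₀.2 a (by omega)) ?_,
    le_finrank_inf_of_le (h₁.2 1 (by omega)) ?_, le_finrank_inf_of_le (h₂.2 a (by omega)) ?_,
    le_finrank_inf_of_le (h₃.2 a (by omega)) ?_⟩
  · rw [ofRows_cons_zero]
    omega
  · obtain ⟨a, rfl⟩ : ∃ a', a = a' + 1 := ⟨a - 1, by omega⟩
    rw [ofRows_cons_replicate_succ, if_pos (by omega)]
    omega
  · simp [ofRows]
    omega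
  · rw [Pi.add_apply, ofRows_replicate, if_pos (by omega)]
    omega
  · rw [Pi.add_apply, ofRows_replicate, if_pos (by omega)]
    omega

namespace IsGeneral

/-- Counting in `H` gives lower bounds: `H` meets `F⁰_2` and `P`, which are independent, so `dim (H
∩ V) ≥ 2`, and this intersection meets each subspace that cuts `H` in codimension one. The upper
bound uses `inf_main` and `not_le_main`. -/
theorem isBasePlane_inf (hX : finrank K X = 4 + b) (ha : 0 < a) (hab : a + 2 ≤ b) (hb : 3 ≤ b)
    (hF : IsGeneral a b (totalProblem a b nu3 nu4 nu) F)
    (hH : H ∈ solutions (2 + a) (totalProblem a b nu3 nu4 nu) F) :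
    IsBasePlane b F (H ⊓ baseSpace b F) := by
  obtain ⟨c₀, c₀', c₁, c₂, c₃⟩ := finrank_inf_of_mem_solutions hX ha hab hH
  have hd := hH.1
  set P := (F (Fin.castAdd t 1)).sub 5 ⊓ (F (Fin.castAdd t 0)).sub (b + 1) with hP
  have hPV : P ≤ baseSpace b F := le_sup_right
  have h0V : (F (Fin.castAdd t 0)).sub 2 ≤ baseSpace b F := le_sup_left
  have p1 : 1 ≤ finrank K ↥(H ⊓ P) := by
    have h1 := finrank_add_le_finrank_inf (inf_le_left : H ⊓ (F (Fin.castAdd t 1)).sub 5 ≤ H)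
      (inf_le_left : H ⊓ (F (Fin.castAdd t 0)).sub (b + 1) ≤ H)
    rw [← inf_inf_distrib_left, ← hP] at h1
    omega
  have p2 : finrank K ↥(H ⊓ P) ≤ 1 := by
    have h1 := (F (Fin.castAdd t 1)).finrank_inf_succ_le (H ⊓ (F (Fin.castAdd t 0)).sub (b + 1)) 4
    have h2 : H ⊓ (F (Fin.castAdd t 0)).sub (b + 1) ⊓ (F (Fin.castAdd t 1)).sub 4 = ⊥ := by
      rw [inf_right_comm, hF.inf_main H hH]
    rw [h2, finrank_bot, inf_right_comm, inf_assoc] at h1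
    exact h1
  have h2 : 2 ≤ finrank K ↥(H ⊓ baseSpace b F) := by
    have h1 := Submodule.finrank_sup_add_finrank_inf_eq (H ⊓ (F (Fin.castAdd t 0)).sub 2) (H ⊓ P)
    have h3 : H ⊓ (F (Fin.castAdd t 0)).sub 2 ⊓ (H ⊓ P) = ⊥ := by
      rw [eq_bot_iff, ← hF.inf_eq_bot' hX hb]
      exact inf_le_inf inf_le_right (inf_le_right.trans inf_le_left)
    have h4 := Submodule.finrank_mono (sup_le (inf_le_inf_left H h0V) (inf_le_inf_left H hPV))
    rw [h3, finrank_bot] at h1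
    omega
  -- If `dim (H ∩ V) ≥ 3`, then, as `H ∩ P` is at most a line, `(H ∩ V) + P = V`. So `F⁰_2` would
  -- lie in `F¹_5 + H`.
  have h3 : finrank K ↥(H ⊓ baseSpace b F) ≤ 2 := by
    by_contra hc
    have h1 := Submodule.finrank_sup_add_finrank_inf_eq (H ⊓ baseSpace b F) P
    rw [inf_assoc, inf_eq_right.mpr hPV, hF.finrank_inf hX hb] at h1
    have h4 : H ⊓ baseSpace b F ⊔ P = baseSpace b F := by
      apply Submodule.eq_of_le_of_finrank_le (sup_le inf_le_right hPV)
      rw [hF.finrank_baseSpace hX hb]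
      omega
    apply hF.not_le_main H hH
    rw [← h4] at h0V
    refine h0V.trans (sup_le (inf_le_left.trans le_sup_right) (inf_le_left.trans le_sup_left))
  have hd2 : ∀ E : CompleteFlag K X, a + 1 ≤ finrank K ↥(H ⊓ E.sub (b + 2)) →
      1 ≤ finrank K ↥(H ⊓ baseSpace b F ⊓ E.sub (b + 2)) := by
    intro E hE
    have h1 := finrank_add_le_finrank_inf (inf_le_left : H ⊓ baseSpace b F ≤ H)
      (inf_le_left : H ⊓ E.sub (b + 2) ≤ H)
    rw [← inf_inf_distrib_left, ← inf_assoc] at h1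
    omega
  refine ⟨by omega, ?_, inf_le_right.trans (baseSpace_le hb), ?_, hd2 _ c₂, hd2 _ c₃⟩
  · rw [inf_assoc, inf_eq_right.mpr h0V]
    exact c₀
  · exact p1.trans (Submodule.finrank_mono (le_inf (inf_le_inf_left H hPV)
      (inf_le_right.trans inf_le_left)))

theorem le_liftSpace (hX : finrank K X = 4 + b) (ha : 0 < a) (hab : a + 2 ≤ b) (hb : 3 ≤ b)
    (hF : IsGeneral a b (totalProblem a b nu3 nu4 nu) F)
    (hH : H ∈ solutions (2 + a) (totalProblem a b nu3 nu4 nu) F) :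
    H ≤ liftSpace b F (H ⊓ baseSpace b F) := by
  obtain ⟨-, -, -, c₂, c₃⟩ := finrank_inf_of_mem_solutions hX ha hab hH
  have hh := hF.isBasePlane_inf hX ha hab hb hH
  have key : ∀ S : Submodule K X, a + 1 ≤ finrank K ↥(H ⊓ S) →
      finrank K ↥(H ⊓ baseSpace b F ⊓ S) = 1 → H ≤ S ⊔ H ⊓ baseSpace b F := by
    intro S hS hS1
    have h1 := Submodule.finrank_sup_add_finrank_inf_eq (H ⊓ S) (H ⊓ baseSpace b F)
    rw [← inf_inf_distrib_left, inf_comm S, ← inf_assoc, hS1, hh.finrank_eq] at h1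
    have h2 : H ⊓ S ⊔ H ⊓ baseSpace b F = H := by
      apply Submodule.eq_of_le_of_finrank_le (sup_le inf_le_left inf_le_left)
      rw [hH.1]
      omega
    conv_lhs => rw [← h2]
    exact sup_le_sup_right inf_le_right _
  exact le_inf (key _ c₂ (hh.finrank_inf₂ hX hb hF)) (key _ c₃ (hh.finrank_inf₃ hX hb hF))

end IsGeneral

/-- Once `h ≤ H ≤ L` and `H ∩ V = h`, every intersection dimension of `H` is the sum of one of its
image and one of `h`. The dimensions of the quotient chains then give exactly the index shifts of
the four comparison lemmas. -/
theorem IsBasePlane.mem_solutions_iff (hX : finrank K X = 4 + b) (ha : 0 < a) (hab : a + 2 ≤ b)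
    (hb : 3 ≤ b) (hnu : IsSchubertProblem a b (fiberProblem a b nu3 nu4 nu))
    (hF : IsGeneral a b (totalProblem a b nu3 nu4 nu) F) {h : Submodule K X}
    (hh : IsBasePlane b F h) (hHL : H ≤ liftSpace b F h) (hHV : H ⊓ baseSpace b F = h)
    (hH : finrank K H = 2 + a) {G : Fin (4 + t) → CompleteFlag K (X ⧸ baseSpace b F)}
    (hG : ∀ i, IsInduced (quotChain (F i) (baseSpace b F) (liftSpace b F h)) (G i)) :
    H ∈ solutions (2 + a) (totalProblem a b nu3 nu4 nu) F ↔
      H.map (baseSpace b F).mkQ ∈ solutions a (fiberProblem a b nu3 nu4 nu) G := by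
  have hV : h ≤ baseSpace b F := hHV ▸ inf_le_right
  have hhH : h ≤ H := hHV ▸ inf_le_left
  have hY : finrank K (X ⧸ baseSpace b F) = b := by
    have h1 := (baseSpace b F).finrank_quotient_add_finrank
    rw [hF.finrank_baseSpace hX hb] at h1
    omega
  have hM : finrank K (H.map (baseSpace b F).mkQ) = a := by
    have h1 := finrank_map_mkQ_add H (baseSpace b F)
    rw [inf_comm, hHV, hh.finrank_eq] at h1
    omega
  obtain ⟨-, -, p₂, p₃, p⟩ := forall_append_four.mp hnu.1
  rw [fiberProblem_two] at p₂
  rw [fiberProblem_three] at p₃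
  simp only [fiberProblem_natAdd] at p
  have key := fun i m => hh.finrank_inf_eq hX hb hF hV hHL hHV (hG i) m
  have hcol : ∀ S : Submodule K X, H ≤ S ⊔ h → finrank K ↥(h ⊓ S) = 1 →
      a + 1 ≤ finrank K ↥(H ⊓ S) := by
    intro S hS hS1
    have h1 : H ⊓ S ⊔ h = H := by
      rw [sup_comm, inf_comm, ← sup_inf_assoc_of_le _ hhH, sup_comm]
      exact inf_eq_right.mpr hS
    have h2 := Submodule.finrank_sup_add_finrank_inf_eq (H ⊓ S) h
    rw [h1, inf_right_comm, inf_eq_right.mpr hhH, hS1, hh.finrank_eq] at h2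
    omega
  have hiff : (∀ i, H ∈ schubertVariety (2 + a) (totalProblem a b nu3 nu4 nu i) (F i)) ↔
      ∀ i, H.map (baseSpace b F).mkQ ∈
        schubertVariety a (fiberProblem a b nu3 nu4 nu i) (G i) := by
    rw [forall_append_four, forall_append_four]
    simp only [totalProblem_zero, totalProblem_one, totalProblem_two, totalProblem_three,
      totalProblem_natAdd, fiberProblem_zero, fiberProblem_one, fiberProblem_two,
      fiberProblem_three, fiberProblem_natAdd]
    refine and_congr ?_ (and_congr ?_ (and_congr ?_ (and_congr ?_ (forall_congr' fun i => ?_))))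
    · refine mem_schubertVariety_iff_of_hook hX hY hab ha hH hM
        (hh.meet₀.trans (Submodule.finrank_mono (inf_le_inf_right _ hhH))) ?_
      rw [key, hh.finrank_quotChain₀ hX hb hF hV, inf_eq_left.mpr hh.le₀, hh.finrank_eq]
    · refine mem_schubertVariety_iff_of_two_rows hX hY hab ha hH hM ?_
      rw [key, hh.finrank_quotChain₁ hX hb hF hV, hh.finrank_inf₁ hX hb hF]
    · refine mem_schubertVariety_iff_of_column_add hX hY (by omega) hH hM p₂ (fun m hm => ?_)
        (hcol _ (hHL.trans inf_le_left) (hh.finrank_inf₂ hX hb hF))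
      rw [key, (hh.finrank_quotChain₂ hX hb hF hV m hm).1,
        (hh.finrank_quotChain₂ hX hb hF hV m hm).2, add_zero]
    · refine mem_schubertVariety_iff_of_column_add hX hY (by omega) hH hM p₃ (fun m hm => ?_)
        (hcol _ (hHL.trans inf_le_right) (hh.finrank_inf₃ hX hb hF))
      rw [key, (hh.finrank_quotChain₃ hX hb hF hV m hm).1,
        (hh.finrank_quotChain₃ hX hb hF hV m hm).2, add_zero]
    · refine mem_schubertVariety_iff_of_partition hX hY (by omega) hH hM (p i) fun m hm => ?_
      rw [key, (hh.finrank_quotChain hX hb hF hV i m hm).1,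
        (hh.finrank_quotChain hX hb hF hV i m hm).2, add_zero]
  exact ⟨fun h1 => ⟨hM, hiff.mp h1.2⟩, fun h1 => ⟨hH, hiff.mpr h1.2⟩⟩

end Solutions

/-! ### The flags of the fibration and the bijection of solutions. -/

section Bijection

variable {K X : Type*} [Field K] [AddCommGroup X] [Module K X] [FiniteDimensional K X]
  {a b t : ℕ} {nu3 nu4 : ℕ → ℕ} {nu : Fin t → ℕ → ℕ} {F : Fin (4 + t) → CompleteFlag K X}

/-- The flags in `baseSpace b F`. -/
noncomputable def baseFlags {t : ℕ} (F : Fin (4 + t) → CompleteFlag K X)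
    (V : Submodule K X) (i : Fin 4) : CompleteFlag K V :=
  inducedFlag (traceChain (F (Fin.castAdd t i)) V)

/-- The flags in the quotient by `baseSpace b F` that are attached to `h`. -/
noncomputable def fiberFlags (b : ℕ) {t : ℕ} (F : Fin (4 + t) → CompleteFlag K X)
    (V : Submodule K X) (h : Submodule K V) (i : Fin (4 + t)) : CompleteFlag K (X ⧸ V) :=
  inducedFlag (quotChain (F i) V (liftSpace b F (h.map V.subtype)))

theorem isInduced_baseFlags (F : Fin (4 + t) → CompleteFlag K X) (V : Submodule K X) (i : Fin 4) :
    IsInduced (traceChain (F (Fin.castAdd t i)) V) (baseFlags F V i) := by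
  obtain ⟨h1, h2, h3, h4⟩ := traceChain_spec (F (Fin.castAdd t i)) V
  exact isInduced_inducedFlag (exists_isInduced h1 h2 h3 h4)

theorem isInduced_fiberFlags {V : Submodule K X} {h : Submodule K V}
    (hL : liftSpace b F (h.map V.subtype) ⊔ V = ⊤) (i : Fin (4 + t)) :
    IsInduced (quotChain (F i) V (liftSpace b F (h.map V.subtype))) (fiberFlags b F V h i) := by
  obtain ⟨h1, h2, h3, h4⟩ := quotChain_spec (F i) hL
  exact isInduced_inducedFlag (exists_isInduced h1 h2 h3 h4)

theorem baseFlags_eq {V : Submodule K X} {E : Fin 4 → CompleteFlag K V}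
    (hE : ∀ i, IsInduced (traceChain (F (Fin.castAdd t i)) V) (E i)) : baseFlags F V = E := by
  funext i
  obtain ⟨-, h2, h3, h4⟩ := traceChain_spec (F (Fin.castAdd t i)) V
  exact (isInduced_baseFlags F V i).unique h2 h3 h4 (hE i)

theorem fiberFlags_eq {V : Submodule K X} {h : Submodule K V}
    (hL : liftSpace b F (h.map V.subtype) ⊔ V = ⊤) {G : Fin (4 + t) → CompleteFlag K (X ⧸ V)}
    (hG : ∀ i, IsInduced (quotChain (F i) V (liftSpace b F (h.map V.subtype))) (G i)) :
    fiberFlags b F V h = G := by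
  funext i
  obtain ⟨-, h2, h3, h4⟩ := quotChain_spec (F i) hL
  exact (isInduced_fiberFlags hL i).unique h2 h3 h4 (hG i)

set_option linter.unusedSectionVars false in
theorem map_mkQ_inf_comap {L V : Submodule K X} (hL : L ⊔ V = ⊤) (M : Submodule K (X ⧸ V)) :
    (L ⊓ M.comap V.mkQ).map V.mkQ = M := by
  apply le_antisymm
  · exact (Submodule.map_mono inf_le_right).trans (Submodule.map_comap_le _ _)
  · intro y hy
    obtain ⟨x, rfl⟩ := Submodule.mkQ_surjective V y
    have hx : x ∈ L ⊔ V := hL ▸ Submodule.mem_top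
    obtain ⟨l, hl, v, hv, rfl⟩ := Submodule.mem_sup.mp hx
    have h0 : V.mkQ v = 0 := (Submodule.Quotient.mk_eq_zero V).mpr hv
    rw [map_add, h0, add_zero] at hy ⊢
    exact ⟨l, ⟨hl, hy⟩, rfl⟩

namespace IsGeneral

variable (hX : finrank K X = 4 + b) (ha : 0 < a) (hab : a + 2 ≤ b) (hb : 3 ≤ b)
  (hF : IsGeneral a b (totalProblem a b nu3 nu4 nu) F)
include hX ha hab hb hF

theorem comap_mem_solutions {H : Submodule K X}
    (hH : H ∈ solutions (2 + a) (totalProblem a b nu3 nu4 nu) F) :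
    H.comap (baseSpace b F).subtype ∈
      solutions 2 (fun _ : Fin 4 => ofRows [1]) (baseFlags F (baseSpace b F)) := by
  rw [hF.mem_solutions_base_iff hX hb (isInduced_baseFlags F _), Submodule.map_comap_subtype,
    inf_comm]
  exact hF.isBasePlane_inf hX ha hab hb hH

variable (hnu : IsSchubertProblem a b (fiberProblem a b nu3 nu4 nu))
include hnu

theorem map_mem_solutions {H : Submodule K X}
    (hH : H ∈ solutions (2 + a) (totalProblem a b nu3 nu4 nu) F) :
    H.map (baseSpace b F).mkQ ∈ solutions a (fiberProblem a b nu3 nu4 nu)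
      (fiberFlags b F (baseSpace b F) (H.comap (baseSpace b F).subtype)) := by
  have hh := hF.isBasePlane_inf hX ha hab hb hH
  have hL := hF.le_liftSpace hX ha hab hb hH
  have e : (H.comap (baseSpace b F).subtype).map (baseSpace b F).subtype = H ⊓ baseSpace b F := by
    rw [Submodule.map_comap_subtype, inf_comm]
  refine (hh.mem_solutions_iff hX ha hab hb hnu hF hL rfl hH.1 fun i => ?_).mp hH
  have h1 := isInduced_fiberFlags (b := b) (F := F) (V := baseSpace b F)
    (h := H.comap (baseSpace b F).subtype)
    (by rw [e]; exact (hh.finrank_liftSpace hX hb hF inf_le_right).2) i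
  rwa [e] at h1

/-- The inverse sends `(h, M)` to the intersection of `L` with the preimage of `M`; since `L ∩ V =
h` and `L + V = X`, it has intersection `h` with `V` and image `M`. -/
theorem bijOn_solutions : Set.BijOn
    (fun H => (H.comap (baseSpace b F).subtype, H.map (baseSpace b F).mkQ))
    (solutions (2 + a) (totalProblem a b nu3 nu4 nu) F)
    {p | p.1 ∈ solutions 2 (fun _ : Fin 4 => ofRows [1]) (baseFlags F (baseSpace b F)) ∧
      p.2 ∈ solutions a (fiberProblem a b nu3 nu4 nu) (fiberFlags b F (baseSpace b F) p.1)} := by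
  refine ⟨fun H hH => ⟨hF.comap_mem_solutions hX ha hab hb hH,
    hF.map_mem_solutions hX ha hab hb hnu hH⟩, ?_, ?_⟩
  · have key : ∀ H ∈ solutions (2 + a) (totalProblem a b nu3 nu4 nu) F,
        H = liftSpace b F ((H.comap (baseSpace b F).subtype).map (baseSpace b F).subtype) ⊓
          (H.map (baseSpace b F).mkQ).comap (baseSpace b F).mkQ := by
      intro H hH
      rw [Submodule.map_comap_subtype, inf_comm (baseSpace b F), Submodule.comap_map_mkQ]
      have hL := hF.le_liftSpace hX ha hab hb hH
      rw [inf_comm, sup_comm, sup_inf_assoc_of_le _ hL, inf_comm,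
        (hF.isBasePlane_inf hX ha hab hb hH).liftSpace_inf hX hb hF inf_le_right]
      exact (sup_eq_left.mpr inf_le_left).symm
    intro H hH H' hH' heq
    simp only [Prod.mk.injEq] at heq
    rw [key H hH, key H' hH', heq.1, heq.2]
  · rintro ⟨h, M⟩ ⟨hh, hM⟩
    simp only at hh hM
    have hp := (hF.mem_solutions_base_iff hX hb (isInduced_baseFlags F _) h).mp hh
    have hV := Submodule.map_subtype_le (baseSpace b F) h
    have hLV := hp.liftSpace_inf hX hb hF hV
    have hL := (hp.finrank_liftSpace hX hb hF hV).2
    have e1 : liftSpace b F (h.map (baseSpace b F).subtype) ⊓ M.comap (baseSpace b F).mkQ ⊓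
        baseSpace b F = h.map (baseSpace b F).subtype := by
      rw [inf_assoc, inf_eq_right.mpr (Submodule.le_comap_mkQ _ M), hLV]
    have e2 := map_mkQ_inf_comap hL M
    have e3 : (liftSpace b F (h.map (baseSpace b F).subtype) ⊓ M.comap (baseSpace b F).mkQ).comap
        (baseSpace b F).subtype = h := by
      apply Submodule.map_injective_of_injective (baseSpace b F).injective_subtype
      rw [Submodule.map_comap_subtype, inf_comm, e1]
    refine ⟨_, (hp.mem_solutions_iff hX ha hab hb hnu hF inf_le_left e1 ?_
      (isInduced_fiberFlags hL)).mpr (by rwa [e2]), Prod.ext e3 e2⟩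
    have h1 := finrank_map_mkQ_add
      (liftSpace b F (h.map (baseSpace b F).subtype) ⊓ M.comap (baseSpace b F).mkQ) (baseSpace b F)
    rw [e2, inf_comm, e1, hp.finrank_eq, hM.1] at h1
    omega

end IsGeneral

end Bijection

/-! ### General flags in the base and in the fiber are attained. -/

section Dominance

variable {K X : Type*} [Field K] [AddCommGroup X] [Module K X]

theorem IsInduced.map {C : ℕ → Submodule K X} {E : CompleteFlag K X} (hE : IsInduced C E)
    (θ : X ≃ₗ[K] X) : IsInduced (fun m => (C m).map (θ : X →ₗ[K] X)) (E.map θ) := by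
  intro m
  rw [LinearEquiv.finrank_map_eq, CompleteFlag.map_sub, ← hE m]

theorem baseSpace_map {b t : ℕ} (F : Fin (4 + t) → CompleteFlag K X) (B : X ≃ₗ[K] X) :
    baseSpace b (fun i => (F i).map B) = (baseSpace b F).map (B : X →ₗ[K] X) := by
  simp only [baseSpace, CompleteFlag.map_sub]
  rw [Submodule.map_sup, Submodule.map_inf _ B.injective]

theorem exists_map_eq [FiniteDimensional K X] {V W : Submodule K X}
    (h : finrank K V = finrank K W) : ∃ B : X ≃ₗ[K] X, V.map (B : X →ₗ[K] X) = W := by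
  obtain ⟨B, hB⟩ := Submodule.exists_linearEquiv_restrict_eq (LinearEquiv.ofFinrankEq V W h)
  refine ⟨B, Submodule.eq_of_le_of_finrank_eq ?_ ?_⟩
  · rintro _ ⟨v, hv, rfl⟩
    have h1 := hB ⟨v, hv⟩
    simp only [LinearEquiv.coe_coe]
    rw [← h1]
    exact Subtype.prop _
  · rw [LinearEquiv.finrank_map_eq, h]

theorem traceChain_map (F : CompleteFlag K X) (V : Submodule K X) (A : X ≃ₗ[K] X)
    (θ : V ≃ₗ[K] V) (hA : ∀ v : V, A v = θ v) (m : ℕ) :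
    traceChain (F.map A) V m = (traceChain F V m).map (θ : V →ₗ[K] V) := by
  apply Submodule.map_injective_of_injective V.injective_subtype
  simp only [traceChain]
  ext x
  simp only [CompleteFlag.map_sub, Submodule.mem_map, Submodule.mem_comap]
  constructor
  · rintro ⟨y, ⟨z, hz, hzy⟩, rfl⟩
    obtain ⟨w, rfl⟩ := θ.surjective y
    have h1 : z = w := A.injective (hzy.trans (hA w).symm)
    exact ⟨θ w, ⟨w, by simpa [h1] using hz, rfl⟩, rfl⟩
  · rintro ⟨y, ⟨z, hz, rfl⟩, rfl⟩
    exact ⟨θ z, ⟨z, hz, hA z⟩, rfl⟩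

theorem quotChain_map (F : CompleteFlag K X) (V L : Submodule K X) (A : X ≃ₗ[K] X)
    (θ : (X ⧸ V) ≃ₗ[K] (X ⧸ V)) (hA : ∀ x, V.mkQ (A x) = θ (V.mkQ x))
    (hL : L.map (A : X →ₗ[K] X) = L) (m : ℕ) :
    quotChain (F.map A) V L m = (quotChain F V L m).map (θ : (X ⧸ V) →ₗ[K] (X ⧸ V)) := by
  simp only [quotChain]
  rw [CompleteFlag.map_sub]
  conv_lhs => rw [← hL]
  rw [← Submodule.map_inf _ A.injective, ← Submodule.map_comp, ← Submodule.map_comp]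
  congr 1
  exact LinearMap.ext hA

variable [FiniteDimensional K X] {a b t : ℕ} {lam : Fin (4 + t) → ℕ → ℕ}
  {F F' : Fin (4 + t) → CompleteFlag K X} {V : Submodule K X}

/-- Automorphisms that preserve the subspace attached to a general tuple of flags may be applied
independently to the flags. -/
theorem IsGeneral.baseSpace_eq (hX : finrank K X = 4 + b) (hb : 3 ≤ b)
    (hF : IsGeneral a b lam F) (hF' : IsGeneral a b lam F') (hV : baseSpace b F = V)
    {A₀ A₁ : X ≃ₗ[K] X} (h₀ : F' (Fin.castAdd t 0) = (F (Fin.castAdd t 0)).map A₀)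
    (h₁ : F' (Fin.castAdd t 1) = (F (Fin.castAdd t 1)).map A₁)
    (hA₀ : V.map (A₀ : X →ₗ[K] X) = V) (hA₁ : V.map (A₁ : X →ₗ[K] X) = V) :
    baseSpace b F' = V := by
  have e1 : (F' (Fin.castAdd t 0)).sub 2 ≤ V := by
    rw [h₀, CompleteFlag.map_sub, ← hA₀, ← hV]
    exact Submodule.map_mono le_sup_left
  have e2 : V ≤ (F' (Fin.castAdd t 0)).sub (b + 1) := by
    rw [h₀, CompleteFlag.map_sub, ← hA₀, ← hV]
    exact Submodule.map_mono (baseSpace_le hb)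
  have e3 : V ⊓ (F' (Fin.castAdd t 1)).sub 5 =
      (V ⊓ (F (Fin.castAdd t 1)).sub 5).map (A₁ : X →ₗ[K] X) := by
    rw [h₁, CompleteFlag.map_sub, Submodule.map_inf _ A₁.injective, hA₁]
  -- The new `F⁰_{b+1}` still contains `V`, so the new `P` contains the trace of the new `F¹_5` on
  -- `V`. That trace has dimension two, and by generality of `F'` so does the new `P`.
  have e4 : V ⊓ (F' (Fin.castAdd t 1)).sub 5 =
      (F' (Fin.castAdd t 1)).sub 5 ⊓ (F' (Fin.castAdd t 0)).sub (b + 1) := by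
    apply Submodule.eq_of_le_of_finrank_eq
    · exact le_inf inf_le_right (inf_le_left.trans e2)
    · rw [e3, LinearEquiv.finrank_map_eq, hF'.finrank_inf hX hb, ← hV, base_inf₁ hb,
        hF.finrank_inf hX hb]
  apply Submodule.eq_of_le_of_finrank_eq
  · refine sup_le e1 ?_
    rw [← e4]
    exact inf_le_left
  · rw [hF'.finrank_baseSpace hX hb, ← hV, hF.finrank_baseSpace hX hb]

theorem IsGeneral.isBasePlane_of_mem (hX : finrank K X = 4 + b) (hb : 3 ≤ b)
    (hF : IsGeneral a b lam F) (hV : baseSpace b F = V) {E : Fin 4 → CompleteFlag K V}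
    (hE : ∀ i, IsInduced (traceChain (F (Fin.castAdd t i)) V) (E i)) {h : Submodule K V}
    (hh : h ∈ solutions 2 (fun _ : Fin 4 => ofRows [1]) E) :
    IsBasePlane b F (h.map V.subtype) := by
  subst hV
  exact (hF.mem_solutions_base_iff hX hb hE h).mp hh

/-- General tuples of flags in `V` come from tuples of flags to which `V` is attached. -/
theorem generally_exists_baseFlags (hX : finrank K X = 4 + b) (hb : 3 ≤ b)
    (hne : (zariskiInterior (IsGeneral (K := K) (X := X) a b lam)).Nonempty)
    (hV : finrank K V = 4) :
    Generally fun E : Fin 4 → CompleteFlag K V => ∃ F ∈ zariskiInterior (IsGeneral a b lam),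
      baseSpace b F = V ∧ ∀ i, IsInduced (traceChain (F (Fin.castAdd t i)) V) (E i) := by
  obtain ⟨F₁, hF₁⟩ := hne
  -- One automorphism of `X`, applied to all flags, carries the attached subspace of some general
  -- tuple to the prescribed `V`.
  obtain ⟨B, hB⟩ := exists_map_eq (((zariskiInterior_subset hF₁).finrank_baseSpace hX hb).trans
    hV.symm)
  have hF := map_mem_zariskiInterior B (fun F hF => hF.map B) hF₁
  rw [← baseSpace_map] at hB
  generalize (fun i => (F₁ i).map B) = F at hF hB
  obtain ⟨π, hπ⟩ := V.subtype.exists_leftInverse_of_injective V.ker_subtype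
  have hπ' : ∀ v : V, π (V.subtype v) = v := fun v => LinearMap.congr_fun hπ v
  -- Only the first four flags move; the remaining ones do not affect the flags in `V`.
  refine (generally_extendAut hπ' hF (Fin.addCases some fun _ => none) (baseFlags F V)).mono ?_
  rintro _ ⟨θ, rfl, hF'⟩
  have hA : ∀ j (v : V), extendAut V.subtype π hπ' (θ j) v = θ j v := fun j v =>
    extendAut_apply_incl hπ' (θ j) v
  have hAV : ∀ j, V.map (extendAut V.subtype π hπ' (θ j) : X →ₗ[K] X) = V := by
    intro j
    apply Submodule.eq_of_le_of_finrank_eq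
    · rintro _ ⟨v, hv, rfl⟩
      have h1 := hA j ⟨v, hv⟩
      simp only [LinearEquiv.coe_coe]
      simp only at h1
      rw [h1]
      exact Subtype.prop _
    · exact LinearEquiv.finrank_map_eq _ _
  refine ⟨_, hF', ?_, fun i => ?_⟩
  · refine (zariskiInterior_subset hF).baseSpace_eq hX hb (zariskiInterior_subset hF') hB
      (A₀ := extendAut V.subtype π hπ' (θ 0)) (A₁ := extendAut V.subtype π hπ' (θ 1)) ?_ ?_
      (hAV 0) (hAV 1)
    · rw [Fin.addCases_left]; rfl
    · rw [Fin.addCases_left]; rfl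
  · simp only [Fin.addCases_left, Option.elim_some]
    have h1 := (isInduced_baseFlags F V i).map (θ i)
    simp only [← traceChain_map (F (Fin.castAdd t i)) V _ (θ i) (hA i)] at h1
    exact h1

/-- General tuples of flags in the quotient by `V` come from tuples of flags to which `V` and a
given tuple of flags in `V` are attached. -/
theorem generally_exists_fiberFlags (hX : finrank K X = 4 + b) (hb : 3 ≤ b)
    (hF : F ∈ zariskiInterior (IsGeneral a b lam)) (hV : baseSpace b F = V)
    {E : Fin 4 → CompleteFlag K V}
    (hE : ∀ i, IsInduced (traceChain (F (Fin.castAdd t i)) V) (E i)) {h : Submodule K V}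
    (hh : h ∈ solutions 2 (fun _ : Fin 4 => ofRows [1]) E) :
    Generally fun G : Fin (4 + t) → CompleteFlag K (X ⧸ V) =>
      ∃ F ∈ zariskiInterior (IsGeneral a b lam), baseSpace b F = V ∧ baseFlags F V = E ∧
        fiberFlags b F V h = G := by
  have hg := zariskiInterior_subset hF
  have hp := hg.isBasePlane_of_mem hX hb hV hE hh
  have hhV := Submodule.map_subtype_le V h
  obtain ⟨hLd, hL⟩ := hp.finrank_liftSpace hX hb hg (hV ▸ hhV)
  rw [hV] at hL
  set L := liftSpace b F (h.map V.subtype) with hLdef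
  -- A section of `X → X / V` with values in `L` turns automorphisms of the quotient into
  -- automorphisms of `X` that fix `V` pointwise and preserve `L`.
  obtain ⟨g, hg1⟩ := (V.mkQ.domRestrict L).exists_rightInverse_of_surjective (by
    rw [LinearMap.range_domRestrict, Submodule.map_mkQ_eq_top, sup_comm, hL])
  have hι : ∀ y, V.mkQ ((L.subtype ∘ₗ g) y) = y := fun y => LinearMap.congr_fun hg1 y
  refine (generally_extendAut hι hF some (fiberFlags b F V h)).mono ?_
  rintro _ ⟨θ, rfl, hF'⟩
  simp only [Option.elim_some] at hF'
  set A : Fin (4 + t) → X ≃ₗ[K] X := fun i => extendAut (L.subtype ∘ₗ g) V.mkQ hι (θ i) with hAdef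
  have hAV : ∀ i, ∀ v ∈ V, A i v = v := by
    intro i v hv
    have h1 : V.mkQ v = 0 := (Submodule.Quotient.mk_eq_zero V).mpr hv
    simp only [hAdef, extendAut_apply, h1, map_zero, sub_zero, add_zero]
  have hAL : ∀ i, L.map (A i : X →ₗ[K] X) = L := by
    intro i
    apply Submodule.eq_of_le_of_finrank_eq _ (LinearEquiv.finrank_map_eq _ _)
    rintro _ ⟨l, hl, rfl⟩
    simp only [LinearEquiv.coe_coe, hAdef, extendAut_apply]
    exact L.add_mem (L.sub_mem hl (g _).2) (g _).2
  have hAW : ∀ i, ∀ W ≤ V, W.map (A i : X →ₗ[K] X) = W := by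
    intro i W hW
    apply Submodule.eq_of_le_of_finrank_eq _ (LinearEquiv.finrank_map_eq _ _)
    rintro _ ⟨w, hw, rfl⟩
    simp only [LinearEquiv.coe_coe, hAV i w (hW hw)]
    exact hw
  have hg' := zariskiInterior_subset hF'
  have hV' := hg.baseSpace_eq hX hb hg' hV rfl rfl (hAW _ V le_rfl) (hAW _ V le_rfl)
  have hE' : ∀ i, IsInduced (traceChain ((F (Fin.castAdd t i)).map (A (Fin.castAdd t i))) V)
      (E i) := by
    intro i m
    rw [traceChain_map _ V _ (LinearEquiv.refl K V) fun v => hAV _ v v.2]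
    have h1 : (traceChain (F (Fin.castAdd t i)) V m).map (LinearEquiv.refl K V : V →ₗ[K] V) =
      traceChain (F (Fin.castAdd t i)) V m := Submodule.map_id _
    rw [h1]
    exact hE i m
  have hp' := hg'.isBasePlane_of_mem hX hb hV' hE' hh
  obtain ⟨hLd', -⟩ := hp'.finrank_liftSpace hX hb hg' (by rw [hV']; exact hhV)
  -- Each automorphism preserves `L` and `h`, so `L` still lies in both moved spaces `F_{b+2} + h`;
  -- equality follows because the new `liftSpace` has the same dimension.
  have hLL : liftSpace b (fun i => (F i).map (A i)) (h.map V.subtype) = L := by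
    symm
    apply Submodule.eq_of_le_of_finrank_eq _ (hLd.trans hLd'.symm)
    have key : ∀ i, L ≤ (F i).sub (b + 2) ⊔ h.map V.subtype →
        L ≤ ((F i).map (A i)).sub (b + 2) ⊔ h.map V.subtype := by
      intro i hi
      rw [← hAL i, ← hAW i _ hhV, CompleteFlag.map_sub, ← Submodule.map_sup]
      exact Submodule.map_mono hi
    exact le_inf (key _ inf_le_left) (key _ inf_le_right)
  refine ⟨_, hF', hV', baseFlags_eq hE', fiberFlags_eq (by rw [hLL]; exact hL) fun i => ?_⟩
  rw [hLL]
  have h1 := (isInduced_fiberFlags (F := F) hL i).map (θ i)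
  simp only [← hLdef] at h1
  simp only [← quotChain_map (F i) V L (A i) (θ i)
    (fun x => retract_extendAut_apply hι (θ i) x) (hAL i)] at h1
  exact h1

end Dominance

/-! ### Assembly of the fibration. -/

section Fibration

variable {K : Type*} [Field K]

/-- The subspace and the flags attached to a tuple of flags. -/
noncomputable def fibrationDatum (b : ℕ) {t : ℕ}
    (F : Fin (4 + t) → CompleteFlag K (Fin (4 + b) → K)) : FibrationDatum K (4 + b) 4 (4 + t) where
  V := baseSpace b F
  E := baseFlags F (baseSpace b F)
  G := fiberFlags b F (baseSpace b F)

theorem fibrationDatum_eq {b t : ℕ} {F : Fin (4 + t) → CompleteFlag K (Fin (4 + b) → K)}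
    {V : Submodule K (Fin (4 + b) → K)} {E : Fin 4 → CompleteFlag K V}
    (hV : baseSpace b F = V) (hE : baseFlags F V = E) :
    fibrationDatum b F = ⟨V, E, fiberFlags b F V⟩ := by
  subst hV
  subst hE
  rfl

theorem isFibered_totalProblem [Infinite K] {a b t : ℕ} (ha : 0 < a) (hab : a + 2 ≤ b)
    (hb : 3 ≤ b) {nu3 nu4 : ℕ → ℕ} {nu : Fin t → ℕ → ℕ}
    (hnu : IsSchubertProblem a b (fiberProblem a b nu3 nu4 nu)) :
    IsFibered K 2 4 a b (totalProblem a b nu3 nu4 nu) (fun _ : Fin 4 => ofRows [1])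
      (fiberProblem a b nu3 nu4 nu) := by
  have hX : finrank K (Fin (4 + b) → K) = 4 + b := finrank_fin_fun K
  have hne := (onFrames_isGeneral (K := K) hX hab ha _
    (isSchubertProblem_totalProblem ha hab hnu)
    (by rw [totalProblem_zero, ofRows_cons_zero])
    (by
      obtain ⟨a, rfl⟩ : ∃ a', a = a' + 1 := ⟨a - 1, by omega⟩
      rw [totalProblem_zero, ofRows_cons_replicate_succ, if_pos (by omega)])
    (by rw [totalProblem_one, ofRows_cons_zero]) (by rw [totalProblem_one]; rfl)).nonempty_interior
  -- The open set is the Zariski interior of `IsGeneral`, nonempty because the conditions hold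
  -- outside a hypersurface in the space of frames.
  refine ⟨_, fibrationDatum b, isZariskiOpen_interior _, hne, ?_, ?_, ?_, fun V hV => ⟨?_, ?_⟩⟩
  · intro F hF
    have hg := zariskiInterior_subset hF
    exact ⟨hg.finrank_baseSpace hX hb, fun H hH => hg.comap_mem_solutions hX ha hab hb hH⟩
  · rintro F hF _ - H hH rfl
    exact (zariskiInterior_subset hF).map_mem_solutions hX ha hab hb hnu hH
  · intro F hF
    exact (zariskiInterior_subset hF).bijOn_solutions hX ha hab hb hnu
  · refine (generally_exists_baseFlags hX hb hne hV).mono ?_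
    rintro E ⟨F, hF, hFV, hE⟩
    exact ⟨F, hF, _, fibrationDatum_eq hFV (baseFlags_eq hE)⟩
  · refine (generally_exists_baseFlags hX hb hne hV).mono ?_
    rintro E ⟨F, hF, hFV, hE⟩ h hh
    refine (generally_exists_fiberFlags hX hb hF hFV hE hh).mono ?_
    rintro G ⟨F', hF', hFV', hE', hG⟩
    exact ⟨F', hF', _, fibrationDatum_eq hFV' hE', hG⟩

end Fibration

end Schubert

theorem theorem3p12 {K : Type*} [Field K] [IsAlgClosed K] [CharZero K]
    (a b : ℕ) (ha : 0 < a) (hab : a < b) (hb : 3 ≤ b)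
    (nu3 nu4 : ℕ → ℕ) {t : ℕ} (nu : Fin t → ℕ → ℕ)
    (hnu : IsSchubertProblem a b
      (Fin.append ![ofRows (List.replicate (a - 1) 2), ofRows [b - a - 1], nu3, nu4] nu)) :
    IsSchubertProblem (2 + a) (4 + b)
      (Fin.append ![ofRows ((b - a + 1) :: List.replicate a 2), ofRows [b - a - 1, b - a - 1],
        ofRows (List.replicate (a + 1) 1) + nu3, ofRows (List.replicate (a + 1) 1) + nu4] nu) ∧
    IsFibered K 2 4 a b
      (Fin.append ![ofRows ((b - a + 1) :: List.replicate a 2), ofRows [b - a - 1, b - a - 1],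
        ofRows (List.replicate (a + 1) 1) + nu3, ofRows (List.replicate (a + 1) 1) + nu4] nu)
      (fun _ : Fin 4 => ofRows [1])
      (Fin.append ![ofRows (List.replicate (a - 1) 2), ofRows [b - a - 1], nu3, nu4] nu) := by
  have hab' := add_two_le_of_fiberProblem hab hb hnu
  have : Infinite K := IsAlgClosed.instInfinite
  exact ⟨isSchubertProblem_totalProblem ha hab' hnu, isFibered_totalProblem ha hab' hb hnu⟩
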